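/- Let $\langle\xi\rangle=(1+|\xi|^2)^{1/2}$. For $m\in\mathbb R$ let $S^m=S^m(\mathbb R^d)$ be the space of all $f\in C^\infty(\mathbb R^d\times\mathbb R^d)$ with $\sup_{x,\xi}\langle\xi\rangle^{|\beta|-m}|\partial_x^\alpha\partial_\xi^\beta f(x,\xi)|<\infty$ for all multi-indices $\alpha,\beta$. Let $BC^\infty(\mathbb R^d)$ be the space of smooth functions that are bounded together with all their derivatives. Let $B=\frac12\sum_{j,k}B_{jk}\,dx_j\wedge dx_k$ (with $B_{jk}=-B_{kj}$ real) be a closed $2$-form on $\mathbb R^d$ with $B_{jk}\in BC^\infty(\mathbb R^d)$, and let $A=\sum_jA_j\,dx_j$ be a vector potential, $B=dA$, whose components $A_j$ are real, smooth and polynomially bounded together with all their derivatives. Put $$\omega^A(x,y)=\exp\Big\{-i\int_{[x,y]}A\Big\},\qquad \int_{[x,y]}A=-\Big\langle x-y,\int_0^1A((1-s)x+sy)\,ds\Big\rangle .$$ Let $U\in C^\infty(\mathbb R^d\times\mathbb R^d)$ be real, $U(x,\eta)=\langle x,\eta\rangle+\mathsf d(x,\eta)$, where $\partial_{x_j}\mathsf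 d\in S^1$ and $\partial_{\eta_j}\mathsf d\in S^0$ for $1\le j\le d$, and suppose that there is $\delta\in[0,1)$ such that the operator norm of the matrix $\nabla^2_{x,\eta}\mathsf d(x,\eta)$ of mixed second derivatives is at most $\delta$ for all $(x,\eta)$. ($U$ is the generating function of a symplectomorphism $\Phi$ of $T^*\mathbb R^d$ whose graph is $\{((x,\nabla_xU(x,\eta)),(\nabla_\eta U(x,\eta),\eta))\}$.) For complex-valued symbols $a,b$ of any order, and for $u\in\mathcal S(\mathbb R^d)$, $x\in\mathbb R^d$, define the magnetic Fourier integral operator and the magnetic pseudodifferential operator by the oscillating integrals $$[\mathfrak{Op}^A_\Phi(a)u](x)=(2\pi)^{-d}\int\!\!\int e^{i(U(x,\eta)-\langle y,\eta\rangle)}\,\omega^A(x,y)\,a(x,\eta)\,u(y)\,dy\,d\eta,$$ $$[b^A(x,D)u](x)=(2\pi)^{-d}\int\!\!\int e^{i\langle x-y,\eta\rangle}\,\omega^A(x,y)\,b(x,\eta)\,u(y)\,dy\,d\eta,$$ that is, as the limit for $\epsilon\searrow0$ of the absolutely convergent integrals with the additional factor $\psi(\epsilon\eta)$, for any $\psi\in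 C_0^\infty(\mathbb R^d)$ equal to $1$ on $|\eta|\le1$. **Theorem.** Let $m',m''\in\mathbb R$, $a\in S^{m''}$ and $b\in S^{m'}$. Then $\mathfrak{Op}^A_\Phi(a)$ and $b^A(x,D)$ are well-defined continuous linear operators on $\mathcal S(\mathbb R^d)$, and there is a symbol $c\in S^{m'+m''}$ such that $$\mathfrak{Op}^A_\Phi(a)\circ b^A(x,D)=\mathfrak{Op}^A_\Phi(c)\quad\text{on }\mathcal S(\mathbb R^d).$$ Moreover $$c(x,\xi)-a(x,\xi)\,b\big(\nabla_\xi U(x,\xi),\xi\big)\in S^{m'+m''-1}.$$ -/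

import Mathlib

open Set Filter Topology MeasureTheory
open scoped ContDiff SchwartzMap

noncomputable section

namespace MagneticFIO

/-- The configuration space `ℝ^d` with its Euclidean structure. -/
abbrev Cfg (d : ℕ) : Type := EuclideanSpace ℝ (Fin d)

/-- Phase space `ℝ^d × ℝ^d`; the first factor is the position `x`, the second the momentum `ξ`. -/
abbrev Phase (d : ℕ) : Type := Cfg d × Cfg d

variable {d : ℕ}

/-! ### Symbols -/

/-- The Japanese bracket `⟨ξ⟩ = (1 + |ξ|²)^(1/2)`. -/
def bracket (ξ : Cfg d) : ℝ := Real.sqrt (1 + ‖ξ‖ ^ 2)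

/-- The coordinate direction of a first order partial derivative on phase space:
`Sum.inl j` stands for `∂/∂x_j`, and `Sum.inr j` for `∂/∂ξ_j`. -/
def dir : Fin d ⊕ Fin d → Phase d
  | Sum.inl j => (EuclideanSpace.single j 1, 0)
  | Sum.inr j => (0, EuclideanSpace.single j 1)

/-- First order partial derivative on phase space. -/
def pderiv {F : Type*} [NormedAddCommGroup F] [NormedSpace ℝ F]
    (i : Fin d ⊕ Fin d) (f : Phase d → F) : Phase d → F :=
  fun p => fderiv ℝ f p (dir i)

/-- Iterated partial derivative `∂_{i₁} ∂_{i₂} ⋯ ∂_{iₙ} f` along a word of directions. For smooth `f`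
the order of the letters does not matter, so these are exactly the derivatives `∂_x^α ∂_ξ^β f`,
with `α_j` the number of letters `inl j` and `β_j` the number of letters `inr j`. -/
def iterPderiv {F : Type*} [NormedAddCommGroup F] [NormedSpace ℝ F] :
    List (Fin d ⊕ Fin d) → (Phase d → F) → Phase d → F
  | [], f => f
  | i :: L, f => pderiv i (iterPderiv L f)

/-- The order `|β|` of differentiation in the momentum variable of a word of directions. -/
def momentumOrder (L : List (Fin d ⊕ Fin d)) : ℕ := L.countP Sum.isRight

/-- The symbol class `S^m(ℝ^d)`: smooth `f(x,ξ)` such that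
`sup_{x,ξ} ⟨ξ⟩^(|β| - m) |∂_x^α ∂_ξ^β f(x,ξ)| < ∞` for all multi-indices `α`, `β`. -/
structure IsSymbol {F : Type*} [NormedAddCommGroup F] [NormedSpace ℝ F]
    (m : ℝ) (f : Phase d → F) : Prop where
  smooth : ContDiff ℝ ∞ f
  bound : ∀ L : List (Fin d ⊕ Fin d), ∃ C : ℝ, ∀ x ξ : Cfg d,
    bracket ξ ^ ((momentumOrder L : ℝ) - m) * ‖iterPderiv L f (x, ξ)‖ ≤ C

/-- The class `S^+`: smooth functions with `∂_{x_j} f ∈ S^1` and `∂_{ξ_j} f ∈ S^0` for all `j`. -/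
structure IsSPlus (f : Phase d → ℝ) : Prop where
  smooth : ContDiff ℝ ∞ f
  deriv_x : ∀ j : Fin d, IsSymbol 1 (pderiv (Sum.inl j) f)
  deriv_xi : ∀ j : Fin d, IsSymbol 0 (pderiv (Sum.inr j) f)

/-! ### Generating functions -/

/-- The gradient `∇_ξ f(x,ξ)` in the momentum variable. -/
def gradXi (f : Phase d → ℝ) (p : Phase d) : Cfg d :=
  gradient (fun ξ : Cfg d => f (p.1, ξ)) p.2

/-- The part `U(x,η) - ⟨x,η⟩` of a generating function. -/
def nonlinearPart (U : Phase d → ℝ) : Phase d → ℝ :=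
  fun p => U p - inner ℝ p.1 p.2

/-- The standing assumption on generating functions: `U` is real and smooth,
`U(x,η) = ⟨x,η⟩ + d(x,η)` with `d ∈ S^+`, and for some `δ ∈ [0,1)` the matrix
`∇²_{x,η} d(x,η)` of mixed second derivatives has norm at most `δ` everywhere. Such a `U` is the
generating function of a symplectomorphism `Φ`, whose graph is
`{((x, ∇_x U(x,η)), (∇_η U(x,η), η))}`. -/
structure IsGenerating (U : Phase d → ℝ) : Prop where
  smooth : ContDiff ℝ ∞ U
  sPlus : IsSPlus (nonlinearPart U)
  mixed : ∃ δ ∈ Ico (0 : ℝ) 1, ∀ x η : Cfg d,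
    ‖fderiv ℝ (fun x' : Cfg d => gradXi (nonlinearPart U) (x', η)) x‖ ≤ δ

/-! ### Magnetic fields and vector potentials -/

/-- The class `BC^∞(ℝ^d)`: smooth functions bounded together with all their derivatives. -/
def IsBCInfty (f : Cfg d → ℝ) : Prop :=
  ContDiff ℝ ∞ f ∧ ∀ n : ℕ, ∃ C : ℝ, ∀ x : Cfg d, ‖iteratedFDeriv ℝ n f x‖ ≤ C

/-- The partial derivative `∂_j f` of a function on configuration space. -/
def partialX (j : Fin d) (f : Cfg d → ℝ) : Cfg d → ℝ :=
  fun x => fderiv ℝ f x (EuclideanSpace.single j 1)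

/-- A magnetic field `B = (1/2) ∑ B_{jk} dx_j ∧ dx_k`, given by its components:
a closed `2`-form with components in `BC^∞`. -/
structure IsMagneticField (B : Fin d → Fin d → Cfg d → ℝ) : Prop where
  antisymm : ∀ j k x, B j k x = -B k j x
  bounded : ∀ j k, IsBCInfty (B j k)
  closed : ∀ i j k x,
    partialX i (B j k) x + partialX j (B k i) x + partialX k (B i j) x = 0

/-- `A = ∑ A_j dx_j` is a vector potential of `B`: its components are smooth and polynomially
bounded together with all their derivatives, and `B = dA`. -/
structure IsVectorPotential (A : Cfg d → Cfg d) (B : Fin d → Fin d → Cfg d → ℝ) : Prop where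
  temperate : Function.HasTemperateGrowth A
  curl : ∀ j k x,
    B j k x = partialX j (fun y => A y k) x - partialX k (fun y => A y j) x

/-- The circulation `∫_{[x,y]} A = -⟨x - y, ∫₀¹ A((1-s)x + sy) ds⟩` of `A` along the segment
from `x` to `y`. -/
def circulation (A : Cfg d → Cfg d) (x y : Cfg d) : ℝ :=
  -inner ℝ (x - y) (∫ s in (0 : ℝ)..1, A ((1 - s) • x + s • y))

/-- `ω^A(x,y) = exp(-i ∫_{[x,y]} A)`. -/
def omegaA (A : Cfg d → Cfg d) (x y : Cfg d) : ℂ :=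
  Complex.exp (-Complex.I * (circulation A x y : ℂ))

/-! ### Oscillating integrals and the operators -/

/-- A cut-off function: smooth, compactly supported, equal to `1` on the closed unit ball. -/
def IsCutoff (ψ : Cfg d → ℂ) : Prop :=
  ContDiff ℝ ∞ ψ ∧ HasCompactSupport ψ ∧ ∀ η : Cfg d, ‖η‖ ≤ 1 → ψ η = 1

/-- The oscillating integral `(2π)^{-d} ∫∫ K(y,η) dy dη` exists and has the value `v`: for every
cut-off function `ψ`, the integrals of `ψ(εη) K(y,η)` over `ℝ^d × ℝ^d` converge absolutely and,
divided by `(2π)^d`, tend to `v` as `ε ↘ 0`. -/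
def HasOscIntegral (K : Cfg d → Cfg d → ℂ) (v : ℂ) : Prop :=
  ∀ ψ : Cfg d → ℂ, IsCutoff ψ →
    (∀ ε : ℝ, 0 < ε →
      Integrable (fun q : Cfg d × Cfg d => ψ (ε • q.2) * K q.1 q.2) volume) ∧
    Tendsto (fun ε : ℝ => (((2 * Real.pi) ^ d : ℝ) : ℂ)⁻¹ *
        ∫ q : Cfg d × Cfg d, ψ (ε • q.2) * K q.1 q.2)
      (𝓝[>] (0 : ℝ)) (𝓝 v)

/-- `T` is the magnetic Fourier integral operator with generating function `U` and symbol `a`: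
`(T u)(x) = (2π)^{-d} ∫∫ e^{i(U(x,η) - ⟨y,η⟩)} ω^A(x,y) a(x,η) u(y) dy dη`, as an
oscillating integral. -/
def IsMagneticFIO (A : Cfg d → Cfg d) (U : Phase d → ℝ) (a : Phase d → ℂ)
    (T : 𝓢(Cfg d, ℂ) →L[ℂ] 𝓢(Cfg d, ℂ)) : Prop :=
  ∀ (u : 𝓢(Cfg d, ℂ)) (x : Cfg d), HasOscIntegral
    (fun y η => Complex.exp (Complex.I * ((U (x, η) - inner ℝ y η : ℝ) : ℂ)) *
      omegaA A x y * a (x, η) * u y) (T u x)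

/-- `T = b^A(x,D)` is the magnetic pseudodifferential operator with left symbol `b`:
`(T u)(x) = (2π)^{-d} ∫∫ e^{i⟨x - y,η⟩} ω^A(x,y) b(x,η) u(y) dy dη`, as an
oscillating integral. -/
def IsMagneticPsiDO (A : Cfg d → Cfg d) (b : Phase d → ℂ)
    (T : 𝓢(Cfg d, ℂ) →L[ℂ] 𝓢(Cfg d, ℂ)) : Prop :=
  ∀ (u : 𝓢(Cfg d, ℂ)) (x : Cfg d), HasOscIntegral
    (fun y η => Complex.exp (Complex.I * ((inner ℝ (x - y) η : ℝ) : ℂ)) *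
      omegaA A x y * b (x, η) * u y) (T u x)

theorem exists_isCutoff : ∃ ψ : Cfg d → ℂ, IsCutoff ψ := by
  let f : ContDiffBump (0 : Cfg d) := ⟨1, 2, one_pos, one_lt_two⟩
  refine ⟨fun η => (f η : ℂ), ?_, ?_, ?_⟩
  · exact Complex.ofRealCLM.contDiff.comp f.contDiff
  · exact f.hasCompactSupport.comp_left (g := fun r : ℝ => (r : ℂ)) (by simp)
  · intro η hη
    have : f η = 1 := f.one_of_mem_closedBall (by simpa using hη)
    simp [this]

/-- The value of an oscillating integral is unique. -/
theorem HasOscIntegral.unique {K : Cfg d → Cfg d → ℂ} {v w : ℂ}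
    (hv : HasOscIntegral K v) (hw : HasOscIntegral K w) : v = w := by
  obtain ⟨ψ, hψ⟩ := exists_isCutoff (d := d)
  exact tendsto_nhds_unique (hv ψ hψ).2 (hw ψ hψ).2

/-- There is at most one magnetic Fourier integral operator with given data. -/
theorem IsMagneticFIO.unique {A : Cfg d → Cfg d} {U : Phase d → ℝ} {a : Phase d → ℂ}
    {S T : 𝓢(Cfg d, ℂ) →L[ℂ] 𝓢(Cfg d, ℂ)}
    (hS : IsMagneticFIO A U a S) (hT : IsMagneticFIO A U a T) : S = T := by
  ext u x
  exact (hS u x).unique (hT u x)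

/-- There is at most one magnetic pseudodifferential operator with given data. -/
theorem IsMagneticPsiDO.unique {A : Cfg d → Cfg d} {b : Phase d → ℂ}
    {S T : 𝓢(Cfg d, ℂ) →L[ℂ] 𝓢(Cfg d, ℂ)}
    (hS : IsMagneticPsiDO A b S) (hT : IsMagneticPsiDO A b T) : S = T := by
  ext u x
  exact (hS u x).unique (hT u x)

end MagneticFIO

end

open Set Filter Topology MeasureTheory
open scoped ContDiff SchwartzMap

noncomputable section

namespace MagneticFIO

/-! Place the variables of the composed kernel at `x`, `x + y`, `x + y + z`, and write `Y = (y, z)`,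
`H = (η, ζ)`. The product `ω^A(x, x+y) ω^A(x+y, x+y+z)` equals `ω^A(x, x+y+z)` times `e^{-i flux}`,
where the flux is that of `B` through the triangle on these points. Insert Fourier inversion for
`ω^A(x, ·) u` and translate both inner momenta by the new variable `ξ`. The phase becomes `U(x,ξ) +
[𝖽(x,ξ+η) - 𝖽(x,ξ)] - ⟨y,η⟩ - ⟨z,ζ⟩`, so the composition is the Fourier integral operator with
symbol `c(x,ξ) = (2π)^{-2d} ∫∫ e^{-i(⟨y,η⟩+⟨z,ζ⟩)} e^{i[𝖽(x,ξ+η)-𝖽(x,ξ)]} a(x,ξ+η) b(x+y,ξ+ζ) e^{-i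
flux} dY dH`.

This integral is only oscillatory. The class `Amp μ a b` consists of functions of size `⟨ξ⟩^μ
(1+|Y|)^a (1+|H|)^b` whose derivatives obey a fixed accounting: an `H`-derivative costs nothing, a
`Y`-derivative costs `(1+|Y|)²`, an `x`- or `ξ`-derivative costs `(1+|Y|)² (1+|H|)²`, and a
`ξ`-derivative also gains `⟨ξ⟩⁻¹`. Integration by parts in `Y` gains decay in `H` at the price of
growth in `Y`; integration by parts in `H` then gains decay in `Y` for free. Hence the integral
makes sense (`osc`), and it is a symbol of order `μ` (`isSymbol_osc`).

The integrand above is such an amplitude of order `m' + m''` (`amp_fullAmp`). By Stokes the flux is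
bilinear in `y`, `z` with coefficients bounded together with all derivatives, whatever the growth of
`A` (`amp_triangle`). The phase difference is controlled because the first derivatives of `𝖽` are
symbols (`IsSPlus.amp_cexp_phaseDiff`).

For the leading term, replace `𝖽(x,ξ+η) - 𝖽(x,ξ)` by `⟨η, ∇_ξ 𝖽(x,ξ)⟩` and evaluate `a`, `b` at
momentum `ξ`. The error is an amplitude of order `m' + m'' - 1` (`exists_amp_sub`). In the
simplified integral the `H`-integration is Fourier inversion: it sets `y = ∇_ξ 𝖽(x,ξ)`, `z = 0`,
where the triangle degenerates, and leaves `a(x,ξ) b(∇_ξ U(x,ξ), ξ)` (`osc_modelAmp`).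

The formal computation is justified with four independent cut-offs: the identity holds by Fubini
while all are active (`integral_leftKer_mul_innerKer`), and they are removed one at a time
(`fioInt_fioInt`). Continuity on `𝓢` comes from the rapid decay of the partial Fourier transform of
`ω^A(x,·)u` and integration by parts in `η` (`rapidN_fioInt`). -/

section

/-! ### Families of smooth functions with weighted derivative estimates. -/

section Controlled

variable {E ι T : Type*} [NormedAddCommGroup E] [NormedSpace ℝ E]

/-- The derivative of `f` in the direction `v`. -/
def dirDeriv (v : E) (f : E → ℂ) (p : E) : ℂ := fderiv ℝ f p v

theorem contDiff_dirDeriv {f : E → ℂ} (hf : ContDiff ℝ ∞ f) (v : E) :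
    ContDiff ℝ ∞ (dirDeriv v f) :=
  (hf.fderiv_right (m := ∞) (by simp)).clm_apply contDiff_const

theorem _root_.ContDiff.diff_at {F : Type*} [NormedAddCommGroup F] [NormedSpace ℝ F] {f : E → F}
    (hf : ContDiff ℝ ∞ f) (p : E) : DifferentiableAt ℝ f p :=
  hf.differentiable (by simp) p

theorem dirDeriv_add {f h : E → ℂ} (hf : ContDiff ℝ ∞ f) (hh : ContDiff ℝ ∞ h) (v : E) :
    dirDeriv v (fun p => f p + h p) = fun p => dirDeriv v f p + dirDeriv v h p := by
  funext p
  simp [dirDeriv, fderiv_fun_add (hf.diff_at p) (hh.diff_at p)]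

theorem dirDeriv_const_mul {f : E → ℂ} (hf : ContDiff ℝ ∞ f) (c : ℂ) (v : E) :
    dirDeriv v (fun p => c * f p) = fun p => c * dirDeriv v f p := by
  funext p
  simp [dirDeriv, fderiv_const_mul (hf.diff_at p) c]

theorem dirDeriv_mul {f h : E → ℂ} (hf : ContDiff ℝ ∞ f) (hh : ContDiff ℝ ∞ h) (v : E) :
    dirDeriv v (fun p => f p * h p) = fun p => dirDeriv v f p * h p + f p * dirDeriv v h p := by
  funext p
  simp only [dirDeriv, fderiv_fun_mul (hf.diff_at p) (hh.diff_at p)]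
  simp [add_comm, mul_comm]

theorem dirDeriv_cexp {f : E → ℂ} (hf : ContDiff ℝ ∞ f) (v : E) :
    dirDeriv v (fun p => Complex.exp (f p)) = fun p => dirDeriv v f p * Complex.exp (f p) := by
  funext p
  simp [dirDeriv, ((hf.diff_at p).hasFDerivAt.cexp).fderiv, mul_comm]

theorem dirDeriv_sum {κ : Type*} (s : Finset κ) {f : κ → E → ℂ}
    (hf : ∀ k ∈ s, ContDiff ℝ ∞ (f k)) (v : E) :
    dirDeriv v (fun p => ∑ k ∈ s, f k p) = fun p => ∑ k ∈ s, dirDeriv v (f k) p := by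
  funext p
  simp [dirDeriv, fderiv_fun_sum fun k hk => (hf k hk).diff_at p]

theorem dirDeriv_const (c : ℂ) (v : E) : dirDeriv v (fun _ => c) = fun _ => 0 := by
  funext p
  simp [dirDeriv]

theorem dirDeriv_congr_eventually {f h : E → ℂ} {p : E} (hfh : f =ᶠ[𝓝 p] h) (v : E) :
    dirDeriv v f p = dirDeriv v h p := by
  simp [dirDeriv, hfh.fderiv_eq]

theorem dirDeriv_comm {f : E → ℂ} (hf : ContDiff ℝ ∞ f) (u v : E) :
    dirDeriv u (dirDeriv v f) = dirDeriv v (dirDeriv u f) := by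
  funext p
  have hd : DifferentiableAt ℝ (fderiv ℝ f) p :=
    (hf.fderiv_right (m := ∞) (by simp)).diff_at p
  have hs : IsSymmSndFDerivAt ℝ f p := hf.contDiffAt.isSymmSndFDerivAt (by rw [minSmoothness_of_isRCLikeNormedField]; exact ENat.LEInfty.out)
  have key : ∀ a b : E, dirDeriv a (dirDeriv b f) p = fderiv ℝ (fderiv ℝ f) p a b := by
    intro a b
    have := (hd.hasFDerivAt.clm_apply (hasFDerivAt_const b p)).fderiv
    simp only [dirDeriv]
    rw [show (dirDeriv b f) = fun q => (fderiv ℝ f q) b from rfl, this]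
    simp
  rw [key, key, hs.eq]

/-- `f` is a family of smooth functions, bounded by a multiple of the weight `w`, uniformly in the
parameter, and each derivative in a direction `v i`, up to total order `n`, multiplies the weight
by `g i`. -/
def CtlN (v : ι → E) (g : ι → E → ℝ) : ℕ → (E → ℝ) → (T → E → ℂ) → Prop
  | 0, w, f => (∀ t, ContDiff ℝ ∞ (f t)) ∧ ∃ C, 0 ≤ C ∧ ∀ t p, ‖f t p‖ ≤ C * w p
  | n + 1, w, f => ((∀ t, ContDiff ℝ ∞ (f t)) ∧ ∃ C, 0 ≤ C ∧ ∀ t p, ‖f t p‖ ≤ C * w p) ∧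
      ∀ i, CtlN v g n (fun p => w p * g i p) (fun t => dirDeriv (v i) (f t))

variable {v : ι → E} {g : ι → E → ℝ} {w w' : E → ℝ} {f h : T → E → ℂ} {n : ℕ}

theorem CtlN.of_succ (hf : CtlN v g (n + 1) w f) : CtlN v g n w f := by
  induction n generalizing w f with
  | zero => exact hf.1
  | succ n ih => exact ⟨hf.1, fun i => ih (hf.2 i)⟩

/-- Nonnegative gains are needed because each derivative multiplies both weights by the same gain,
which must preserve their inequality. -/
theorem CtlN.mono (hg : ∀ i p, 0 ≤ g i p) {K : ℝ} (hK : 0 ≤ K) (hw : ∀ p, w p ≤ K * w' p)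
    (hf : CtlN v g n w f) : CtlN v g n w' f := by
  have key : ∀ {w w' : E → ℝ} {f : T → E → ℂ}, (∀ p, w p ≤ K * w' p) →
      ((∀ t, ContDiff ℝ ∞ (f t)) ∧ ∃ C, 0 ≤ C ∧ ∀ t p, ‖f t p‖ ≤ C * w p) →
      ((∀ t, ContDiff ℝ ∞ (f t)) ∧ ∃ C, 0 ≤ C ∧ ∀ t p, ‖f t p‖ ≤ C * w' p) := by
    rintro w w' f hw ⟨h1, C, hC, h2⟩
    refine ⟨h1, C * K, by positivity, fun t p => (h2 t p).trans ?_⟩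
    rw [mul_assoc]
    gcongr
    exact hw p
  induction n generalizing w w' f with
  | zero => exact key hw hf
  | succ n ih =>
    refine ⟨key hw hf.1, fun i => ih (fun p => ?_) (hf.2 i)⟩
    rw [← mul_assoc]
    exact mul_le_mul_of_nonneg_right (hw p) (hg i p)

theorem CtlN.add (hf : CtlN v g n w f) (hh : CtlN v g n w h) :
    CtlN v g n w (fun t p => f t p + h t p) := by
  have key : ∀ {w : E → ℝ} {f h : T → E → ℂ},
      ((∀ t, ContDiff ℝ ∞ (f t)) ∧ ∃ C, 0 ≤ C ∧ ∀ t p, ‖f t p‖ ≤ C * w p) →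
      ((∀ t, ContDiff ℝ ∞ (h t)) ∧ ∃ C, 0 ≤ C ∧ ∀ t p, ‖h t p‖ ≤ C * w p) →
      ((∀ t, ContDiff ℝ ∞ (fun p => f t p + h t p)) ∧
        ∃ C, 0 ≤ C ∧ ∀ t p, ‖f t p + h t p‖ ≤ C * w p) := by
    rintro w f h ⟨h1, C, hC, h2⟩ ⟨h3, D, hD, h4⟩
    refine ⟨fun t => (h1 t).add (h3 t), C + D, by positivity, fun t p => ?_⟩
    rw [add_mul]
    exact (norm_add_le _ _).trans (add_le_add (h2 t p) (h4 t p))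
  induction n generalizing w f h with
  | zero => exact key hf hh
  | succ n ih =>
    refine ⟨key hf.1 hh.1, fun i => ?_⟩
    simp only [fun t => dirDeriv_add (hf.1.1 t) (hh.1.1 t) (v i)]
    exact ih (hf.2 i) (hh.2 i)

theorem CtlN.mul (hg : ∀ i p, 0 ≤ g i p) (hf : CtlN v g n w f) (hh : CtlN v g n w' h) :
    CtlN v g n (fun p => w p * w' p) (fun t p => f t p * h t p) := by
  have key : ∀ {w w' : E → ℝ} {f h : T → E → ℂ},
      ((∀ t, ContDiff ℝ ∞ (f t)) ∧ ∃ C, 0 ≤ C ∧ ∀ t p, ‖f t p‖ ≤ C * w p) →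
      ((∀ t, ContDiff ℝ ∞ (h t)) ∧ ∃ C, 0 ≤ C ∧ ∀ t p, ‖h t p‖ ≤ C * w' p) →
      ((∀ t, ContDiff ℝ ∞ (fun p => f t p * h t p)) ∧
        ∃ C, 0 ≤ C ∧ ∀ t p, ‖f t p * h t p‖ ≤ C * (w p * w' p)) := by
    rintro w w' f h ⟨h1, C, hC, h2⟩ ⟨h3, D, hD, h4⟩
    refine ⟨fun t => (h1 t).mul (h3 t), C * D, by positivity, fun t p => ?_⟩
    rw [norm_mul, mul_mul_mul_comm]
    exact mul_le_mul (h2 t p) (h4 t p) (norm_nonneg _) ((norm_nonneg _).trans (h2 t p))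
  induction n generalizing w w' f h with
  | zero => exact key hf hh
  | succ n ih =>
    refine ⟨key hf.1 hh.1, fun i => ?_⟩
    simp only [fun t => dirDeriv_mul (hf.1.1 t) (hh.1.1 t) (v i)]
    exact ((ih (hf.2 i) hh.of_succ).mono hg zero_le_one fun p => by ring_nf; exact le_rfl).add
      ((ih hf.of_succ (hh.2 i)).mono hg zero_le_one fun p => by ring_nf; exact le_rfl)

theorem CtlN.scale {s : T → ℂ} {K : ℝ} (hK : 0 ≤ K) (hs : ∀ t, ‖s t‖ ≤ K)
    (hf : CtlN v g n w f) : CtlN v g n w (fun t p => s t * f t p) := by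
  have key : ∀ {w : E → ℝ} {f : T → E → ℂ},
      ((∀ t, ContDiff ℝ ∞ (f t)) ∧ ∃ C, 0 ≤ C ∧ ∀ t p, ‖f t p‖ ≤ C * w p) →
      ((∀ t, ContDiff ℝ ∞ (fun p => s t * f t p)) ∧
        ∃ C, 0 ≤ C ∧ ∀ t p, ‖s t * f t p‖ ≤ C * w p) := by
    rintro w f ⟨h1, C, hC, h2⟩
    refine ⟨fun t => contDiff_const.mul (h1 t), K * C, by positivity, fun t p => ?_⟩
    rw [norm_mul, mul_assoc]
    exact mul_le_mul (hs t) (h2 t p) (norm_nonneg _) hK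
  induction n generalizing w f with
  | zero => exact key hf
  | succ n ih =>
    refine ⟨key hf.1, fun i => ?_⟩
    simp only [fun t => dirDeriv_const_mul (hf.1.1 t) (s t) (v i)]
    exact ih (hf.2 i)

/-- `CtlN` at all orders. -/
def Ctl (v : ι → E) (g : ι → E → ℝ) (w : E → ℝ) (f : T → E → ℂ) : Prop := ∀ n, CtlN v g n w f

theorem Ctl.smooth (hf : Ctl v g w f) (t : T) : ContDiff ℝ ∞ (f t) := (hf 0).1 t

theorem Ctl.bound (hf : Ctl v g w f) : ∃ C, 0 ≤ C ∧ ∀ t p, ‖f t p‖ ≤ C * w p := (hf 0).2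

theorem Ctl.deriv (hf : Ctl v g w f) (i : ι) :
    Ctl v g (fun p => w p * g i p) (fun t => dirDeriv (v i) (f t)) := fun n => (hf (n + 1)).2 i

theorem Ctl.mono (hg : ∀ i p, 0 ≤ g i p) {K : ℝ} (hK : 0 ≤ K) (hw : ∀ p, w p ≤ K * w' p)
    (hf : Ctl v g w f) : Ctl v g w' f := fun n => (hf n).mono hg hK hw

theorem Ctl.congr (hw : ∀ p, w p = w' p) (hf : Ctl v g w f) : Ctl v g w' f := by
  rwa [← funext hw]

theorem Ctl.add (hf : Ctl v g w f) (hh : Ctl v g w h) :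
    Ctl v g w (fun t p => f t p + h t p) := fun n => (hf n).add (hh n)

theorem Ctl.mul (hg : ∀ i p, 0 ≤ g i p) (hf : Ctl v g w f) (hh : Ctl v g w' h) :
    Ctl v g (fun p => w p * w' p) (fun t p => f t p * h t p) := fun n => (hf n).mul hg (hh n)

theorem Ctl.scale {s : T → ℂ} {K : ℝ} (hK : 0 ≤ K) (hs : ∀ t, ‖s t‖ ≤ K)
    (hf : Ctl v g w f) : Ctl v g w (fun t p => s t * f t p) := fun n => (hf n).scale hK hs

theorem Ctl.const_mul (c : ℂ) (hf : Ctl v g w f) : Ctl v g w (fun t p => c * f t p) :=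
  hf.scale (s := fun _ => c) (norm_nonneg c) fun _ => le_rfl

theorem Ctl.sub (hf : Ctl v g w f) (hh : Ctl v g w h) :
    Ctl v g w (fun t p => f t p - h t p) := by
  simpa [sub_eq_add_neg] using hf.add (hh.const_mul (-1))

/-- Coinduction principle for `Ctl`. -/
theorem Ctl.coind (P : (E → ℝ) → (T → E → ℂ) → Prop)
    (hsm : ∀ w f, P w f → ∀ t, ContDiff ℝ ∞ (f t))
    (hbd : ∀ w f, P w f → ∃ C, 0 ≤ C ∧ ∀ t p, ‖f t p‖ ≤ C * w p)
    (hst : ∀ w f, P w f → ∀ i, P (fun p => w p * g i p) (fun t => dirDeriv (v i) (f t)))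
    (hf : P w f) : Ctl v g w f := by
  intro n
  induction n generalizing w f with
  | zero => exact ⟨hsm w f hf, hbd w f hf⟩
  | succ n ih => exact ⟨⟨hsm w f hf, hbd w f hf⟩, fun i => ih (hst w f hf i)⟩

/-- For functions whose derivatives are already known to be controlled, such as linear functionals
or `e^{iR} - 1`: only the undifferentiated bound remains to be checked. -/
theorem Ctl.of_deriv (hsm : ∀ t, ContDiff ℝ ∞ (f t)) {C : ℝ} (hC : 0 ≤ C)
    (hbd : ∀ t p, ‖f t p‖ ≤ C * w p)
    (hd : ∀ i, Ctl v g (fun p => w p * g i p) (fun t => dirDeriv (v i) (f t))) :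
    Ctl v g w f := by
  intro n
  cases n with
  | zero => exact ⟨hsm, C, hC, hbd⟩
  | succ n => exact ⟨⟨hsm, C, hC, hbd⟩, fun i => hd i n⟩

theorem Ctl.zero (hg : ∀ i p, 0 ≤ g i p) (hw : ∀ p, 0 ≤ w p) :
    Ctl v g w (fun (_ : T) (_ : E) => (0 : ℂ)) := by
  refine Ctl.coind (fun w f => (∀ p, 0 ≤ w p) ∧ f = fun _ _ => 0) ?_ ?_ ?_ ⟨hw, rfl⟩
  · rintro w f ⟨-, rfl⟩ t
    exact contDiff_const
  · rintro w f ⟨-, rfl⟩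
    exact ⟨0, le_rfl, by simp⟩
  · rintro w f ⟨hw, rfl⟩ i
    exact ⟨fun p => mul_nonneg (hw p) (hg i p), by simp [dirDeriv_const]⟩

theorem Ctl.const (hg : ∀ i p, 0 ≤ g i p) (hw : ∀ p, 1 ≤ w p) (c : ℂ) :
    Ctl v g w (fun (_ : T) (_ : E) => c) := by
  refine Ctl.of_deriv (fun _ => contDiff_const) (norm_nonneg c)
    (fun t p => le_mul_of_one_le_right (norm_nonneg c) (hw p)) fun i => ?_
  simp only [dirDeriv_const]
  exact Ctl.zero hg fun p => mul_nonneg (zero_le_one.trans (hw p)) (hg i p)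

theorem Ctl.sum (hg : ∀ i p, 0 ≤ g i p) (hw : ∀ p, 0 ≤ w p) {κ : Type*} (s : Finset κ)
    {f : κ → T → E → ℂ} (hf : ∀ k ∈ s, Ctl v g w (f k)) :
    Ctl v g w (fun t p => ∑ k ∈ s, f k t p) := by
  classical
  induction s using Finset.induction_on with
  | empty => simpa using Ctl.zero hg hw
  | insert k s hk ih =>
    simp only [Finset.sum_insert hk]
    exact (hf k (by simp)).add (ih fun j hj => hf j (by simp [hj]))

theorem Ctl.reindex {S : Type*} (φ : S → T) (hf : Ctl v g w f) :
    Ctl v g w (fun s => f (φ s)) := by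
  refine Ctl.coind (fun w f' => ∃ f : T → E → ℂ, Ctl v g w f ∧ f' = fun s => f (φ s))
    ?_ ?_ ?_ ⟨f, hf, rfl⟩
  · rintro w _ ⟨f, hf, rfl⟩ s
    exact hf.smooth _
  · rintro w _ ⟨f, hf, rfl⟩
    obtain ⟨C, hC, h⟩ := hf.bound
    exact ⟨C, hC, fun s => h _⟩
  · rintro w _ ⟨f, hf, rfl⟩ i
    exact ⟨_, hf.deriv i, rfl⟩

/-- Exponentials of functions with bounded real part, with controlled derivatives. -/
theorem Ctl.cexp (hg : ∀ i p, 0 ≤ g i p) (hsm : ∀ t, ContDiff ℝ ∞ (f t))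
    (hre : ∀ t p, (f t p).re ≤ 0) (hd : ∀ i, Ctl v g (g i) (fun t => dirDeriv (v i) (f t))) :
    Ctl v g (fun _ => 1) (fun t p => Complex.exp (f t p)) := by
  have h0 : (∀ t, ContDiff ℝ ∞ (fun p => Complex.exp (f t p))) ∧
      ∃ C, 0 ≤ C ∧ ∀ t p, ‖Complex.exp (f t p)‖ ≤ C * (fun _ : E => (1 : ℝ)) p :=
    ⟨fun t => (hsm t).cexp, 1, zero_le_one, fun t p => by
      simpa [Complex.norm_exp] using hre t p⟩
  intro n
  induction n with
  | zero => exact h0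
  | succ n ih =>
    refine ⟨h0, fun i => ?_⟩
    simp only [fun t => dirDeriv_cexp (hsm t) (v i)]
    -- The derivative `f' e^f` needs `e^f` only to order `n`, so the induction on the order closes.
    exact ((hd i n).mul hg ih).mono hg zero_le_one fun p => by simp

end Controlled


end

section

variable {d : ℕ}

/-! ### The Japanese bracket and Peetre's inequality. -/

section Bracket

theorem one_le_bracket (ξ : Cfg d) : 1 ≤ bracket ξ := by
  rw [bracket, Real.one_le_sqrt]
  nlinarith [sq_nonneg ‖ξ‖]

theorem bracket_pos (ξ : Cfg d) : 0 < bracket ξ := zero_lt_one.trans_le (one_le_bracket ξ)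

theorem norm_le_bracket (ξ : Cfg d) : ‖ξ‖ ≤ bracket ξ :=
  Real.le_sqrt_of_sq_le (by linarith)

theorem bracket_le_one_add_norm (ξ : Cfg d) : bracket ξ ≤ 1 + ‖ξ‖ :=
  Real.sqrt_le_iff.2 ⟨by positivity, by nlinarith [norm_nonneg ξ]⟩

theorem bracket_add_le (ξ η : Cfg d) : bracket (ξ + η) ≤ 2 * bracket ξ * (1 + ‖η‖) := by
  have h1 := bracket_le_one_add_norm (ξ + η)
  have h2 := norm_add_le ξ η
  have h3 := norm_le_bracket ξ
  have h4 := one_le_bracket ξ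
  nlinarith [norm_nonneg η, norm_nonneg ξ]

/-- Peetre's inequality. -/
theorem bracket_add_rpow_le (s : ℝ) (ξ η : Cfg d) :
    bracket (ξ + η) ^ s ≤ 2 ^ |s| * (bracket ξ ^ s * (1 + ‖η‖) ^ |s|) := by
  have hη : (0 : ℝ) < 1 + ‖η‖ := by positivity
  rcases le_or_gt 0 s with hs | hs
  · rw [abs_of_nonneg hs]
    calc bracket (ξ + η) ^ s ≤ (2 * bracket ξ * (1 + ‖η‖)) ^ s :=
          Real.rpow_le_rpow (bracket_pos _).le (bracket_add_le ξ η) hs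
      _ = _ := by
          rw [Real.mul_rpow (by have := bracket_pos ξ; positivity) hη.le,
            Real.mul_rpow zero_le_two (bracket_pos ξ).le, mul_assoc]
  · rw [abs_of_neg hs]
    -- For a negative exponent the roles are exchanged: `ξ` is regarded as the translate of `ξ + η`
    -- by `-η`.
    have h := bracket_add_le (ξ + η) (-η)
    rw [add_neg_cancel_right, norm_neg] at h
    have h2 : bracket ξ ^ (-s) ≤ (2 * bracket (ξ + η) * (1 + ‖η‖)) ^ (-s) :=
      Real.rpow_le_rpow (bracket_pos _).le h (by linarith)
    rw [Real.mul_rpow (by have := bracket_pos (ξ + η); positivity) hη.le,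
      Real.mul_rpow zero_le_two (bracket_pos _).le, Real.rpow_neg (bracket_pos _).le,
      Real.rpow_neg (bracket_pos (ξ + η)).le] at h2
    have h3 : 0 < bracket ξ ^ s := Real.rpow_pos_of_pos (bracket_pos _) _
    have h4 : 0 < bracket (ξ + η) ^ s := Real.rpow_pos_of_pos (bracket_pos _) _
    have h5 := mul_le_mul_of_nonneg_left h2 (mul_pos h3 h4).le
    calc bracket (ξ + η) ^ s = bracket ξ ^ s * bracket (ξ + η) ^ s * (bracket ξ ^ s)⁻¹ := by
          field_simp
      _ ≤ _ := h5
      _ = _ := by field_simp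

end Bracket

/-! ### Symbol classes in terms of weighted estimates. -/

section Symbols

variable {F : Type*} [NormedAddCommGroup F] [NormedSpace ℝ F]

theorem contDiff_pderiv {f : Phase d → F} (hf : ContDiff ℝ ∞ f) (i : Fin d ⊕ Fin d) :
    ContDiff ℝ ∞ (pderiv i f) :=
  (hf.fderiv_right (m := ∞) (by simp)).clm_apply contDiff_const

theorem contDiff_iterPderiv {f : Phase d → F} (hf : ContDiff ℝ ∞ f) (L : List (Fin d ⊕ Fin d)) :
    ContDiff ℝ ∞ (iterPderiv L f) := by
  induction L with
  | nil => exact hf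
  | cons i L ih => exact contDiff_pderiv ih i

/-- The last letter of a word is the derivative applied first. Peeling it off shows that a
derivative of a symbol is a symbol without commuting any derivatives. -/
theorem iterPderiv_append_singleton (L : List (Fin d ⊕ Fin d)) (i : Fin d ⊕ Fin d)
    (f : Phase d → F) : iterPderiv (L ++ [i]) f = iterPderiv L (pderiv i f) := by
  induction L with
  | nil => rfl
  | cons j L ih => simp only [List.cons_append, iterPderiv, ih]

/-- The order of a symbol gained by a derivative. -/
def ord : Fin d ⊕ Fin d → ℝ := Sum.elim (fun _ => 0) (fun _ => 1)

theorem momentumOrder_append_singleton (L : List (Fin d ⊕ Fin d)) (i : Fin d ⊕ Fin d) :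
    (momentumOrder (L ++ [i]) : ℝ) = momentumOrder L + ord i := by
  rcases i with i | i <;> simp [momentumOrder, ord, List.countP_append]

theorem momentumOrder_cons (L : List (Fin d ⊕ Fin d)) (i : Fin d ⊕ Fin d) :
    (momentumOrder (i :: L) : ℝ) = momentumOrder L + ord i := by
  rcases i with i | i <;> simp [momentumOrder, ord, List.countP_cons]

theorem IsSymbol.pderiv {m : ℝ} {f : Phase d → F} (hf : IsSymbol m f) (i : Fin d ⊕ Fin d) :
    IsSymbol (m - ord i) (pderiv i f) := by
  refine ⟨contDiff_pderiv hf.smooth i, fun L => ?_⟩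
  obtain ⟨C, hC⟩ := hf.bound (L ++ [i])
  refine ⟨C, fun x ξ => ?_⟩
  have := hC x ξ
  rwa [iterPderiv_append_singleton, momentumOrder_append_singleton,
    show (momentumOrder L : ℝ) + ord i - m = momentumOrder L - (m - ord i) by ring] at this

theorem IsSymbol.norm_le {m : ℝ} {f : Phase d → F} (hf : IsSymbol m f) :
    ∃ C, 0 ≤ C ∧ ∀ p, ‖f p‖ ≤ C * bracket p.2 ^ m := by
  obtain ⟨C, hC⟩ := hf.bound []
  refine ⟨max C 0, le_max_right _ _, fun p => ?_⟩
  have := hC p.1 p.2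
  simp only [momentumOrder, List.countP_nil, CharP.cast_eq_zero, zero_sub, iterPderiv,
    Prod.mk.eta, Real.rpow_neg (bracket_pos p.2).le] at this
  have hp : 0 < bracket p.2 ^ m := Real.rpow_pos_of_pos (bracket_pos _) _
  rw [inv_mul_le_iff₀ hp, mul_comm] at this
  exact this.trans (by gcongr; exact le_max_left _ _)

theorem pderiv_ofReal {f : Phase d → ℝ} (hf : ContDiff ℝ ∞ f) (i : Fin d ⊕ Fin d) :
    MagneticFIO.pderiv i (fun p => (f p : ℂ)) = fun p => ((MagneticFIO.pderiv i f p : ℝ) : ℂ) := by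
  funext p
  have := (Complex.ofRealCLM.hasFDerivAt.comp p (hf.diff_at p).hasFDerivAt).fderiv
  simp only [MagneticFIO.pderiv]
  rw [show (fun p => (f p : ℂ)) = Complex.ofRealCLM ∘ f from rfl, this]
  simp

theorem iterPderiv_ofReal {f : Phase d → ℝ} (hf : ContDiff ℝ ∞ f) (L : List (Fin d ⊕ Fin d)) :
    iterPderiv L (fun p => (f p : ℂ)) = fun p => ((iterPderiv L f p : ℝ) : ℂ) := by
  induction L with
  | nil => rfl
  | cons i L ih => rw [iterPderiv, ih, pderiv_ofReal (contDiff_iterPderiv hf L)]; rfl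

theorem IsSymbol.ofReal {m : ℝ} {f : Phase d → ℝ} (hf : IsSymbol m f) :
    IsSymbol m (fun p => (f p : ℂ)) := by
  refine ⟨Complex.ofRealCLM.contDiff.comp hf.smooth, fun L => ?_⟩
  obtain ⟨C, hC⟩ := hf.bound L
  exact ⟨C, fun x ξ => by simpa [iterPderiv_ofReal hf.smooth] using hC x ξ⟩

/-- The factor gained by a derivative of a symbol. -/
def symGain (i : Fin d ⊕ Fin d) (p : Phase d) : ℝ := bracket p.2 ^ (-ord i)

theorem symGain_nonneg (i : Fin d ⊕ Fin d) (p : Phase d) : 0 ≤ symGain i p :=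
  Real.rpow_nonneg (bracket_pos _).le _

theorem bracket_mul_symGain (m : ℝ) (i : Fin d ⊕ Fin d) (p : Phase d) :
    bracket p.2 ^ m * symGain i p = bracket p.2 ^ (m - ord i) := by
  rw [symGain, ← Real.rpow_add (bracket_pos _), sub_eq_add_neg]

/-- Transfers the calculus of `Ctl` (products, sums, change of weight) to symbols: the weight is
`⟨ξ⟩^m`, and a momentum derivative multiplies it by `⟨ξ⟩⁻¹`. -/
theorem isSymbol_iff_ctl {m : ℝ} {f : Phase d → ℂ} :
    IsSymbol m f ↔ Ctl dir symGain (fun p : Phase d => bracket p.2 ^ m) (fun _ : Unit => f) := by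
  constructor
  · intro hf
    refine Ctl.coind (fun w h => ∃ m s, IsSymbol m s ∧ w = (fun p : Phase d => bracket p.2 ^ m) ∧
      h = fun _ => s) ?_ ?_ ?_ ⟨m, f, hf, rfl, rfl⟩
    · rintro w h ⟨m, s, hs, rfl, rfl⟩ t
      exact hs.smooth
    · rintro w h ⟨m, s, hs, rfl, rfl⟩
      obtain ⟨C, hC, hb⟩ := hs.norm_le
      exact ⟨C, hC, fun _ => hb⟩
    · rintro w h ⟨m, s, hs, rfl, rfl⟩ i
      exact ⟨m - ord i, _, hs.pderiv i, funext (bracket_mul_symGain m i), rfl⟩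
  · intro hf
    refine ⟨hf.smooth (), fun L => ?_⟩
    induction L using List.reverseRecOn generalizing m f with
    | nil =>
      obtain ⟨C, hC, hb⟩ := hf.bound
      refine ⟨C, fun x ξ => ?_⟩
      simp only [momentumOrder, List.countP_nil, CharP.cast_eq_zero, zero_sub, iterPderiv,
        Real.rpow_neg (bracket_pos ξ).le]
      rw [inv_mul_le_iff₀ (Real.rpow_pos_of_pos (bracket_pos _) _), mul_comm]
      exact hb () (x, ξ)
    | append_singleton L i ih =>
      obtain ⟨C, hC⟩ := ih (m := m - ord i) (f := MagneticFIO.pderiv i f)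
        ((hf.deriv i).congr (bracket_mul_symGain m i))
      refine ⟨C, fun x ξ => ?_⟩
      rw [iterPderiv_append_singleton, momentumOrder_append_singleton,
        show (momentumOrder L : ℝ) + ord i - m = momentumOrder L - (m - ord i) by ring]
      exact hC x ξ

variable {m m' : ℝ} {f h : Phase d → ℂ}

theorem IsSymbol.mul (hf : IsSymbol m f) (hh : IsSymbol m' h) :
    IsSymbol (m + m') (fun p => f p * h p) :=
  isSymbol_iff_ctl.2 (((isSymbol_iff_ctl.1 hf).mul symGain_nonneg (isSymbol_iff_ctl.1 hh)).congr
    fun _ => (Real.rpow_add (bracket_pos _) _ _).symm)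

theorem IsSymbol.add (hf : IsSymbol m f) (hh : IsSymbol m h) :
    IsSymbol m (fun p => f p + h p) :=
  isSymbol_iff_ctl.2 ((isSymbol_iff_ctl.1 hf).add (isSymbol_iff_ctl.1 hh))

theorem IsSymbol.const_mul (c : ℂ) (hf : IsSymbol m f) : IsSymbol m (fun p => c * f p) :=
  isSymbol_iff_ctl.2 ((isSymbol_iff_ctl.1 hf).const_mul c)

theorem IsSymbol.mono (hm : m ≤ m') (hf : IsSymbol m f) : IsSymbol m' f :=
  isSymbol_iff_ctl.2 ((isSymbol_iff_ctl.1 hf).mono symGain_nonneg zero_le_one fun p => by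
    rw [one_mul]; exact Real.rpow_le_rpow_of_exponent_le (one_le_bracket _) hm)

theorem IsSymbol.coord (j : Fin d) : IsSymbol 1 (fun p : Phase d => ((p.2 j : ℝ) : ℂ)) := by
  let ℓ : Phase d →L[ℝ] ℂ :=
    Complex.ofRealCLM ∘L EuclideanSpace.proj j ∘L ContinuousLinearMap.snd ℝ (Cfg d) (Cfg d)
  have hℓ : (fun p : Phase d => ((p.2 j : ℝ) : ℂ)) = ℓ := rfl
  refine isSymbol_iff_ctl.2 (Ctl.of_deriv (fun _ => hℓ ▸ ℓ.contDiff) zero_le_one (fun _ p => ?_)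
    fun i => ?_)
  · rw [Complex.norm_real, one_mul, Real.rpow_one]
    exact (PiLp.norm_apply_le p.2 j).trans (norm_le_bracket _)
  · have : (fun _ : Unit => dirDeriv (dir i) (fun p : Phase d => ((p.2 j : ℝ) : ℂ)))
        = fun _ _ => ℓ (dir i) := by
      funext _ p
      simp [dirDeriv, hℓ]
    rw [this]
    refine Ctl.const symGain_nonneg (fun p => ?_) _
    rw [bracket_mul_symGain]
    refine Real.one_le_rpow (one_le_bracket _) ?_
    rcases i with i | i <;> simp [ord]

end Symbols

end

/-! ### Amplitudes on phase space times the integration variables. -/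

section

variable {d : ℕ}

/-- Phase space together with the integration variables `(Y, H)` of an oscillatory integral. -/
abbrev Big (d : ℕ) : Type := Phase d × (Phase d × Phase d)

/-- Labels of the coordinate directions of `Big d`. -/
abbrev BigIdx (d : ℕ) : Type := (Fin d ⊕ Fin d) ⊕ ((Fin d ⊕ Fin d) ⊕ (Fin d ⊕ Fin d))

/-- The coordinate directions of `Big d`. -/
def bigDir : BigIdx d → Big d
  | Sum.inl i => (dir i, 0)
  | Sum.inr (Sum.inl i) => (0, (dir i, 0))
  | Sum.inr (Sum.inr i) => (0, (0, dir i))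

/-- The weight `⟨ξ⟩^μ (1 + |Y|)^a (1 + |H|)^b`. -/
def wt (μ a b : ℝ) (q : Big d) : ℝ :=
  bracket q.1.2 ^ μ * (1 + ‖q.2.1‖) ^ a * (1 + ‖q.2.2‖) ^ b

/-- The exponents of the factor a derivative contributes to the weight. -/
def expo : BigIdx d → ℝ × ℝ × ℝ
  | Sum.inl i => (-ord i, 2, 2)
  | Sum.inr (Sum.inl _) => (0, 2, 0)
  | Sum.inr (Sum.inr _) => (0, 0, 0)

/-- The factor a derivative contributes to the weight. -/
def bigGain (i : BigIdx d) (q : Big d) : ℝ := wt (expo i).1 (expo i).2.1 (expo i).2.2 q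

/-- Amplitudes: families of smooth functions on `Big d` with weight `wt μ a b`. -/
def Amp {T : Type*} (μ a b : ℝ) (f : T → Big d → ℂ) : Prop := Ctl bigDir bigGain (wt μ a b) f

theorem one_le_one_add_norm {V : Type*} [NormedAddCommGroup V] (v : V) : 1 ≤ 1 + ‖v‖ := by
  linarith [norm_nonneg v]

theorem wt_pos (μ a b : ℝ) (q : Big d) : 0 < wt μ a b q := by
  have := bracket_pos q.1.2
  unfold wt
  positivity

theorem wt_mul (μ a b μ' a' b' : ℝ) (q : Big d) :
    wt μ a b q * wt μ' a' b' q = wt (μ + μ') (a + a') (b + b') q := by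
  have h1 : (0 : ℝ) < 1 + ‖q.2.1‖ := by positivity
  have h2 : (0 : ℝ) < 1 + ‖q.2.2‖ := by positivity
  rw [wt, wt, wt, Real.rpow_add (bracket_pos _), Real.rpow_add h1, Real.rpow_add h2]
  ring

theorem wt_mono {μ a b μ' a' b' : ℝ} (hμ : μ ≤ μ') (ha : a ≤ a') (hb : b ≤ b') (q : Big d) :
    wt μ a b q ≤ wt μ' a' b' q := by
  have h0 := bracket_pos q.1.2
  unfold wt
  gcongr
  · exact one_le_bracket _
  · exact one_le_one_add_norm _
  · exact one_le_one_add_norm _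

theorem wt_zero (q : Big d) : wt 0 0 0 q = 1 := by simp [wt]

theorem one_le_wt {a b : ℝ} (ha : 0 ≤ a) (hb : 0 ≤ b) (q : Big d) : 1 ≤ wt 0 a b q := by
  rw [← wt_zero q]
  exact wt_mono le_rfl ha hb q

theorem bigGain_nonneg (i : BigIdx d) (q : Big d) : 0 ≤ bigGain i q := (wt_pos _ _ _ q).le

theorem wt_mul_bigGain (μ a b : ℝ) (i : BigIdx d) (q : Big d) :
    wt μ a b q * bigGain i q = wt (μ + (expo i).1) (a + (expo i).2.1) (b + (expo i).2.2) q :=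
  wt_mul _ _ _ _ _ _ _

theorem expo_snd_nonneg (i : BigIdx d) : 0 ≤ (expo i).2.1 ∧ 0 ≤ (expo i).2.2 := by
  rcases i with i | i | i <;> simp [expo]

section Amp

variable {T : Type*} {μ a b μ' a' b' : ℝ} {f h : T → Big d → ℂ}

theorem Amp.mul (hf : Amp μ a b f) (hh : Amp μ' a' b' h) :
    Amp (μ + μ') (a + a') (b + b') (fun t q => f t q * h t q) :=
  (Ctl.mul bigGain_nonneg hf hh).congr (wt_mul _ _ _ _ _ _)

theorem Amp.add (hf : Amp μ a b f) (hh : Amp μ a b h) : Amp μ a b (fun t q => f t q + h t q) :=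
  Ctl.add hf hh

theorem Amp.sub (hf : Amp μ a b f) (hh : Amp μ a b h) : Amp μ a b (fun t q => f t q - h t q) :=
  Ctl.sub hf hh

theorem Amp.const_mul (c : ℂ) (hf : Amp μ a b f) : Amp μ a b (fun t q => c * f t q) :=
  Ctl.const_mul c hf

theorem Amp.weaken (hf : Amp μ a b f) (hμ : μ ≤ μ') (ha : a ≤ a') (hb : b ≤ b') :
    Amp μ' a' b' f :=
  Ctl.mono bigGain_nonneg zero_le_one (fun q => by rw [one_mul]; exact wt_mono hμ ha hb q) hf

theorem Amp.smooth (hf : Amp μ a b f) (t : T) : ContDiff ℝ ∞ (f t) := Ctl.smooth hf t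

theorem Amp.bound (hf : Amp μ a b f) : ∃ C, 0 ≤ C ∧ ∀ t q, ‖f t q‖ ≤ C * wt μ a b q :=
  Ctl.bound hf

theorem Amp.deriv (hf : Amp μ a b f) (i : BigIdx d) :
    Amp (μ + (expo i).1) (a + (expo i).2.1) (b + (expo i).2.2)
      (fun t => dirDeriv (bigDir i) (f t)) :=
  (Ctl.deriv hf i).congr (wt_mul_bigGain μ a b i)

theorem Amp.zero : Amp μ a b (fun (_ : T) (_ : Big d) => (0 : ℂ)) :=
  Ctl.zero bigGain_nonneg fun q => (wt_pos _ _ _ q).le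

theorem Amp.const (ha : 0 ≤ a) (hb : 0 ≤ b) (c : ℂ) :
    Amp 0 a b (fun (_ : T) (_ : Big d) => c) :=
  Ctl.const bigGain_nonneg (one_le_wt ha hb) c

theorem Amp.sum {κ : Type*} (s : Finset κ) {f : κ → T → Big d → ℂ}
    (hf : ∀ k ∈ s, Amp μ a b (f k)) : Amp μ a b (fun t q => ∑ k ∈ s, f k t q) :=
  Ctl.sum bigGain_nonneg (fun q => (wt_pos _ _ _ q).le) s hf

theorem Amp.reindex {S : Type*} (φ : S → T) (hf : Amp μ a b f) : Amp μ a b (fun s => f (φ s)) :=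
  Ctl.reindex φ hf

theorem Amp.of_deriv (hsm : ∀ t, ContDiff ℝ ∞ (f t)) {C : ℝ} (hC : 0 ≤ C)
    (hbd : ∀ t q, ‖f t q‖ ≤ C * wt μ a b q)
    (hd : ∀ i, Amp (μ + (expo i).1) (a + (expo i).2.1) (b + (expo i).2.2)
      (fun t => dirDeriv (bigDir i) (f t))) : Amp μ a b f :=
  Ctl.of_deriv hsm hC hbd fun i => Ctl.congr (fun q => (wt_mul_bigGain μ a b i q).symm) (hd i)

/-- Coinduction principle for amplitudes. -/
theorem Amp.coind (P : ℝ → ℝ → ℝ → (T → Big d → ℂ) → Prop)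
    (hsm : ∀ μ a b f, P μ a b f → ∀ t, ContDiff ℝ ∞ (f t))
    (hbd : ∀ μ a b f, P μ a b f → ∃ C, 0 ≤ C ∧ ∀ t q, ‖f t q‖ ≤ C * wt μ a b q)
    (hst : ∀ μ a b f, P μ a b f → ∀ i, P (μ + (expo i).1) (a + (expo i).2.1) (b + (expo i).2.2)
      (fun t => dirDeriv (bigDir i) (f t)))
    (hf : P μ a b f) : Amp μ a b f := by
  refine Ctl.coind (fun w f => ∃ μ a b, P μ a b f ∧ w = wt μ a b) ?_ ?_ ?_ ⟨μ, a, b, hf, rfl⟩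
  · rintro w f ⟨μ, a, b, h, rfl⟩
    exact hsm μ a b f h
  · rintro w f ⟨μ, a, b, h, rfl⟩
    exact hbd μ a b f h
  · rintro w f ⟨μ, a, b, h, rfl⟩ i
    exact ⟨_, _, _, hst μ a b f h i, funext (wt_mul_bigGain μ a b i)⟩

/-- `exp (i ψ)` is an amplitude of order zero when the derivatives of the real phase `ψ` are
controlled. -/
theorem Amp.cexp_I {ψ : T → Big d → ℝ} (hsm : ∀ t, ContDiff ℝ ∞ (ψ t))
    (hd : ∀ i, Amp (expo i).1 (expo i).2.1 (expo i).2.2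
      (fun t => dirDeriv (bigDir i) (fun q => (ψ t q : ℂ)))) :
    Amp 0 0 0 (fun t q => Complex.exp (Complex.I * (ψ t q : ℂ))) := by
  have hs : ∀ t, ContDiff ℝ ∞ (fun q => (ψ t q : ℂ)) :=
    fun t => Complex.ofRealCLM.contDiff.comp (hsm t)
  refine Ctl.congr (fun q => (wt_zero q).symm) (Ctl.cexp bigGain_nonneg
    (fun t => contDiff_const.mul (hs t)) (fun t q => by simp) fun i => ?_)
  simp only [fun t => dirDeriv_const_mul (hs t) Complex.I (bigDir i)]
  exact Amp.const_mul _ (hd i)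

/-- A bounded real-linear functional, as an amplitude. -/
theorem Amp.linear (ℓ : Big d →L[ℝ] ℂ) (hμ : 0 ≤ μ) (ha : 0 ≤ a) (hb : 0 ≤ b) {C : ℝ} (hC : 0 ≤ C)
    (hbd : ∀ q, ‖ℓ q‖ ≤ C * wt μ a b q) (h0 : ∀ j, ℓ (bigDir (Sum.inl (Sum.inr j))) = 0) :
    Amp μ a b (fun (_ : T) q => ℓ q) := by
  refine Amp.of_deriv (fun _ => ℓ.contDiff) hC (fun _ => hbd) fun i => ?_
  have : (fun _ : T => dirDeriv (bigDir i) (fun q => ℓ q)) = fun _ _ => ℓ (bigDir i) := by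
    funext _ p
    simp [dirDeriv]
  rw [this]
  rcases i with (i | i) | i
  · exact (Amp.const (a := a + 2) (b := b + 2) (by linarith) (by linarith) _).weaken
      (by simp [expo, ord, hμ]) le_rfl le_rfl
  · rw [h0]
    exact Amp.zero
  · have := expo_snd_nonneg (Sum.inr i : BigIdx d)
    exact (Amp.const (add_nonneg ha this.1) (add_nonneg hb this.2) _).weaken
      (by rcases i with i | i <;> simp [expo, hμ]) le_rfl le_rfl

end Amp

section Coordinates

/-- The `i`-th coordinate on phase space. -/
def coord (i : Fin d ⊕ Fin d) : Phase d →L[ℝ] ℝ :=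
  match i with
  | Sum.inl j => EuclideanSpace.proj j ∘L ContinuousLinearMap.fst ℝ (Cfg d) (Cfg d)
  | Sum.inr j => EuclideanSpace.proj j ∘L ContinuousLinearMap.snd ℝ (Cfg d) (Cfg d)

theorem coord_inl (j : Fin d) (p : Phase d) : coord (Sum.inl j) p = p.1 j := rfl

theorem coord_inr (j : Fin d) (p : Phase d) : coord (Sum.inr j) p = p.2 j := rfl

theorem coord_dir (i j : Fin d ⊕ Fin d) : coord i (dir j) = if i = j then 1 else 0 := by
  rcases i with i | i <;> rcases j with j | j <;> simp [coord_inl, coord_inr, dir]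

theorem abs_coord_le (i : Fin d ⊕ Fin d) (p : Phase d) : |coord i p| ≤ ‖p‖ := by
  rcases i with i | i
  · exact (PiLp.norm_apply_le p.1 i).trans (norm_fst_le p)
  · exact (PiLp.norm_apply_le p.2 i).trans (norm_snd_le p)

theorem sum_coord_smul_dir (p : Phase d) : ∑ i, coord i p • dir i = p := by
  have h : ∀ x : Cfg d, ∑ j, x j • EuclideanSpace.single j (1 : ℝ) = x := fun x => by
    ext k
    simp [Pi.single_apply]
  rw [Fintype.sum_sum_type]
  ext1
  · simp [Prod.fst_add, Prod.fst_sum, coord_inl, dir, h]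
  · simp [Prod.snd_add, Prod.snd_sum, coord_inr, dir, h]

/-- `1 + ∑ p_i²`. -/
def sqBracket (p : Phase d) : ℝ := 1 + ∑ i, coord i p ^ 2

theorem one_le_sqBracket (p : Phase d) : 1 ≤ sqBracket p :=
  le_add_of_nonneg_right (Finset.sum_nonneg fun _ _ => sq_nonneg _)

theorem sqBracket_eq (p : Phase d) : sqBracket p = 1 + (‖p.1‖ ^ 2 + ‖p.2‖ ^ 2) := by
  simp [sqBracket, Fintype.sum_sum_type, coord_inl, coord_inr, EuclideanSpace.norm_sq_eq]

/-- The product norm is a maximum, hence at most the Euclidean norm, and `(1+t)² = 2(1+t²) -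
(t-1)²`. -/
theorem one_add_norm_sq_le_sqBracket (p : Phase d) : (1 + ‖p‖) ^ 2 ≤ 2 * sqBracket p := by
  have : ‖p‖ ^ 2 ≤ ‖p.1‖ ^ 2 + ‖p.2‖ ^ 2 := by
    rcases max_choice ‖p.1‖ ‖p.2‖ with h | h <;> rw [Prod.norm_def, h] <;>
      nlinarith [sq_nonneg ‖p.1‖, sq_nonneg ‖p.2‖]
  rw [sqBracket_eq]
  nlinarith [sq_nonneg (‖p‖ - 1)]

end Coordinates

end

section

variable {d : ℕ} {T : Type*}

/-! ### The operators of integration by parts and their effect on weights. -/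

section Operators

/-- Obtained by differentiating `f · f⁻¹ = 1`. -/
theorem dirDeriv_inv {E : Type*} [NormedAddCommGroup E] [NormedSpace ℝ E] {f : E → ℂ}
    (hf : ContDiff ℝ ∞ f) (h0 : ∀ p, f p ≠ 0) (v : E) :
    dirDeriv v (fun p => (f p)⁻¹) = fun p => -(dirDeriv v f p * ((f p)⁻¹ * (f p)⁻¹)) := by
  have h := dirDeriv_mul (h := fun p => (f p)⁻¹) hf (hf.inv h0) v
  have h1 : (fun p => f p * (f p)⁻¹) = fun _ => 1 := funext fun p => mul_inv_cancel₀ (h0 p)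
  rw [h1, dirDeriv_const] at h
  funext p
  have h2 := congrFun h p
  have h3 := h0 p
  have : dirDeriv v (fun p => (f p)⁻¹) p = -(dirDeriv v f p * (f p)⁻¹) / f p := by
    rw [eq_div_iff h3]
    linear_combination -h2
  rw [this]
  field_simp

/-- The derivative `-f' f⁻²` has the exponents `-μ + 2μ = μ`, and likewise for `a`, `b`, shifted by
those of the derivative. It involves `f⁻¹` only at the previous order, so induction applies once
`f⁻¹` itself is bounded. -/
theorem Amp.inv {μ a b : ℝ} {f : Big d → ℂ} (hf : Amp (-μ) (-a) (-b) (fun _ : T => f))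
    (hsm : ContDiff ℝ ∞ f) (h0 : ∀ q, f q ≠ 0) {C : ℝ} (hC : 0 ≤ C)
    (hbd : ∀ q, ‖(f q)⁻¹‖ ≤ C * wt μ a b q) : Amp μ a b (fun _ : T => fun q => (f q)⁻¹) := by
  intro n
  induction n with
  | zero => exact ⟨fun _ => hsm.inv h0, C, hC, fun _ => hbd⟩
  | succ n ih =>
    refine ⟨⟨fun _ => hsm.inv h0, C, hC, fun _ => hbd⟩, fun i => ?_⟩
    simp only [dirDeriv_inv hsm h0]
    have h1 := ((hf.deriv i n).mul bigGain_nonneg (ih.mul bigGain_nonneg ih)).scale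
      (s := fun _ => (-1 : ℂ)) (K := 1) zero_le_one (by simp)
    simp only [neg_one_mul] at h1
    refine h1.mono bigGain_nonneg zero_le_one fun q => ?_
    rw [wt_mul, wt_mul, wt_mul_bigGain, one_mul]
    exact wt_mono (by linarith) (by linarith) (by linarith) q

/-- The coordinates of the first group of integration variables. -/
def coordY (i : Fin d ⊕ Fin d) (q : Big d) : ℂ := (coord i q.2.1 : ℝ)

/-- The coordinates of the second group of integration variables. -/
def coordH (i : Fin d ⊕ Fin d) (q : Big d) : ℂ := (coord i q.2.2 : ℝ)

/-- `1 + |Y|²`. -/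
def sqY (q : Big d) : ℂ := (sqBracket q.2.1 : ℝ)

/-- `1 + |H|²`. -/
def sqH (q : Big d) : ℂ := (sqBracket q.2.2 : ℝ)

theorem amp_coordY (i : Fin d ⊕ Fin d) : Amp 0 1 0 (fun _ : T => coordY (d := d) i) := by
  refine Amp.linear (Complex.ofRealCLM ∘L coord i ∘L ContinuousLinearMap.fst ℝ _ _ ∘L
    ContinuousLinearMap.snd ℝ _ _) le_rfl zero_le_one le_rfl zero_le_one (fun q => ?_) fun j => ?_
  · simpa [wt] using (abs_coord_le i q.2.1).trans (by linarith)
  · simp [bigDir]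

theorem amp_coordH (i : Fin d ⊕ Fin d) : Amp 0 0 1 (fun _ : T => coordH (d := d) i) := by
  refine Amp.linear (Complex.ofRealCLM ∘L coord i ∘L ContinuousLinearMap.snd ℝ _ _ ∘L
    ContinuousLinearMap.snd ℝ _ _) le_rfl le_rfl zero_le_one zero_le_one (fun q => ?_) fun j => ?_
  · simpa [wt] using (abs_coord_le i q.2.2).trans (by linarith)
  · simp [bigDir]

theorem sqY_eq : sqY (d := d) = fun q => 1 + ∑ i, coordY i q * coordY i q := by
  funext q
  simp [sqY, sqBracket, coordY, sq]

theorem sqH_eq : sqH (d := d) = fun q => 1 + ∑ i, coordH i q * coordH i q := by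
  funext q
  simp [sqH, sqBracket, coordH, sq]

theorem sqBracket_ofReal_ne_zero (p : Phase d) : ((sqBracket p : ℝ) : ℂ) ≠ 0 :=
  Complex.ofReal_ne_zero.2 (zero_lt_one.trans_le (one_le_sqBracket p)).ne'

theorem norm_inv_sqBracket_le (p : Phase d) :
    ‖((sqBracket p : ℝ) : ℂ)⁻¹‖ ≤ 2 * (1 + ‖p‖) ^ (-2 : ℝ) := by
  have h1 := one_le_sqBracket p
  have h2 := one_add_norm_sq_le_sqBracket p
  have h3 : (0 : ℝ) < 1 + ‖p‖ := by positivity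
  rw [norm_inv, Complex.norm_real, Real.norm_of_nonneg (by linarith), Real.rpow_neg h3.le,
    Real.rpow_two, inv_le_comm₀ (by linarith) (by positivity), mul_inv, inv_inv]
  linarith

theorem amp_sqY : Amp 0 2 0 (fun _ : T => sqY (d := d)) := by
  rw [sqY_eq]
  refine (Amp.const zero_le_two le_rfl 1).add (Amp.sum _ fun i _ => ?_)
  exact ((amp_coordY i).mul (amp_coordY i)).weaken (by norm_num) (by norm_num) (by norm_num)

theorem amp_sqH : Amp 0 0 2 (fun _ : T => sqH (d := d)) := by
  rw [sqH_eq]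
  refine (Amp.const le_rfl zero_le_two 1).add (Amp.sum _ fun i _ => ?_)
  exact ((amp_coordH i).mul (amp_coordH i)).weaken (by norm_num) (by norm_num) (by norm_num)

theorem amp_sqY_inv : Amp 0 (-2) 0 (fun _ : T => fun q : Big d => (sqY q)⁻¹) :=
  Amp.inv (amp_sqY.weaken (by norm_num) (by norm_num) (by norm_num)) (amp_sqY.smooth ())
    (fun q => sqBracket_ofReal_ne_zero q.2.1) zero_le_two
    (fun q => by simpa [wt, sqY] using norm_inv_sqBracket_le q.2.1)

theorem amp_sqH_inv : Amp 0 0 (-2) (fun _ : T => fun q : Big d => (sqH q)⁻¹) :=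
  Amp.inv (amp_sqH.weaken (by norm_num) (by norm_num) (by norm_num)) (amp_sqH.smooth ())
    (fun q => sqBracket_ofReal_ne_zero q.2.2) zero_le_two
    (fun q => by simpa [wt, sqH] using norm_inv_sqBracket_le q.2.2)

/-- Integration by parts in `Y`, which gains one power of `1 + |H|`. -/
def opY (f : Big d → ℂ) (q : Big d) : ℂ :=
  (sqH q)⁻¹ * (f q - Complex.I * ∑ i, coordH i q * dirDeriv (bigDir (Sum.inr (Sum.inl i))) f q)

/-- Integration by parts in `H`, which gains one power of `1 + |Y|`. -/
def opH (f : Big d → ℂ) (q : Big d) : ℂ :=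
  (sqY q)⁻¹ * (f q - Complex.I * ∑ i, coordY i q * dirDeriv (bigDir (Sum.inr (Sum.inr i))) f q)

variable {μ a b : ℝ} {f : T → Big d → ℂ}

/-- In the derivative term the factor `H_i` costs one power of `1+|H|`, the `Y`-derivative costs
`(1+|Y|)²`, and `(1+|H|²)⁻¹` returns two powers of `1+|H|`. -/
theorem Amp.opY (hf : Amp μ a b f) : Amp μ (a + 2) (b - 1) (fun t => opY (f t)) := by
  refine ((amp_sqH_inv (T := T)).mul (((hf.weaken (a' := a + 2) (b' := b + 1) le_rfl (by linarith)
    (by linarith)).sub (Amp.const_mul _ (Amp.sum _ fun i _ => ?_))))).weaken (by simp) (by simp)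
    (by linarith)
  exact ((amp_coordH i).mul (hf.deriv (Sum.inr (Sum.inl i)))).weaken (by simp [expo])
    (by simp [expo]) (by simp [expo, add_comm])

/-- `H`-derivatives leave the weight unchanged, so the gain in `Y` is not paid for in `H`. This
asymmetry with `opY` is what makes the scheme terminate. -/
theorem Amp.opH (hf : Amp μ a b f) : Amp μ (a - 1) b (fun t => opH (f t)) := by
  refine ((amp_sqY_inv (T := T)).mul (((hf.weaken (a' := a + 1) (b' := b) le_rfl (by linarith)
    (by linarith)).sub (Amp.const_mul _ (Amp.sum _ fun i _ => ?_))))).weaken (by simp) (by linarith)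
    (by simp)
  exact ((amp_coordY i).mul (hf.deriv (Sum.inr (Sum.inr i)))).weaken (by simp [expo])
    (by simp [expo, add_comm]) (by simp [expo])

/-- The iterated integrations by parts. -/
def ibp (M N : ℕ) (f : Big d → ℂ) : Big d → ℂ := opH^[N] (opY^[M] f)

theorem Amp.ibp (M N : ℕ) (hf : Amp μ a b f) :
    Amp μ (a + 2 * M - N) (b - M) (fun t => ibp M N (f t)) := by
  have h1 : Amp μ (a + 2 * M) (b - M) (fun t => MagneticFIO.opY^[M] (f t)) := by
    induction M with
    | zero => simpa using hf
    | succ M ih =>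
      simp only [Function.iterate_succ_apply']
      exact ih.opY.weaken le_rfl (by push_cast; linarith) (by push_cast; linarith)
  induction N with
  | zero => simpa [MagneticFIO.ibp] using h1
  | succ N ih =>
    simp only [MagneticFIO.ibp, Function.iterate_succ_apply'] at ih ⊢
    exact ih.opH.weaken le_rfl (by push_cast; linarith) le_rfl

theorem opY_congr {f h : Big d → ℂ} {q : Big d} (hfh : f =ᶠ[𝓝 q] h) : opY f =ᶠ[𝓝 q] opY h := by
  filter_upwards [hfh.eventually_nhds] with r hr
  simp only [opY, hr.self_of_nhds, fun i => dirDeriv_congr_eventually hr (bigDir i)]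

theorem opH_congr {f h : Big d → ℂ} {q : Big d} (hfh : f =ᶠ[𝓝 q] h) : opH f =ᶠ[𝓝 q] opH h := by
  filter_upwards [hfh.eventually_nhds] with r hr
  simp only [opH, hr.self_of_nhds, fun i => dirDeriv_congr_eventually hr (bigDir i)]

/-- Integration by parts is local. Cut-offs equal to `1` near a point therefore disappear there from
the transformed integrand, which gives pointwise convergence when they are removed. -/
theorem ibp_congr {f h : Big d → ℂ} {q : Big d} (M N : ℕ) (hfh : f =ᶠ[𝓝 q] h) :
    ibp M N f q = ibp M N h q := by
  have h1 : opY^[M] f =ᶠ[𝓝 q] opY^[M] h := by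
    induction M with
    | zero => exact hfh
    | succ M ih => simpa only [Function.iterate_succ_apply'] using opY_congr ih
  have h2 : ibp M N f =ᶠ[𝓝 q] ibp M N h := by
    induction N with
    | zero => exact h1
    | succ N ih => simpa only [ibp, Function.iterate_succ_apply'] using opH_congr ih
  exact h2.self_of_nhds

theorem contDiff_coordY (i : Fin d ⊕ Fin d) : ContDiff ℝ ∞ (coordY (d := d) i) :=
  (amp_coordY i).smooth ()

theorem contDiff_coordH (i : Fin d ⊕ Fin d) : ContDiff ℝ ∞ (coordH (d := d) i) :=
  (amp_coordH i).smooth ()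

theorem contDiff_opY {f : Big d → ℂ} (hf : ContDiff ℝ ∞ f) : ContDiff ℝ ∞ (opY f) :=
  (amp_sqH_inv.smooth ()).mul (hf.sub (contDiff_const.mul (ContDiff.sum fun i _ =>
    (contDiff_coordH i).mul (contDiff_dirDeriv hf _))))

theorem contDiff_opH {f : Big d → ℂ} (hf : ContDiff ℝ ∞ f) : ContDiff ℝ ∞ (opH f) :=
  (amp_sqY_inv.smooth ()).mul (hf.sub (contDiff_const.mul (ContDiff.sum fun i _ =>
    (contDiff_coordY i).mul (contDiff_dirDeriv hf _))))

/-- Where the function is differentiable, its restriction to a line in a parameter direction is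
constant; this avoids any regularity assumption on `k`. -/
theorem dirDeriv_param_const {k : Phase d × Phase d → ℂ} (v : Phase d) :
    dirDeriv ((v, 0) : Big d) (fun q => k q.2) = fun _ => 0 := by
  funext q
  by_cases h : DifferentiableAt ℝ (fun q : Big d => k q.2) q
  · have h1 : HasFDerivAt (fun s : ℝ => q + s • ((v, 0) : Big d))
        (ContinuousLinearMap.toSpanSingleton ℝ ((v, 0) : Big d)) 0 := by
      have := ((ContinuousLinearMap.toSpanSingleton ℝ ((v, 0) : Big d)).hasFDerivAt
        (x := 0)).const_add q
      simpa using this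
    have h2 : HasFDerivAt (fun q : Big d => k q.2) (fderiv ℝ (fun q : Big d => k q.2) q)
        (q + (0 : ℝ) • ((v, 0) : Big d)) := by
      simpa using h.hasFDerivAt
    have h3 := (h2.comp (0 : ℝ) h1).fderiv
    have h4 : ((fun q : Big d => k q.2) ∘ fun s : ℝ => q + s • ((v, 0) : Big d))
        = fun _ => k q.2 := by
      funext s
      simp
    rw [h4] at h3
    have h5 := congrArg (fun L : ℝ →L[ℝ] ℂ => L 1) h3
    simpa [dirDeriv] using h5.symm
  -- At points without differentiability `fderiv` is zero by convention.
  · simp [dirDeriv, fderiv_zero_of_not_differentiableAt h]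

/-- The coefficients of `opY` depend on `H` alone, so parameter derivatives pass through it, up to
the symmetry of second derivatives. -/
theorem dirDeriv_param_opY {f : Big d → ℂ} (hf : ContDiff ℝ ∞ f) (i : Fin d ⊕ Fin d) :
    dirDeriv (bigDir (Sum.inl i)) (opY f) = opY (dirDeriv (bigDir (Sum.inl i)) f) := by
  have hs : ∀ j : Fin d ⊕ Fin d,
      ContDiff ℝ ∞ (fun q => coordH j q * dirDeriv (bigDir (Sum.inr (Sum.inl j))) f q) :=
    fun j => (contDiff_coordH j).mul (contDiff_dirDeriv hf _)
  have hS : ContDiff ℝ ∞ (fun q => -Complex.I *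
      ∑ j, coordH j q * dirDeriv (bigDir (Sum.inr (Sum.inl j))) f q) :=
    contDiff_const.mul (ContDiff.sum fun j _ => hs j)
  have e : opY f = fun q => (sqH q)⁻¹ * (f q + -Complex.I *
      ∑ j, coordH j q * dirDeriv (bigDir (Sum.inr (Sum.inl j))) f q) := by
    funext q
    simp [opY, sub_eq_add_neg]
  have z1 : dirDeriv (bigDir (Sum.inl i)) (fun q : Big d => (sqH q)⁻¹) = fun _ => 0 :=
    dirDeriv_param_const (k := fun Q => (((sqBracket Q.2 : ℝ) : ℂ))⁻¹) (dir i)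
  have z2 : ∀ j, dirDeriv (bigDir (Sum.inl i)) (coordH (d := d) j) = fun _ => 0 := fun j =>
    dirDeriv_param_const (k := fun Q => ((coord j Q.2 : ℝ) : ℂ)) (dir i)
  rw [e, dirDeriv_mul (amp_sqH_inv.smooth ()) (hf.add hS), z1, dirDeriv_add hf hS,
    dirDeriv_const_mul (ContDiff.sum fun j _ => hs j), dirDeriv_sum _ fun j _ => hs j]
  simp only [fun j => dirDeriv_mul (contDiff_coordH j)
    (contDiff_dirDeriv hf (bigDir (Sum.inr (Sum.inl j)))) (bigDir (Sum.inl i)), z2,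
    fun j => dirDeriv_comm hf (bigDir (Sum.inl i)) (bigDir (Sum.inr (Sum.inl j)))]
  funext q
  simp [opY, sub_eq_add_neg]

theorem dirDeriv_param_opH {f : Big d → ℂ} (hf : ContDiff ℝ ∞ f) (i : Fin d ⊕ Fin d) :
    dirDeriv (bigDir (Sum.inl i)) (opH f) = opH (dirDeriv (bigDir (Sum.inl i)) f) := by
  have hs : ∀ j : Fin d ⊕ Fin d,
      ContDiff ℝ ∞ (fun q => coordY j q * dirDeriv (bigDir (Sum.inr (Sum.inr j))) f q) :=
    fun j => (contDiff_coordY j).mul (contDiff_dirDeriv hf _)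
  have hS : ContDiff ℝ ∞ (fun q => -Complex.I *
      ∑ j, coordY j q * dirDeriv (bigDir (Sum.inr (Sum.inr j))) f q) :=
    contDiff_const.mul (ContDiff.sum fun j _ => hs j)
  have e : opH f = fun q => (sqY q)⁻¹ * (f q + -Complex.I *
      ∑ j, coordY j q * dirDeriv (bigDir (Sum.inr (Sum.inr j))) f q) := by
    funext q
    simp [opH, sub_eq_add_neg]
  have z1 : dirDeriv (bigDir (Sum.inl i)) (fun q : Big d => (sqY q)⁻¹) = fun _ => 0 :=
    dirDeriv_param_const (k := fun Q => (((sqBracket Q.1 : ℝ) : ℂ))⁻¹) (dir i)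
  have z2 : ∀ j, dirDeriv (bigDir (Sum.inl i)) (coordY (d := d) j) = fun _ => 0 := fun j =>
    dirDeriv_param_const (k := fun Q => ((coord j Q.1 : ℝ) : ℂ)) (dir i)
  rw [e, dirDeriv_mul (amp_sqY_inv.smooth ()) (hf.add hS), z1, dirDeriv_add hf hS,
    dirDeriv_const_mul (ContDiff.sum fun j _ => hs j), dirDeriv_sum _ fun j _ => hs j]
  simp only [fun j => dirDeriv_mul (contDiff_coordY j)
    (contDiff_dirDeriv hf (bigDir (Sum.inr (Sum.inr j)))) (bigDir (Sum.inl i)), z2,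
    fun j => dirDeriv_comm hf (bigDir (Sum.inl i)) (bigDir (Sum.inr (Sum.inr j)))]
  funext q
  simp [opH, sub_eq_add_neg]

theorem dirDeriv_param_ibp {f : Big d → ℂ} (hf : ContDiff ℝ ∞ f) (M N : ℕ) (i : Fin d ⊕ Fin d) :
    dirDeriv (bigDir (Sum.inl i)) (ibp M N f) = ibp M N (dirDeriv (bigDir (Sum.inl i)) f) := by
  have h1 : ContDiff ℝ ∞ (opY^[M] f) ∧ dirDeriv (bigDir (Sum.inl i)) (opY^[M] f) =
      opY^[M] (dirDeriv (bigDir (Sum.inl i)) f) := by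
    induction M with
    | zero => exact ⟨hf, rfl⟩
    | succ M ih =>
      simp only [Function.iterate_succ_apply']
      exact ⟨contDiff_opY ih.1, by rw [dirDeriv_param_opY ih.1, ih.2]⟩
  have h2 : ContDiff ℝ ∞ (ibp M N f) ∧ dirDeriv (bigDir (Sum.inl i)) (ibp M N f) =
      ibp M N (dirDeriv (bigDir (Sum.inl i)) f) := by
    induction N with
    | zero => exact h1
    | succ N ih =>
      simp only [ibp, Function.iterate_succ_apply'] at ih ⊢
      exact ⟨contDiff_opH ih.1, by rw [dirDeriv_param_opH ih.1, ih.2]⟩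
  exact h2.2

end Operators

end

section

variable {d : ℕ} {T : Type*}

/-! ### Integration by parts against the oscillating factor. -/

section Oscillatory

instance : (volume : Measure (Phase d)).IsAddHaarMeasure :=
  Measure.prod.instIsAddHaarMeasure (volume : Measure (Cfg d)) (volume : Measure (Cfg d))

instance : (volume : Measure (Phase d × Phase d)).IsAddHaarMeasure :=
  Measure.prod.instIsAddHaarMeasure (volume : Measure (Phase d)) (volume : Measure (Phase d))

/-- The pairing `⟨y, η⟩ + ⟨z, ζ⟩`. -/
def pair (Q : Phase d × Phase d) : ℝ := ∑ i, coord i Q.1 * coord i Q.2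

/-- The oscillating factor `exp (-i (⟨y, η⟩ + ⟨z, ζ⟩))`. -/
def oscKer (Q : Phase d × Phase d) : ℂ := Complex.exp (-(Complex.I * (pair Q : ℂ)))

theorem pair_eq_inner (Q : Phase d × Phase d) :
    pair Q = inner ℝ Q.1.1 Q.2.1 + inner ℝ Q.1.2 Q.2.2 := by
  simp [pair, Fintype.sum_sum_type, coord_inl, coord_inr, PiLp.inner_apply, mul_comm]

theorem contDiff_pair : ContDiff ℝ ∞ (pair (d := d)) :=
  ContDiff.sum fun i _ => ((coord i).contDiff.comp contDiff_fst).mul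
    ((coord i).contDiff.comp contDiff_snd)

theorem contDiff_oscKer : ContDiff ℝ ∞ (oscKer (d := d)) :=
  (contDiff_const.mul (Complex.ofRealCLM.contDiff.comp contDiff_pair)).neg.cexp

theorem norm_oscKer (Q : Phase d × Phase d) : ‖oscKer Q‖ = 1 := by
  simp [oscKer, Complex.norm_exp]

/-- The integral over the integration variables against the oscillating factor. -/
def bigInt (f : Big d → ℂ) (p : Phase d) : ℂ := ∫ Q : Phase d × Phase d, oscKer Q * f (p, Q)

/-- `f (p, ·)` vanishes outside a bounded set. -/
def BddSupp (p : Phase d) (f : Big d → ℂ) : Prop := ∃ R : ℝ, ∀ Q, R < ‖Q‖ → f (p, Q) = 0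

theorem dirDeriv_fiber {f : Big d → ℂ} (hf : ContDiff ℝ ∞ f) (p : Phase d)
    (v : Phase d × Phase d) (Q : Phase d × Phase d) :
    dirDeriv v (fun Q => f (p, Q)) Q = dirDeriv ((0, v) : Big d) f (p, Q) := by
  have := ((hf.diff_at (p, Q)).hasFDerivAt.comp Q (hasFDerivAt_prodMk_right p Q)).fderiv
  simp only [dirDeriv]
  rw [show (fun Q => f (p, Q)) = f ∘ fun Q => (p, Q) from rfl, this]
  simp

theorem BddSupp.dirDeriv {p : Phase d} {f : Big d → ℂ} (hf : ContDiff ℝ ∞ f) (h : BddSupp p f)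
    (v : Phase d × Phase d) : BddSupp p (dirDeriv ((0, v) : Big d) f) := by
  obtain ⟨R, hR⟩ := h
  refine ⟨R, fun Q hQ => ?_⟩
  rw [← dirDeriv_fiber hf]
  have : (fun Q => f (p, Q)) =ᶠ[𝓝 Q] fun _ => 0 := by
    filter_upwards [(isOpen_lt continuous_const continuous_norm).mem_nhds hQ] with Q' hQ'
    exact hR Q' hQ'
  rw [dirDeriv_congr_eventually this, dirDeriv_const]

theorem BddSupp.opY {p : Phase d} {f : Big d → ℂ} (hf : ContDiff ℝ ∞ f) (h : BddSupp p f) :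
    BddSupp p (opY f) := by
  obtain ⟨R, hR⟩ := h
  choose R' hR' using fun i : Fin d ⊕ Fin d => BddSupp.dirDeriv hf ⟨R, hR⟩ (dir i, 0)
  -- A common radius outside which `f` and all the finitely many derivatives in question vanish.
  refine ⟨max R (∑ i, |R' i|), fun Q hQ => ?_⟩
  have h1 : ∀ i, MagneticFIO.dirDeriv (bigDir (Sum.inr (Sum.inl i))) f (p, Q) = 0 := fun i =>
    hR' i Q ((((le_abs_self _).trans (Finset.single_le_sum (f := fun i => |R' i|)
      (fun j _ => abs_nonneg _) (Finset.mem_univ i))).trans (le_max_right _ _)).trans_lt hQ)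
  simp [MagneticFIO.opY, hR Q ((le_max_left _ _).trans_lt hQ), h1]

theorem BddSupp.opH {p : Phase d} {f : Big d → ℂ} (hf : ContDiff ℝ ∞ f) (h : BddSupp p f) :
    BddSupp p (opH f) := by
  obtain ⟨R, hR⟩ := h
  choose R' hR' using fun i : Fin d ⊕ Fin d => BddSupp.dirDeriv hf ⟨R, hR⟩ (0, dir i)
  refine ⟨max R (∑ i, |R' i|), fun Q hQ => ?_⟩
  have h1 : ∀ i, MagneticFIO.dirDeriv (bigDir (Sum.inr (Sum.inr i))) f (p, Q) = 0 := fun i =>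
    hR' i Q ((((le_abs_self _).trans (Finset.single_le_sum (f := fun i => |R' i|)
      (fun j _ => abs_nonneg _) (Finset.mem_univ i))).trans (le_max_right _ _)).trans_lt hQ)
  simp [MagneticFIO.opH, hR Q ((le_max_left _ _).trans_lt hQ), h1]

theorem integrable_of_bddSupp {p : Phase d} {f : Big d → ℂ} (hf : Continuous f) (h : BddSupp p f)
    {k : Phase d × Phase d → ℂ} (hk : Continuous k) :
    Integrable (fun Q : Phase d × Phase d => k Q * f (p, Q)) := by
  obtain ⟨R, hR⟩ := h
  refine Continuous.integrable_of_hasCompactSupport (by fun_prop) ?_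
  refine HasCompactSupport.intro (isCompact_closedBall (0 : Phase d × Phase d) R) fun Q hQ => ?_
  rw [hR Q (by simpa using hQ), mul_zero]

/-- Bounded support of `f (p, ·)` makes all three products integrable and removes boundary terms;
nothing is required of `k` at infinity. -/
theorem integral_mul_dirDeriv {p : Phase d} {f : Big d → ℂ} (hf : ContDiff ℝ ∞ f)
    (h : BddSupp p f) {k : Phase d × Phase d → ℂ} (hk : ContDiff ℝ ∞ k) (v : Phase d × Phase d) :
    ∫ Q, k Q * dirDeriv ((0, v) : Big d) f (p, Q) = -∫ Q, dirDeriv v k Q * f (p, Q) := by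
  have hfp : ContDiff ℝ ∞ (fun Q => f (p, Q)) := hf.comp (contDiff_prodMk_right p)
  have := integral_mul_fderiv_eq_neg_fderiv_mul_of_integrable (μ := volume) (f := k)
    (g := fun Q => f (p, Q)) (v := v)
    (integrable_of_bddSupp hf.continuous h (contDiff_dirDeriv hk v).continuous)
    (by
      have := integrable_of_bddSupp (contDiff_dirDeriv hf ((0, v) : Big d)).continuous
        (h.dirDeriv hf v) hk.continuous
      simp only [← dirDeriv_fiber hf] at this
      exact this)
    (integrable_of_bddSupp hf.continuous h hk.continuous)
    (fun Q _ => hk.diff_at Q) (fun Q _ => hfp.diff_at Q)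
  simp only [← dirDeriv_fiber hf]
  exact this

theorem dirDeriv_clm {E : Type*} [NormedAddCommGroup E] [NormedSpace ℝ E] (ℓ : E →L[ℝ] ℂ)
    (v : E) : dirDeriv v (fun p => ℓ p) = fun _ => ℓ v := by
  funext p
  simp [dirDeriv]

theorem dirDeriv_oscKer (v : Phase d × Phase d) :
    dirDeriv v (oscKer (d := d)) = fun Q => -(Complex.I * ∑ i, ((coord i v.1 : ℂ) * coord i Q.2 +
      coord i Q.1 * coord i v.2)) * oscKer Q := by
  let ℓ₁ : Fin d ⊕ Fin d → (Phase d × Phase d →L[ℝ] ℂ) := fun i =>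
    Complex.ofRealCLM ∘L coord i ∘L ContinuousLinearMap.fst ℝ _ _
  let ℓ₂ : Fin d ⊕ Fin d → (Phase d × Phase d →L[ℝ] ℂ) := fun i =>
    Complex.ofRealCLM ∘L coord i ∘L ContinuousLinearMap.snd ℝ _ _
  have e : oscKer (d := d) = fun Q => Complex.exp (-Complex.I * ∑ i, ℓ₁ i Q * ℓ₂ i Q) := by
    funext Q
    simp [oscKer, pair, ℓ₁, ℓ₂]
  have h1 : ∀ i, ContDiff ℝ ∞ (fun Q => ℓ₁ i Q * ℓ₂ i Q) :=
    fun i => (ℓ₁ i).contDiff.mul (ℓ₂ i).contDiff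
  have h2 : ContDiff ℝ ∞ (fun Q => ∑ i, ℓ₁ i Q * ℓ₂ i Q) := ContDiff.sum fun i _ => h1 i
  rw [e, dirDeriv_cexp (contDiff_const.mul h2), dirDeriv_const_mul h2, dirDeriv_sum _ fun i _ => h1 i]
  simp only [fun i => dirDeriv_mul (ℓ₁ i).contDiff (ℓ₂ i).contDiff v, dirDeriv_clm]
  funext Q
  simp [ℓ₁, ℓ₂]

theorem dirDeriv_oscKer_fst (i : Fin d ⊕ Fin d) (Q : Phase d × Phase d) :
    dirDeriv (dir i, 0) oscKer Q = -(Complex.I * (coord i Q.2 : ℂ)) * oscKer Q := by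
  simp [dirDeriv_oscKer, coord_dir, -Fintype.sum_sum_type, apply_ite Complex.ofReal]

theorem dirDeriv_oscKer_snd (i : Fin d ⊕ Fin d) (Q : Phase d × Phase d) :
    dirDeriv (0, dir i) oscKer Q = -(Complex.I * (coord i Q.1 : ℂ)) * oscKer Q := by
  simp [dirDeriv_oscKer, coord_dir, -Fintype.sum_sum_type, apply_ite Complex.ofReal]

theorem dirDeriv_of_forall_eq {E : Type*} [NormedAddCommGroup E] [NormedSpace ℝ E] {k : E → ℂ}
    (hk : ContDiff ℝ ∞ k) (v : E) (h : ∀ p (s : ℝ), k (p + s • v) = k p) (p : E) :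
    dirDeriv v k p = 0 := by
  have := ((hk.diff_at p).hasFDerivAt.hasLineDerivAt v).lineDeriv
  rw [dirDeriv, ← this]
  simp [lineDeriv, h]

theorem contDiff_inv_sqBracket : ContDiff ℝ ∞ (fun p : Phase d => ((sqBracket p : ℝ) : ℂ)⁻¹) := by
  refine ContDiff.inv (Complex.ofRealCLM.contDiff.comp ?_) fun p => sqBracket_ofReal_ne_zero p
  exact contDiff_const.add (ContDiff.sum fun i _ => (coord i).contDiff.pow 2)

/-- Since `∂_Y` of the oscillating factor is `-iH` times it, the operator `1 + i H·∂_Y` multiplies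
it by `1 + |H|²`. Dividing by `1 + |H|²` and transposing yields `opY`. -/
theorem bigInt_opY {p : Phase d} {f : Big d → ℂ} (hf : ContDiff ℝ ∞ f) (h : BddSupp p f) :
    bigInt (opY f) p = bigInt f p := by
  let s : Phase d × Phase d → ℂ := fun Q => ((sqBracket Q.2 : ℝ) : ℂ)⁻¹
  let k : Fin d ⊕ Fin d → Phase d × Phase d → ℂ := fun i Q => s Q * (coord i Q.2 : ℂ)
  have hs : ContDiff ℝ ∞ s := contDiff_inv_sqBracket.comp contDiff_snd
  have hk : ∀ i, ContDiff ℝ ∞ (k i) := fun i =>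
    hs.mul (Complex.ofRealCLM.contDiff.comp ((coord i).contDiff.comp contDiff_snd))
  -- The coefficient `k i` is independent of `Y`, so the derivative moved off `f` falls on the
  -- oscillating factor only.
  have key : ∀ i, ∫ Q, oscKer Q * k i Q * dirDeriv (bigDir (Sum.inr (Sum.inl i))) f (p, Q)
      = Complex.I * ∫ Q, oscKer Q * (k i Q * (coord i Q.2 : ℂ)) * f (p, Q) := by
    intro i
    rw [show bigDir (Sum.inr (Sum.inl i)) = ((0, (dir i, 0)) : Big d) from rfl,
      integral_mul_dirDeriv hf h (contDiff_oscKer.mul (hk i)), ← integral_neg,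
      ← integral_const_mul]
    refine integral_congr_ae (Eventually.of_forall fun Q => ?_)
    simp only [dirDeriv_mul contDiff_oscKer (hk i), dirDeriv_oscKer_fst,
      dirDeriv_of_forall_eq (hk i) ((dir i, 0) : Phase d × Phase d) (fun p t => by simp [k, s]) Q]
    ring
  have hint : ∀ i, Integrable fun Q : Phase d × Phase d =>
      oscKer Q * k i Q * dirDeriv (bigDir (Sum.inr (Sum.inl i))) f (p, Q) := fun i =>
    integrable_of_bddSupp (contDiff_dirDeriv hf _).continuous (h.dirDeriv hf _)
      (contDiff_oscKer.mul (hk i)).continuous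
  have hint2 : ∀ i, Integrable fun Q : Phase d × Phase d =>
      oscKer Q * (k i Q * (coord i Q.2 : ℂ)) * f (p, Q) := fun i =>
    integrable_of_bddSupp hf.continuous h (contDiff_oscKer.mul ((hk i).mul
      (Complex.ofRealCLM.contDiff.comp ((coord i).contDiff.comp contDiff_snd)))).continuous
  have hint3 : Integrable fun Q : Phase d × Phase d => oscKer Q * s Q * f (p, Q) :=
    integrable_of_bddSupp hf.continuous h (contDiff_oscKer.mul hs).continuous
  calc bigInt (opY f) p
      = ∫ Q, (oscKer Q * s Q * f (p, Q) - Complex.I * ∑ i,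
          oscKer Q * k i Q * dirDeriv (bigDir (Sum.inr (Sum.inl i))) f (p, Q)) := by
        refine integral_congr_ae (Eventually.of_forall fun Q => ?_)
        simp only [opY, sqH, coordH, k, s, Finset.mul_sum, mul_sub]
        congr 1
        · ring
        · exact Finset.sum_congr rfl fun i _ => by ring
    _ = ∫ Q, (oscKer Q * s Q * f (p, Q) +
          ∑ i, oscKer Q * (k i Q * (coord i Q.2 : ℂ)) * f (p, Q)) := by
        rw [integral_sub hint3 ((integrable_finsetSum _ fun i _ => hint i).const_mul _),
          integral_add hint3 (integrable_finsetSum _ fun i _ => hint2 i), integral_const_mul,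
          integral_finsetSum _ fun i _ => hint i, integral_finsetSum _ fun i _ => hint2 i,
          Finset.sum_congr rfl fun i _ => key i, ← Finset.mul_sum, ← mul_assoc, Complex.I_mul_I]
        ring
    _ = bigInt f p := by
        refine integral_congr_ae (Eventually.of_forall fun Q => ?_)
        simp only [k]
        have h0 : s Q * (1 + ∑ i, (coord i Q.2 : ℂ) ^ 2) = 1 := by
          have := inv_mul_cancel₀ (sqBracket_ofReal_ne_zero Q.2)
          simpa [s, sqBracket] using this
        calc _ = oscKer Q * f (p, Q) * (s Q * (1 + ∑ i, (coord i Q.2 : ℂ) ^ 2)) := by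
              rw [mul_add, mul_add, Finset.mul_sum, Finset.mul_sum]
              congr 1
              · ring
              · exact Finset.sum_congr rfl fun i _ => by ring
          _ = _ := by rw [h0, mul_one]

/-- The mirror image of `bigInt_opY`, with `1 - i Y·∂_H` as the transposed operator. -/
theorem bigInt_opH {p : Phase d} {f : Big d → ℂ} (hf : ContDiff ℝ ∞ f) (h : BddSupp p f) :
    bigInt (opH f) p = bigInt f p := by
  let s : Phase d × Phase d → ℂ := fun Q => ((sqBracket Q.1 : ℝ) : ℂ)⁻¹
  let k : Fin d ⊕ Fin d → Phase d × Phase d → ℂ := fun i Q => s Q * (coord i Q.1 : ℂ)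
  have hs : ContDiff ℝ ∞ s := contDiff_inv_sqBracket.comp contDiff_fst
  have hk : ∀ i, ContDiff ℝ ∞ (k i) := fun i =>
    hs.mul (Complex.ofRealCLM.contDiff.comp ((coord i).contDiff.comp contDiff_fst))
  have key : ∀ i, ∫ Q, oscKer Q * k i Q * dirDeriv (bigDir (Sum.inr (Sum.inr i))) f (p, Q)
      = Complex.I * ∫ Q, oscKer Q * (k i Q * (coord i Q.1 : ℂ)) * f (p, Q) := by
    intro i
    rw [show bigDir (Sum.inr (Sum.inr i)) = ((0, (0, dir i)) : Big d) from rfl,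
      integral_mul_dirDeriv hf h (contDiff_oscKer.mul (hk i)), ← integral_neg,
      ← integral_const_mul]
    refine integral_congr_ae (Eventually.of_forall fun Q => ?_)
    simp only [dirDeriv_mul contDiff_oscKer (hk i), dirDeriv_oscKer_snd,
      dirDeriv_of_forall_eq (hk i) ((0, dir i) : Phase d × Phase d) (fun p t => by simp [k, s]) Q]
    ring
  have hint : ∀ i, Integrable fun Q : Phase d × Phase d =>
      oscKer Q * k i Q * dirDeriv (bigDir (Sum.inr (Sum.inr i))) f (p, Q) := fun i =>
    integrable_of_bddSupp (contDiff_dirDeriv hf _).continuous (h.dirDeriv hf _)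
      (contDiff_oscKer.mul (hk i)).continuous
  have hint2 : ∀ i, Integrable fun Q : Phase d × Phase d =>
      oscKer Q * (k i Q * (coord i Q.1 : ℂ)) * f (p, Q) := fun i =>
    integrable_of_bddSupp hf.continuous h (contDiff_oscKer.mul ((hk i).mul
      (Complex.ofRealCLM.contDiff.comp ((coord i).contDiff.comp contDiff_fst)))).continuous
  have hint3 : Integrable fun Q : Phase d × Phase d => oscKer Q * s Q * f (p, Q) :=
    integrable_of_bddSupp hf.continuous h (contDiff_oscKer.mul hs).continuous
  calc bigInt (opH f) p
      = ∫ Q, (oscKer Q * s Q * f (p, Q) - Complex.I * ∑ i,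
          oscKer Q * k i Q * dirDeriv (bigDir (Sum.inr (Sum.inr i))) f (p, Q)) := by
        refine integral_congr_ae (Eventually.of_forall fun Q => ?_)
        simp only [opH, sqY, coordY, k, s, Finset.mul_sum, mul_sub]
        congr 1
        · ring
        · exact Finset.sum_congr rfl fun i _ => by ring
    _ = ∫ Q, (oscKer Q * s Q * f (p, Q) +
          ∑ i, oscKer Q * (k i Q * (coord i Q.1 : ℂ)) * f (p, Q)) := by
        rw [integral_sub hint3 ((integrable_finsetSum _ fun i _ => hint i).const_mul _),
          integral_add hint3 (integrable_finsetSum _ fun i _ => hint2 i), integral_const_mul,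
          integral_finsetSum _ fun i _ => hint i, integral_finsetSum _ fun i _ => hint2 i,
          Finset.sum_congr rfl fun i _ => key i, ← Finset.mul_sum, ← mul_assoc, Complex.I_mul_I]
        ring
    _ = bigInt f p := by
        refine integral_congr_ae (Eventually.of_forall fun Q => ?_)
        simp only [k]
        have h0 : s Q * (1 + ∑ i, (coord i Q.1 : ℂ) ^ 2) = 1 := by
          have := inv_mul_cancel₀ (sqBracket_ofReal_ne_zero Q.1)
          simpa [s, sqBracket] using this
        calc _ = oscKer Q * f (p, Q) * (s Q * (1 + ∑ i, (coord i Q.1 : ℂ) ^ 2)) := by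
              rw [mul_add, mul_add, Finset.mul_sum, Finset.mul_sum]
              congr 1
              · ring
              · exact Finset.sum_congr rfl fun i _ => by ring
          _ = _ := by rw [h0, mul_one]

theorem bigInt_ibp {p : Phase d} {f : Big d → ℂ} (hf : ContDiff ℝ ∞ f) (h : BddSupp p f)
    (M N : ℕ) : bigInt (ibp M N f) p = bigInt f p := by
  have h1 : ContDiff ℝ ∞ (opY^[M] f) ∧ BddSupp p (opY^[M] f) ∧
      bigInt (opY^[M] f) p = bigInt f p := by
    induction M with
    | zero => exact ⟨hf, h, rfl⟩
    | succ M ih =>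
      simp only [Function.iterate_succ_apply']
      exact ⟨contDiff_opY ih.1, ih.2.1.opY ih.1, (bigInt_opY ih.1 ih.2.1).trans ih.2.2⟩
  have h2 : ContDiff ℝ ∞ (ibp M N f) ∧ BddSupp p (ibp M N f) ∧
      bigInt (ibp M N f) p = bigInt f p := by
    induction N with
    | zero => exact h1
    | succ N ih =>
      simp only [ibp, Function.iterate_succ_apply'] at ih ⊢
      exact ⟨contDiff_opH ih.1, ih.2.1.opH ih.1, (bigInt_opH ih.1 ih.2.1).trans ih.2.2⟩
  exact h2.2.2

end Oscillatory

end

section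

variable {d : ℕ} {T : Type*}

/-! ### Cut-offs, with estimates uniform in the dilation parameters. -/

section Cutoffs

/-- A fixed cut-off function. -/
def cut : Cfg d → ℂ := Classical.choose exists_isCutoff

theorem cut_isCutoff : IsCutoff (cut (d := d)) := Classical.choose_spec exists_isCutoff

theorem cut_zero : cut (0 : Cfg d) = 1 := cut_isCutoff.2.2 0 (by simp)

theorem HasCompactSupport.dirDeriv_cfg {φ : Cfg d → ℂ} (h : HasCompactSupport φ) (v : Cfg d) :
    HasCompactSupport (dirDeriv v φ) := by
  refine (h.fderiv ℝ).comp_left (g := fun L : Cfg d →L[ℝ] ℂ => L v) (by simp)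

theorem exists_bound_of_compactSupport {φ : Cfg d → ℂ} (hφ : Continuous φ)
    (h : HasCompactSupport φ) :
    ∃ C R : ℝ, 0 ≤ C ∧ 0 ≤ R ∧ (∀ v, ‖φ v‖ ≤ C) ∧ ∀ v, R < ‖v‖ → φ v = 0 := by
  obtain ⟨C, hC⟩ := h.exists_bound_of_continuous hφ
  obtain ⟨R, hR⟩ := h.isCompact.isBounded.exists_norm_le
  refine ⟨max C 0, max R 0, le_max_right _ _, le_max_right _ _,
    fun v => (hC v).trans (le_max_left _ _), fun v hv => ?_⟩
  by_contra hne
  exact absurd (hR v (subset_tsupport _ hne)) (not_le.2 ((le_max_left _ _).trans_lt hv))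

theorem dirDeriv_comp_smul_clm {φ : Cfg d → ℂ} (hφ : ContDiff ℝ ∞ φ) (ℓ : Big d →L[ℝ] Cfg d)
    (s c : ℝ) (v : Big d) :
    dirDeriv v (fun q => (s : ℂ) * φ (c • ℓ q)) =
      fun q => ((s * c : ℝ) : ℂ) * dirDeriv (ℓ v) φ (c • ℓ q) := by
  funext q
  have h1 : HasFDerivAt (fun q => φ (c • ℓ q)) (fderiv ℝ φ (c • ℓ q) ∘L (c • ℓ)) q :=
    (hφ.diff_at _).hasFDerivAt.comp q (c • ℓ).hasFDerivAt
  have h2 := (h1.const_mul (s : ℂ)).fderiv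
  simp only [dirDeriv, h2]
  simp [mul_assoc]

theorem contDiff_comp_smul_clm {φ : Cfg d → ℂ} (hφ : ContDiff ℝ ∞ φ) (ℓ : Big d →L[ℝ] Cfg d)
    (s c : ℝ) : ContDiff ℝ ∞ (fun q => (s : ℂ) * φ (c • ℓ q)) :=
  contDiff_const.mul (hφ.comp (c • ℓ).contDiff)

/-- Dilated cut-offs in variables other than the momentum are amplitudes of order `0`, uniformly in
the dilation parameter. -/
theorem amp_cutoff_of_zero {φ : Cfg d → ℂ} (hφ : ContDiff ℝ ∞ φ) (hc : HasCompactSupport φ)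
    (ℓ : Big d →L[ℝ] Cfg d) (hℓ : ∀ j, ℓ (bigDir (Sum.inl (Sum.inr j))) = 0) :
    Amp 0 0 0 (fun (t : unitInterval) q => φ ((t : ℝ) • ℓ q)) := by
  -- The invariant class `s(t) φ(tℓ)` with `|s| ≤ 1` is stable because each derivative produces a
  -- factor `t ≤ 1`. The zero function is admitted since `ξ`-derivatives vanish while lowering `μ`
  -- below zero.
  refine Amp.coind (fun μ a b f => f = (fun _ _ => 0) ∨ (0 ≤ μ ∧ 0 ≤ a ∧ 0 ≤ b ∧
    ∃ (s : unitInterval → ℝ) (φ : Cfg d → ℂ), (∀ t, |s t| ≤ 1) ∧ ContDiff ℝ ∞ φ ∧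
      HasCompactSupport φ ∧ f = fun t q => (s t : ℂ) * φ ((t : ℝ) • ℓ q))) ?_ ?_ ?_
    (Or.inr ⟨le_rfl, le_rfl, le_rfl, fun _ => 1, φ, by simp, hφ, hc, by simp⟩)
  · rintro μ a b f (rfl | ⟨-, -, -, s, φ, -, hφ, -, rfl⟩) t
    · exact contDiff_const
    · exact contDiff_comp_smul_clm hφ ℓ _ _
  · rintro μ a b f (rfl | ⟨hμ, ha, hb, s, φ, hs, hφ, hc, rfl⟩)
    · exact ⟨0, le_rfl, by simp⟩
    · obtain ⟨C, R, hC, -, h, -⟩ := exists_bound_of_compactSupport hφ.continuous hc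
      refine ⟨C, hC, fun t q => ?_⟩
      have h1 : 1 ≤ wt μ a b q := (one_le_wt ha hb q).trans (wt_mono hμ le_rfl le_rfl q)
      rw [norm_mul, Complex.norm_real]
      calc ‖s t‖ * ‖φ ((t : ℝ) • ℓ q)‖ ≤ 1 * C :=
            mul_le_mul (hs t) (h _) (norm_nonneg _) zero_le_one
        _ ≤ C * wt μ a b q := by rw [one_mul]; exact le_mul_of_one_le_right hC h1
  · rintro μ a b f (rfl | ⟨hμ, ha, hb, s, φ, hs, hφ, hc, rfl⟩) i
    · left
      simp [dirDeriv_const]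
    · simp only [fun t : unitInterval => dirDeriv_comp_smul_clm hφ ℓ (s t) t (bigDir i)]
      by_cases hi : ∃ j, i = Sum.inl (Sum.inr j)
      · obtain ⟨j, rfl⟩ := hi
        left
        simp [hℓ, dirDeriv]
      · right
        have h0 : 0 ≤ (expo i).1 := by
          rcases i with (i | i) | i | i
          · simp [expo, ord]
          · exact absurd ⟨i, rfl⟩ hi
          · simp [expo]
          · simp [expo]
        refine ⟨add_nonneg hμ h0, add_nonneg ha (expo_snd_nonneg i).1,
          add_nonneg hb (expo_snd_nonneg i).2, fun t => s t * t, dirDeriv (ℓ (bigDir i)) φ,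
          fun t => ?_, contDiff_dirDeriv hφ _, HasCompactSupport.dirDeriv_cfg hc _, rfl⟩
        rw [abs_mul, abs_of_nonneg t.2.1]
        exact mul_le_one₀ (hs t) t.2.1 t.2.2

/-- Dilated cut-offs in `ξ + h(q)` are amplitudes of order `0`, uniformly in the dilation
parameter. -/
theorem amp_cutoff_momentum {φ : Cfg d → ℂ} (hφ : ContDiff ℝ ∞ φ) (hc : HasCompactSupport φ)
    (ℓ h : Big d →L[ℝ] Cfg d) (hℓ : ∀ q, ℓ q = q.1.2 + h q) (hh : ∀ q, ‖h q‖ ≤ ‖q.2.2‖) :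
    Amp 0 0 0 (fun (t : unitInterval) q => φ ((t : ℝ) • ℓ q)) := by
  -- The integer `k` counts the `ξ`-derivatives taken. Each leaves a factor `t`, and `|s t| ≤ t^k`
  -- is the information that will be converted into decay `⟨ξ⟩^{-k}`.
  refine Amp.coind (fun μ a b f => ∃ (k : ℕ) (s : unitInterval → ℝ) (φ : Cfg d → ℂ),
    -(k : ℝ) ≤ μ ∧ 0 ≤ a ∧ (k : ℝ) ≤ b ∧ (∀ t, |s t| ≤ (t : ℝ) ^ k) ∧ ContDiff ℝ ∞ φ ∧
      HasCompactSupport φ ∧ f = fun t q => (s t : ℂ) * φ ((t : ℝ) • ℓ q)) ?_ ?_ ?_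
    ⟨0, fun _ => 1, φ, by simp, le_rfl, by simp, by simp, hφ, hc, by simp⟩
  · rintro μ a b f ⟨k, s, φ, -, -, -, -, hφ, -, rfl⟩ t
    exact contDiff_comp_smul_clm hφ ℓ _ _
  · rintro μ a b f ⟨k, s, φ, hμ, ha, hb, hs, hφ, hc, rfl⟩
    obtain ⟨C, R, hC, hR, h1, h2⟩ := exists_bound_of_compactSupport hφ.continuous hc
    refine ⟨(1 + R) ^ k * C * 2 ^ (k : ℝ), by positivity, fun t q => ?_⟩
    rw [norm_mul, Complex.norm_real]
    by_cases hq : R < ‖(t : ℝ) • ℓ q‖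
    · rw [h2 _ hq, norm_zero, mul_zero]
      exact mul_nonneg (by positivity) (wt_pos _ _ _ q).le
    · have ht0 : (0 : ℝ) ≤ t := t.2.1
      have ht1 : (t : ℝ) ≤ 1 := t.2.2
      rw [norm_smul, Real.norm_of_nonneg ht0, not_lt] at hq
      have hB := bracket_pos (ℓ q)
      -- On the support `t|ξ + h| ≤ R`, so `t` is at most a multiple of `⟨ξ + h⟩⁻¹`. Peetre's
      -- inequality then replaces `⟨ξ + h⟩` by `⟨ξ⟩` at the price of `(1+|H|)^k`.
      have h3 : (t : ℝ) * bracket (ℓ q) ≤ 1 + R := by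
        have := bracket_le_one_add_norm (ℓ q)
        nlinarith
      have h4 : (t : ℝ) ^ k ≤ (1 + R) ^ k * bracket (ℓ q) ^ (-(k : ℝ)) := by
        rw [Real.rpow_neg hB.le, Real.rpow_natCast, ← div_eq_mul_inv, le_div_iff₀ (by positivity),
          ← mul_pow]
        exact pow_le_pow_left₀ (by positivity) h3 k
      have h5 : bracket (ℓ q) ^ (-(k : ℝ)) ≤ 2 ^ (k : ℝ) * wt μ a b q := by
        have h6 := bracket_add_rpow_le (-(k : ℝ)) q.1.2 (h q)
        rw [← hℓ, abs_neg, abs_of_nonneg (Nat.cast_nonneg k)] at h6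
        refine h6.trans (mul_le_mul_of_nonneg_left ?_ (by positivity))
        calc bracket q.1.2 ^ (-(k : ℝ)) * (1 + ‖h q‖) ^ (k : ℝ)
            ≤ bracket q.1.2 ^ (-(k : ℝ)) * (1 + ‖q.2.2‖) ^ (k : ℝ) := by
              have := Real.rpow_nonneg (bracket_pos q.1.2).le (-(k : ℝ))
              gcongr
              exact hh q
          _ = wt (-(k : ℝ)) 0 k q := by simp [wt]
          _ ≤ _ := wt_mono hμ ha hb q
      calc ‖s t‖ * ‖φ ((t : ℝ) • ℓ q)‖ ≤ (t : ℝ) ^ k * C :=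
            mul_le_mul (hs t) (h1 _) (norm_nonneg _) (by positivity)
        _ ≤ ((1 + R) ^ k * (2 ^ (k : ℝ) * wt μ a b q)) * C := by
            refine mul_le_mul_of_nonneg_right (h4.trans ?_) hC
            exact mul_le_mul_of_nonneg_left h5 (by positivity)
        _ = _ := by ring
  · rintro μ a b f ⟨k, s, φ, hμ, ha, hb, hs, hφ, hc, rfl⟩ i
    simp only [fun t : unitInterval => dirDeriv_comp_smul_clm hφ ℓ (s t) t (bigDir i)]
    have hs' : ∀ t : unitInterval, |s t * t| ≤ (t : ℝ) ^ (k + 1) := fun t => by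
      rw [abs_mul, abs_of_nonneg t.2.1, pow_succ]
      exact mul_le_mul_of_nonneg_right (hs t) t.2.1
    have hs'' : ∀ t : unitInterval, |s t * t| ≤ (t : ℝ) ^ k := fun t =>
      (hs' t).trans (pow_le_pow_of_le_one t.2.1 t.2.2 (Nat.le_succ k))
    by_cases hi : ∃ j, i = Sum.inl (Sum.inr j)
    · obtain ⟨j, rfl⟩ := hi
      refine ⟨k + 1, fun t => s t * t, dirDeriv (ℓ (bigDir (Sum.inl (Sum.inr j)))) φ, ?_, ?_, ?_,
        hs', contDiff_dirDeriv hφ _, HasCompactSupport.dirDeriv_cfg hc _, rfl⟩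
      · simp [expo, ord]; linarith
      · simp [expo]; linarith
      · simp [expo]; linarith
    · have h0 : 0 ≤ (expo i).1 := by
        rcases i with (i | i) | i | i
        · simp [expo, ord]
        · exact absurd ⟨i, rfl⟩ hi
        · simp [expo]
        · simp [expo]
      have h1 := expo_snd_nonneg i
      exact ⟨k, fun t => s t * t, dirDeriv (ℓ (bigDir i)) φ, by linarith, by linarith [h1.1],
        by linarith [h1.2], hs'', contDiff_dirDeriv hφ _, HasCompactSupport.dirDeriv_cfg hc _, rfl⟩

/-- The variables in which the integrand of an oscillatory integral is cut off. -/
def cutVar (i : Fin 4) : Big d →L[ℝ] Cfg d :=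
  let fst := ContinuousLinearMap.fst ℝ (Cfg d) (Cfg d)
  let snd := ContinuousLinearMap.snd ℝ (Cfg d) (Cfg d)
  let P := ContinuousLinearMap.fst ℝ (Phase d) (Phase d × Phase d)
  let Y := ContinuousLinearMap.fst ℝ (Phase d) (Phase d) ∘L
    ContinuousLinearMap.snd ℝ (Phase d) (Phase d × Phase d)
  let H := ContinuousLinearMap.snd ℝ (Phase d) (Phase d) ∘L
    ContinuousLinearMap.snd ℝ (Phase d) (Phase d × Phase d)
  match i with
  | 0 => snd ∘L P + fst ∘L H
  | 1 => fst ∘L Y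
  | 2 => snd ∘L P + snd ∘L H
  | 3 => snd ∘L Y

theorem cutVar_zero (q : Big d) : cutVar 0 q = q.1.2 + q.2.2.1 := rfl
theorem cutVar_one (q : Big d) : cutVar 1 q = q.2.1.1 := rfl
theorem cutVar_two (q : Big d) : cutVar 2 q = q.1.2 + q.2.2.2 := rfl
theorem cutVar_three (q : Big d) : cutVar 3 q = q.2.1.2 := rfl

/-- The cut-offs of the oscillatory integrals, with one dilation parameter for each of the four
groups of variables. -/
def kap (τ : Fin 4 → unitInterval) (q : Big d) : ℂ := ∏ i, cut ((τ i : ℝ) • cutVar i q)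

theorem amp_cut (i : Fin 4) :
    Amp 0 0 0 (fun (t : unitInterval) (q : Big d) => cut ((t : ℝ) • cutVar i q)) := by
  have hφ := (cut_isCutoff (d := d)).1
  have hc := (cut_isCutoff (d := d)).2.1
  fin_cases i
  · refine amp_cutoff_momentum hφ hc _ (ContinuousLinearMap.fst ℝ (Cfg d) (Cfg d) ∘L
      ContinuousLinearMap.snd ℝ (Phase d) (Phase d) ∘L
      ContinuousLinearMap.snd ℝ (Phase d) (Phase d × Phase d)) (fun q => rfl) fun q => ?_
    exact norm_fst_le q.2.2
  · refine amp_cutoff_of_zero hφ hc _ fun j => ?_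
    rfl
  · refine amp_cutoff_momentum hφ hc _ (ContinuousLinearMap.snd ℝ (Cfg d) (Cfg d) ∘L
      ContinuousLinearMap.snd ℝ (Phase d) (Phase d) ∘L
      ContinuousLinearMap.snd ℝ (Phase d) (Phase d × Phase d)) (fun q => rfl) fun q => ?_
    exact norm_snd_le q.2.2
  · refine amp_cutoff_of_zero hφ hc _ fun j => ?_
    rfl

/-- The estimates are uniform over all of `[0,1]⁴`, including zero parameters. This allows dominated
convergence whenever a single cut-off is removed while others remain. -/
theorem amp_kap : Amp 0 0 0 (fun (τ : Fin 4 → unitInterval) (q : Big d) => kap τ q) := by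
  have h := fun i => (amp_cut (d := d) i).reindex (fun τ : Fin 4 → unitInterval => τ i)
  have := (((h 0).mul (h 1)).mul (h 2)).mul (h 3)
  simp only [add_zero] at this
  simpa only [kap, Fin.prod_univ_four] using this

/-- With all four parameters positive, `y`, `z`, `ξ + η` and `ξ + ζ` are bounded; recovering `η` and
`ζ` adds `‖ξ‖` to the radius. -/
theorem bddSupp_kap {τ : Fin 4 → unitInterval} (hτ : ∀ i, τ i ≠ 0) (p : Phase d) :
    BddSupp p (kap τ) := by
  obtain ⟨C, R, -, hR, -, h⟩ := exists_bound_of_compactSupport (cut_isCutoff (d := d)).1.continuous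
    cut_isCutoff.2.1
  have hpos : ∀ i, (0 : ℝ) < τ i := fun i => unitInterval.pos_iff_ne_zero.2 (hτ i)
  let S : ℝ := ∑ i, R / τ i
  have hS : ∀ i, R / τ i ≤ S := fun i =>
    Finset.single_le_sum (f := fun i => R / (τ i : ℝ))
      (fun j _ => div_nonneg hR (hpos j).le) (Finset.mem_univ i)
  refine ⟨S + ‖p.2‖, fun Q hQ => ?_⟩
  by_contra hne
  have key : ∀ i, ‖cutVar i (p, Q)‖ ≤ S := by
    intro i
    have h1 : cut ((τ i : ℝ) • cutVar i (p, Q)) ≠ 0 :=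
      (Finset.prod_ne_zero_iff.1 hne) i (Finset.mem_univ i)
    have h2 : ‖(τ i : ℝ) • cutVar i (p, Q)‖ ≤ R := by
      by_contra h3
      exact h1 (h _ (not_le.1 h3))
    rw [norm_smul, Real.norm_of_nonneg (hpos i).le, mul_comm, ← le_div_iff₀ (hpos i)] at h2
    exact h2.trans (hS i)
  have h0 := key 0
  have h1 := key 1
  have h2 := key 2
  have h3 := key 3
  rw [cutVar_zero] at h0
  rw [cutVar_one] at h1
  rw [cutVar_two] at h2
  rw [cutVar_three] at h3
  have hp := norm_nonneg p.2
  have h4 : ‖Q.2.1‖ ≤ S + ‖p.2‖ := by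
    have := norm_sub_le (p.2 + Q.2.1) p.2
    rw [add_sub_cancel_left] at this
    linarith
  have h5 : ‖Q.2.2‖ ≤ S + ‖p.2‖ := by
    have := norm_sub_le (p.2 + Q.2.2) p.2
    rw [add_sub_cancel_left] at this
    linarith
  refine absurd hQ (not_lt.2 ?_)
  exact max_le (max_le (by linarith) (by linarith)) (max_le h4 h5)

/-- The dilation parameters `1 / (n + 1)`. -/
def eps (n : ℕ) : unitInterval := ⟨1 / (n + 1), by positivity, by
  rw [div_le_one (by positivity)]; linarith [(Nat.cast_nonneg n : (0 : ℝ) ≤ n)]⟩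

theorem eps_ne_zero (n : ℕ) : eps n ≠ 0 := by
  intro h
  have h1 : (1 : ℝ) / (n + 1) = 0 := congrArg Subtype.val h
  have : (0 : ℝ) < 1 / (n + 1) := by positivity
  linarith

theorem tendsto_eps : Tendsto (fun n => (eps n : ℝ)) atTop (𝓝 0) :=
  tendsto_one_div_add_atTop_nhds_zero_nat

theorem tendsto_eps_gt : Tendsto (fun n => (eps n : ℝ)) atTop (𝓝[>] 0) :=
  tendsto_nhdsWithin_iff.2 ⟨tendsto_eps, Eventually.of_forall fun n => by
    have : (0 : ℝ) < 1 / (n + 1) := by positivity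
    exact this⟩

/-- The value `1` is needed on a neighbourhood and not just at the point, because the cut-offs are
differentiated in the integrations by parts. -/
theorem eventually_cut_eq (i : Fin 4) (q : Big d) :
    ∀ᶠ n in atTop, ∀ᶠ r in 𝓝 q, cut ((eps n : ℝ) • cutVar i r) = 1 := by
  have h1 : Tendsto (fun n => (eps n : ℝ) * (‖cutVar i q‖ + 1)) atTop (𝓝 0) := by
    simpa using tendsto_eps.mul_const (‖cutVar i q‖ + 1)
  filter_upwards [h1.eventually_lt_const zero_lt_one] with n hn
  have h2 : ∀ᶠ r in 𝓝 q, ‖cutVar i r‖ < ‖cutVar i q‖ + 1 :=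
    ((cutVar i).continuous.norm.tendsto q).eventually_lt_const (by linarith)
  filter_upwards [h2] with r hr
  refine cut_isCutoff.2.2 _ ?_
  rw [norm_smul, Real.norm_of_nonneg (eps n).2.1]
  exact (mul_le_mul_of_nonneg_left hr.le (eps n).2.1).trans hn.le

end Cutoffs

end

section

variable {d : ℕ} {T : Type*}

/-! ### Oscillatory integrals of amplitudes are symbols. -/

section OscillatoryIntegral

variable {μ a b : ℝ}

theorem finrank_phase : Module.finrank ℝ (Phase d) = 2 * d := by
  rw [Module.finrank_prod, finrank_euclideanSpace_fin]
  ring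

theorem integrable_one_add_norm_rpow {r : ℝ} (hr : r ≤ -(2 * d + 1)) :
    Integrable (fun Y : Phase d => (1 + ‖Y‖) ^ r) := by
  have := integrable_one_add_norm (E := Phase d) (μ := volume) (r := -r) (by
    rw [finrank_phase]; push_cast; linarith)
  simpa using this

theorem integrable_wt (hb : b ≤ -(2 * d + 1)) (ha : a ≤ -(2 * d + 1)) (p : Phase d) :
    Integrable (fun Q : Phase d × Phase d => wt μ a b (p, Q)) := by
  have := ((integrable_one_add_norm_rpow ha).mul_prod
    (integrable_one_add_norm_rpow hb)).const_mul (bracket p.2 ^ μ)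
  simp only [wt, mul_assoc]
  exact this

theorem norm_oscKer_mul (Q : Phase d × Phase d) (z : ℂ) : ‖oscKer Q * z‖ = ‖z‖ := by
  rw [norm_mul, norm_oscKer, one_mul]

theorem Amp.integrable {f : T → Big d → ℂ} (hf : Amp μ a b f) (hb : b ≤ -(2 * d + 1))
    (ha : a ≤ -(2 * d + 1)) (t : T) (p : Phase d) :
    Integrable (fun Q : Phase d × Phase d => oscKer Q * f t (p, Q)) := by
  obtain ⟨C, -, hC⟩ := hf.bound
  refine ((integrable_wt (μ := μ) hb ha p).const_mul C).mono' ?_ (Eventually.of_forall fun Q => ?_)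
  · exact (contDiff_oscKer.continuous.mul
      ((hf.smooth t).continuous.comp (by fun_prop))).aestronglyMeasurable
  · rw [norm_oscKer_mul]
    exact hC t (p, Q)

/-- `M`, `N` integrations by parts make the oscillatory integral absolutely convergent. -/
def Adm (d : ℕ) (a b : ℝ) (M N : ℕ) : Prop :=
  b - M ≤ -(2 * d + 1) ∧ a + 2 * M - N ≤ -(2 * d + 1)

/-- `M` is chosen first, to make the integrand integrable in `H`. It costs `2M` powers of `1+|Y|`,
which `N` then absorbs without affecting `H`. -/
theorem exists_adm (a b : ℝ) : ∃ M N, Adm d a b M N := by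
  obtain ⟨M, hM⟩ := exists_nat_ge (b + (2 * d + 1))
  obtain ⟨N, hN⟩ := exists_nat_ge (a + 2 * M + (2 * d + 1))
  exact ⟨M, N, by linarith, by linarith⟩

theorem Adm.mono {a b a' b' : ℝ} {M N : ℕ} (h : Adm d a' b' M N) (ha : a ≤ a') (hb : b ≤ b') :
    Adm d a b M N := ⟨by linarith [h.1], by linarith [h.2]⟩

/-- The amplitude bound, uniform in `n`, supplies the dominating function. Pointwise convergence is
eventual equality, by locality of the integrations by parts. -/
theorem tendsto_bigInt_ibp {F : ℕ → Big d → ℂ} {f : Big d → ℂ} (hF : Amp μ a b F)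
    {M N : ℕ} (h : Adm d a b M N) (p : Phase d)
    (hlim : ∀ q, ∀ᶠ n in atTop, F n =ᶠ[𝓝 q] f) :
    Tendsto (fun n => bigInt (ibp M N (F n)) p) atTop (𝓝 (bigInt (ibp M N f) p)) := by
  have hI := hF.ibp M N
  obtain ⟨C, -, hC⟩ := hI.bound
  refine tendsto_integral_of_dominated_convergence (fun Q => C * wt μ _ _ (p, Q))
    (fun n => (hI.integrable h.1 h.2 n p).aestronglyMeasurable)
    ((integrable_wt h.1 h.2 p).const_mul C)
    (fun n => Eventually.of_forall fun Q => ?_) (Eventually.of_forall fun Q => ?_)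
  · rw [norm_oscKer_mul]
    exact hC n (p, Q)
  · refine tendsto_const_nhds.congr' ?_
    filter_upwards [hlim (p, Q)] with n hn
    rw [ibp_congr M N hn]

/-- All four cut-off parameters equal to `1 / (n + 1)`. -/
def diagEps (n : ℕ) : Fin 4 → unitInterval := fun _ => eps n

/-- The oscillatory integral of an amplitude. -/
def osc (f : Big d → ℂ) (p : Phase d) : ℂ :=
  limUnder atTop fun n => bigInt (fun q => kap (diagEps n) q * f q) p

theorem Amp.kap_mul {S : Type*} {f : T → Big d → ℂ} (hf : Amp μ a b f)
    (φ : S → Fin 4 → unitInterval) (ψ : S → T) :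
    Amp μ a b (fun s q => kap (φ s) q * f (ψ s) q) := by
  simpa using (amp_kap.reindex φ).mul (hf.reindex ψ)

theorem BddSupp.mul_right {p : Phase d} {f : Big d → ℂ} (h : BddSupp p f) (k : Big d → ℂ) :
    BddSupp p (fun q => f q * k q) := by
  obtain ⟨R, hR⟩ := h
  exact ⟨R, fun Q hQ => by simp [hR Q hQ]⟩

theorem eventually_kap_diagEps (q : Big d) :
    ∀ᶠ n in atTop, ∀ᶠ r in 𝓝 q, kap (diagEps n) r = 1 := by
  have h : ∀ᶠ n in atTop, ∀ i, ∀ᶠ r in 𝓝 q, cut ((eps n : ℝ) • cutVar i r) = 1 :=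
    eventually_all.2 fun i => eventually_cut_eq i q
  filter_upwards [h] with n hn
  filter_upwards [eventually_all.2 hn] with r hr
  simp [kap, diagEps, hr]

theorem tendsto_osc_aux {f : Big d → ℂ} (hf : Amp μ a b (fun _ : Unit => f)) {M N : ℕ}
    (h : Adm d a b M N) (p : Phase d) :
    Tendsto (fun n => bigInt (fun q => kap (diagEps n) q * f q) p) atTop
      (𝓝 (bigInt (ibp M N f) p)) := by
  have hF : Amp μ a b (fun (n : ℕ) q => kap (diagEps n) q * f q) := hf.kap_mul _ fun _ => ()
  refine (tendsto_bigInt_ibp hF h p fun q => ?_).congr fun n =>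
    bigInt_ibp (hF.smooth n) ((bddSupp_kap (fun _ => eps_ne_zero n) p).mul_right f) M N
  filter_upwards [eventually_kap_diagEps q] with n hn
  filter_upwards [hn] with r hr
  rw [hr, one_mul]

/-- Any admissible pair `(M, N)` computes the same limit, so exponents may be adapted to each use.
-/
theorem osc_eq {f : Big d → ℂ} (hf : Amp μ a b (fun _ : Unit => f)) {M N : ℕ}
    (h : Adm d a b M N) (p : Phase d) : osc f p = bigInt (ibp M N f) p :=
  (tendsto_osc_aux hf h p).limUnder_eq

theorem tendsto_osc {f : Big d → ℂ} (hf : Amp μ a b (fun _ : Unit => f)) (p : Phase d) :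
    Tendsto (fun n => bigInt (fun q => kap (diagEps n) q * f q) p) atTop (𝓝 (osc f p)) := by
  obtain ⟨M, N, h⟩ := exists_adm (d := d) a b
  rw [osc_eq hf h]
  exact tendsto_osc_aux hf h p

theorem osc_of_bddSupp {f : Big d → ℂ} (hf : Amp μ a b (fun _ : Unit => f)) {p : Phase d}
    (h : BddSupp p f) : osc f p = bigInt f p := by
  obtain ⟨M, N, hMN⟩ := exists_adm (d := d) a b
  rw [osc_eq hf hMN, bigInt_ibp (hf.smooth ()) h]

theorem osc_tendsto {F : ℕ → Big d → ℂ} {f : Big d → ℂ} (hF : Amp μ a b F)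
    (hf : Amp μ a b (fun _ : Unit => f)) (p : Phase d)
    (hlim : ∀ q, ∀ᶠ n in atTop, F n =ᶠ[𝓝 q] f) :
    Tendsto (fun n => osc (F n) p) atTop (𝓝 (osc f p)) := by
  obtain ⟨M, N, h⟩ := exists_adm (d := d) a b
  simp only [osc_eq hf h, fun n => osc_eq (hF.reindex fun _ : Unit => n) h]
  exact tendsto_bigInt_ibp hF h p hlim

theorem exists_norm_osc_le {f : T → Big d → ℂ} (hf : Amp μ a b f) :
    ∃ C, 0 ≤ C ∧ ∀ t p, ‖osc (f t) p‖ ≤ C * bracket p.2 ^ μ := by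
  obtain ⟨M, N, h⟩ := exists_adm (d := d) a b
  obtain ⟨C, hC0, hC⟩ := (hf.ibp M N).bound
  refine ⟨C * ∫ Q : Phase d × Phase d,
    (1 + ‖Q.1‖) ^ (a + 2 * M - N) * (1 + ‖Q.2‖) ^ (b - M),
    mul_nonneg hC0 (integral_nonneg fun Q => by positivity), fun t p => ?_⟩
  rw [osc_eq (hf.reindex fun _ : Unit => t) h]
  refine (norm_integral_le_integral_norm _).trans ?_
  calc ∫ Q : Phase d × Phase d, ‖oscKer Q * ibp M N (f t) (p, Q)‖
      ≤ ∫ Q : Phase d × Phase d, C * wt μ (a + 2 * M - N) (b - M) (p, Q) := by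
        refine integral_mono ((hf.ibp M N).integrable h.1 h.2 t p).norm
          ((integrable_wt h.1 h.2 p).const_mul C) fun Q => ?_
        simp only [norm_oscKer_mul]
        exact hC t (p, Q)
    _ = _ := by
        simp only [wt, mul_assoc, integral_const_mul]
        ring

theorem osc_sub {f h : Big d → ℂ} (hf : Amp μ a b (fun _ : Unit => f))
    (hh : Amp μ a b (fun _ : Unit => h)) (p : Phase d) :
    osc (fun q => f q - h q) p = osc f p - osc h p := by
  refine tendsto_nhds_unique (tendsto_osc (hf.sub hh) p) ?_
  refine ((tendsto_osc hf p).sub (tendsto_osc hh p)).congr fun n => ?_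
  have hi : ∀ {f : Big d → ℂ}, Amp μ a b (fun _ : Unit => f) → Integrable
      (fun Q : Phase d × Phase d => oscKer Q * (kap (diagEps n) (p, Q) * f (p, Q))) := fun hf =>
    integrable_of_bddSupp (f := fun q => kap (diagEps n) q * _)
      ((hf.kap_mul (fun _ : Unit => diagEps n) id).smooth ()).continuous
      ((bddSupp_kap (fun _ => eps_ne_zero n) p).mul_right _) contDiff_oscKer.continuous
  rw [bigInt, bigInt, bigInt, ← integral_sub (hi hf) (hi hh)]
  refine integral_congr_ae (Eventually.of_forall fun Q => ?_)
  ring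

/-- A Fréchet derivative on phase space is controlled by the partial derivatives. -/
theorem norm_le_sum_dir (L : Phase d →L[ℝ] ℂ) : ‖L‖ ≤ ∑ i, ‖L (dir i)‖ := by
  refine L.opNorm_le_bound (Finset.sum_nonneg fun _ _ => norm_nonneg _) fun v => ?_
  conv_lhs => rw [← sum_coord_smul_dir v]
  rw [map_sum, Finset.sum_mul]
  refine (norm_sum_le _ _).trans (Finset.sum_le_sum fun i _ => ?_)
  rw [map_smul, norm_smul, mul_comm]
  exact mul_le_mul_of_nonneg_left (abs_coord_le i v) (norm_nonneg _)

theorem hasFDerivAt_bigInt {f : Big d → ℂ} (hf : Amp μ a b (fun _ : Unit => f))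
    (hb : b + 2 ≤ -(2 * d + 1)) (ha : a + 2 ≤ -(2 * d + 1)) (p : Phase d) :
    ∃ L : Phase d →L[ℝ] ℂ, HasFDerivAt (bigInt f) L p ∧
      ∀ i, L (dir i) = bigInt (dirDeriv (bigDir (Sum.inl i)) f) p := by
  let inl := ContinuousLinearMap.inl ℝ (Phase d) (Phase d × Phase d)
  let F' : Phase d → Phase d × Phase d → Phase d →L[ℝ] ℂ :=
    fun p Q => oscKer Q • (fderiv ℝ f (p, Q) ∘L inl)
  have hsm := hf.smooth ()
  have hfd : ContDiff ℝ ∞ (fderiv ℝ f) := hsm.fderiv_right (m := ∞) (by simp)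
  have hd : ∀ i, Amp μ (a + 2) (b + 2) (fun _ : Unit => dirDeriv (bigDir (Sum.inl i)) f) :=
    fun i => (hf.deriv (Sum.inl i)).weaken (by rcases i with i | i <;> simp [expo, ord]) le_rfl
      le_rfl
  choose C hC0 hC using fun i => (hd i).bound
  have hF'c : ∀ p, Continuous (F' p) := fun p =>
    contDiff_oscKer.continuous.smul ((hfd.continuous.comp (by fun_prop)).clm_comp continuous_const)
  have hF'i : ∀ p Q i, F' p Q (dir i) = oscKer Q * dirDeriv (bigDir (Sum.inl i)) f (p, Q) :=
    fun p Q i => rfl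
  -- Peetre's inequality for displacements of length at most `1`, giving a bound on `⟨ξ⟩^μ` uniform
  -- over the unit ball around `p`.
  let K : ℝ := 2 ^ |μ| * (bracket p.2 ^ μ * (1 + 1) ^ |μ|)
  let bound : Phase d × Phase d → ℝ := fun Q =>
    (∑ i, C i) * (K * ((1 + ‖Q.1‖) ^ (a + 2) * (1 + ‖Q.2‖) ^ (b + 2)))
  have hbound : ∀ Q, ∀ p' ∈ Metric.ball p 1, ‖F' p' Q‖ ≤ bound Q := by
    intro Q p' hp'
    refine (norm_le_sum_dir _).trans ?_
    simp only [bound]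
    rw [Finset.sum_mul]
    refine Finset.sum_le_sum fun i _ => ?_
    rw [hF'i, norm_oscKer_mul]
    refine (hC i () (p', Q)).trans (mul_le_mul_of_nonneg_left ?_ (hC0 i))
    rw [wt, mul_assoc]
    refine mul_le_mul_of_nonneg_right ?_ (by positivity)
    have h1 := bracket_add_rpow_le μ p.2 (p'.2 - p.2)
    rw [add_sub_cancel] at h1
    refine h1.trans ?_
    have h2 : ‖p'.2 - p.2‖ ≤ 1 :=
      (norm_snd_le (p' - p)).trans (by simpa [dist_eq_norm] using (Metric.mem_ball.1 hp').le)
    have h3 := Real.rpow_nonneg (bracket_pos p.2).le μ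
    simp only [K]
    gcongr
  have hint : Integrable (F' p) := by
    refine Integrable.mono' ?_ (hF'c p).aestronglyMeasurable
      (Eventually.of_forall fun Q => hbound Q p (Metric.mem_ball_self one_pos))
    exact (((integrable_one_add_norm_rpow ha).mul_prod
      (integrable_one_add_norm_rpow hb)).const_mul K).const_mul _
  refine ⟨∫ Q, F' p Q, ?_, fun i => ?_⟩
  · refine hasFDerivAt_integral_of_dominated_of_fderiv_le (bound := bound)
      (Metric.ball_mem_nhds p one_pos) (Eventually.of_forall fun p' => ?_) ?_
      (hF'c p).aestronglyMeasurable (Eventually.of_forall hbound) ?_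
      (Eventually.of_forall fun Q p' _ => ?_)
    · exact (hf.integrable (by linarith) (by linarith) () p').aestronglyMeasurable
    · exact hf.integrable (by linarith) (by linarith) () p
    · exact (((integrable_one_add_norm_rpow ha).mul_prod
        (integrable_one_add_norm_rpow hb)).const_mul K).const_mul _
    · have h1 : HasFDerivAt (fun p => f (p, Q)) (fderiv ℝ f (p', Q) ∘L inl) p' :=
        HasFDerivAt.comp p' (f := fun p => (p, Q)) (hsm.diff_at (p', Q)).hasFDerivAt
          (hasFDerivAt_prodMk_left p' Q)
      exact h1.const_mul (oscKer Q)
  · rw [ContinuousLinearMap.integral_apply hint]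
    rfl

/-- A parameter derivative raises both exponents by `2`. Choosing `M`, `N` for the raised exponents
makes the integral and its derivative absolutely convergent together. -/
theorem hasFDerivAt_osc {f : Big d → ℂ} (hf : Amp μ a b (fun _ : Unit => f)) (p : Phase d) :
    ∃ L : Phase d →L[ℝ] ℂ, HasFDerivAt (osc f) L p ∧
      ∀ i, L (dir i) = osc (dirDeriv (bigDir (Sum.inl i)) f) p := by
  obtain ⟨M, N, h⟩ := exists_adm (d := d) (a + 2) (b + 2)
  have h1 := h.1
  have h2 := h.2
  obtain ⟨L, hL, hLi⟩ := hasFDerivAt_bigInt (hf.ibp M N) (by linarith) (by linarith) p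
  refine ⟨L, ?_, fun i => ?_⟩
  · rwa [show osc f = bigInt (ibp M N f) from
      funext (osc_eq hf (h.mono (by linarith) (by linarith)))]
  · rw [hLi, dirDeriv_param_ibp (hf.smooth ()), osc_eq (hf.deriv (Sum.inl i))]
    exact h.mono (by simp [expo]) (by simp [expo])

theorem pderiv_osc {f : Big d → ℂ} (hf : Amp μ a b (fun _ : Unit => f)) (i : Fin d ⊕ Fin d) :
    pderiv i (osc f) = osc (dirDeriv (bigDir (Sum.inl i)) f) := by
  funext p
  obtain ⟨L, hL, hLi⟩ := hasFDerivAt_osc hf p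
  rw [pderiv, hL.fderiv, hLi]

/-- A function on phase space is smooth if all its iterated partial derivatives exist. -/
theorem contDiff_of_pderiv {f : Phase d → ℂ} (n : ℕ) (hf : ∀ L, Differentiable ℝ (iterPderiv L f)) :
    ContDiff ℝ n f := by
  induction n generalizing f with
  | zero => exact contDiff_zero.2 (hf []).continuous
  | succ n ih =>
    have h1 : ∀ i, ContDiff ℝ n (pderiv i f) := fun i =>
      ih fun L => by rw [← iterPderiv_append_singleton]; exact hf _
    have h2 : fderiv ℝ f = fun p => ∑ i, (coord i).smulRight (pderiv i f p) := by
      funext p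
      refine ContinuousLinearMap.ext fun v => ?_
      conv_lhs => rw [← sum_coord_smul_dir v]
      simp [pderiv, map_sum, -Fintype.sum_sum_type]
    have h3 : Differentiable ℝ f := hf []
    rw [Nat.cast_succ]
    refine contDiff_succ_iff_fderiv.2 ⟨h3, fun h => absurd h (by simp), ?_⟩
    rw [h2]
    refine ContDiff.sum fun i _ => ?_
    exact (ContinuousLinearMap.smulRightL ℝ (Phase d) ℂ (coord i)).contDiff.comp (h1 i)

/-- Oscillatory integrals of amplitudes of order `μ` are symbols of order `μ`. -/
theorem isSymbol_osc {f : Big d → ℂ} (hf : Amp μ a b (fun _ : Unit => f)) :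
    IsSymbol μ (osc f) := by
  -- Every derivative of the symbol is again an oscillatory integral. Only the exponent of `⟨ξ⟩` is
  -- tracked, since the growth in `Y` and `H` is irrelevant after integration.
  have key : ∀ L : List (Fin d ⊕ Fin d), ∃ (a' b' : ℝ) (F : Big d → ℂ),
      Amp (μ - momentumOrder L) a' b' (fun _ : Unit => F) ∧ iterPderiv L (osc f) = osc F := by
    intro L
    induction L with
    | nil => exact ⟨a, b, f, by simpa [momentumOrder] using hf, rfl⟩
    | cons i L ih =>
      obtain ⟨a', b', F, hF, he⟩ := ih
      refine ⟨_, _, _, (hF.deriv (Sum.inl i)).weaken ?_ le_rfl le_rfl, ?_⟩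
      · rw [momentumOrder_cons]
        simp [expo]
        linarith
      · rw [iterPderiv, he, pderiv_osc hF]
  refine ⟨contDiff_infty.2 fun n => contDiff_of_pderiv n fun L => ?_, fun L => ?_⟩
  · obtain ⟨a', b', F, hF, he⟩ := key L
    rw [he]
    intro p
    obtain ⟨L', hL', -⟩ := hasFDerivAt_osc hF p
    exact hL'.differentiableAt
  · obtain ⟨a', b', F, hF, he⟩ := key L
    obtain ⟨C, -, hC⟩ := exists_norm_osc_le hF
    refine ⟨C, fun x ξ => ?_⟩
    have h1 := hC () (x, ξ)
    have h2 := bracket_pos ξ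
    rw [he, show (momentumOrder L : ℝ) - μ = -(μ - momentumOrder L) by ring, Real.rpow_neg h2.le,
      inv_mul_le_iff₀ (Real.rpow_pos_of_pos h2 _), mul_comm]
    exact h1

end OscillatoryIntegral

end

section

variable {d : ℕ}

/-! ### Substitutions in symbols, and Taylor estimates in the momentum. -/

section Shift

/-- `AmpN n μ a b f`: the function `f` satisfies the estimates of an amplitude up to order `n`. -/
def AmpN (n : ℕ) (μ a b : ℝ) (f : Big d → ℂ) : Prop :=
  CtlN bigDir bigGain n (wt μ a b) (fun _ : Unit => f)

/-- A single amplitude. -/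
abbrev Amp₁ (μ a b : ℝ) (f : Big d → ℂ) : Prop := Amp μ a b (fun _ : Unit => f)

variable {n : ℕ} {μ a b μ' a' b' : ℝ} {f h : Big d → ℂ}

theorem AmpN.weaken (hf : AmpN n μ a b f) (hμ : μ ≤ μ') (ha : a ≤ a') (hb : b ≤ b') :
    AmpN n μ' a' b' f :=
  CtlN.mono bigGain_nonneg zero_le_one (fun q => by rw [one_mul]; exact wt_mono hμ ha hb q) hf

theorem AmpN.const_mul (c : ℂ) (hf : AmpN n μ a b f) : AmpN n μ a b (fun q => c * f q) :=
  CtlN.scale (s := fun _ => c) (norm_nonneg c) (fun _ => le_rfl) hf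

theorem AmpN.sum {κ : Type*} (s : Finset κ) {f : κ → Big d → ℂ}
    (hf : ∀ k ∈ s, AmpN n μ a b (f k)) : AmpN n μ a b (fun q => ∑ k ∈ s, f k q) := by
  classical
  induction s using Finset.induction_on with
  | empty =>
    simp only [Finset.sum_empty]
    exact (Amp.zero (T := Unit) (d := d) (μ := μ) (a := a) (b := b)) n
  | insert k s hk ih =>
    simp only [Finset.sum_insert hk]
    exact CtlN.add (hf k (by simp)) (ih fun j hj => hf j (by simp [hj]))

/-- Derivatives are required only at the preceding order. This permits induction on the order over
all symbols at once when a derivative of a substituted symbol is expressed by other symbols. -/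
theorem AmpN.intro {C : ℝ} (hsm : ContDiff ℝ ∞ f) (hC : 0 ≤ C) (hbd : ∀ q, ‖f q‖ ≤ C * wt μ a b q)
    (hd : ∀ k i, n = k + 1 → AmpN k (μ + (expo i).1) (a + (expo i).2.1) (b + (expo i).2.2)
      (dirDeriv (bigDir i) f)) : AmpN n μ a b f := by
  cases n with
  | zero => exact ⟨fun _ => hsm, C, hC, fun _ => hbd⟩
  | succ n =>
    refine ⟨⟨fun _ => hsm, C, hC, fun _ => hbd⟩, fun i => ?_⟩
    have := hd n i rfl
    rwa [AmpN, ← funext (wt_mul_bigGain μ a b i)] at this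

/-- The data `(X, h)` of a substitution `(x, ξ) ↦ (X q, ξ + h q)`. -/
structure IsShift (X h : Big d →L[ℝ] Cfg d) : Prop where
  norm_le : ∀ q, ‖h q‖ ≤ ‖q.2.2‖
  h_p : ∀ i, h (bigDir (Sum.inl i)) = 0
  h_Y : ∀ i, h (bigDir (Sum.inr (Sum.inl i))) = 0
  X_xi : ∀ j, X (bigDir (Sum.inl (Sum.inr j))) = 0
  X_H : ∀ i, X (bigDir (Sum.inr (Sum.inr i))) = 0

/-- The substitution `(x, ξ) ↦ (X q, ξ + h q)` in a function on phase space. -/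
def pull (X h : Big d →L[ℝ] Cfg d) (s : Phase d → ℂ) (q : Big d) : ℂ := s (X q, q.1.2 + h q)

variable {X h : Big d →L[ℝ] Cfg d}

theorem IsShift.zero (H : IsShift X h) : IsShift X 0 :=
  ⟨fun q => by simp, fun i => rfl, fun i => rfl, H.X_xi, H.X_H⟩

theorem contDiff_pull {s : Phase d → ℂ} (hs : ContDiff ℝ ∞ s) : ContDiff ℝ ∞ (pull X h s) :=
  hs.comp (X.contDiff.prodMk ((contDiff_snd.comp contDiff_fst).add h.contDiff))

theorem dirDeriv_pull {s : Phase d → ℂ} (hs : ContDiff ℝ ∞ s) (v : Big d) :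
    dirDeriv v (pull X h s) = fun q => ∑ k, (X v k : ℂ) * pull X h (pderiv (Sum.inl k) s) q +
      ∑ k, ((v.1.2 + h v) k : ℂ) * pull X h (pderiv (Sum.inr k) s) q := by
  let κ : Big d →L[ℝ] Phase d := X.prod (ContinuousLinearMap.snd ℝ (Cfg d) (Cfg d) ∘L
    ContinuousLinearMap.fst ℝ (Phase d) (Phase d × Phase d) + h)
  have hκ : ∀ q, κ q = (X q, q.1.2 + h q) := fun q => rfl
  funext q
  have h1 : HasFDerivAt (s ∘ κ) (fderiv ℝ s (κ q) ∘L κ) q :=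
    (hs.diff_at _).hasFDerivAt.comp q κ.hasFDerivAt
  have h2 : dirDeriv v (pull X h s) q = fderiv ℝ s (κ q) (κ v) := by
    rw [dirDeriv, show pull X h s = s ∘ κ from rfl, h1.fderiv]
    rfl
  rw [h2]
  conv_lhs => rw [← sum_coord_smul_dir (κ v)]
  rw [map_sum, Fintype.sum_sum_type]
  simp only [map_smul, Complex.real_smul]
  rfl

theorem dirDeriv_pull_x (H : IsShift X h) {s : Phase d → ℂ} (hs : ContDiff ℝ ∞ s) (j : Fin d) :
    dirDeriv (bigDir (Sum.inl (Sum.inl j))) (pull X h s) = fun q =>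
      ∑ k, (X (bigDir (Sum.inl (Sum.inl j))) k : ℂ) * pull X h (pderiv (Sum.inl k) s) q := by
  rw [dirDeriv_pull hs, H.h_p]
  simp [bigDir, dir]

theorem dirDeriv_pull_Y (H : IsShift X h) {s : Phase d → ℂ} (hs : ContDiff ℝ ∞ s)
    (i : Fin d ⊕ Fin d) : dirDeriv (bigDir (Sum.inr (Sum.inl i))) (pull X h s) = fun q =>
      ∑ k, (X (bigDir (Sum.inr (Sum.inl i))) k : ℂ) * pull X h (pderiv (Sum.inl k) s) q := by
  rw [dirDeriv_pull hs, H.h_Y]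
  simp [bigDir]

theorem dirDeriv_pull_xi (H : IsShift X h) {s : Phase d → ℂ} (hs : ContDiff ℝ ∞ s) (j : Fin d) :
    dirDeriv (bigDir (Sum.inl (Sum.inr j))) (pull X h s) = pull X h (pderiv (Sum.inr j) s) := by
  rw [dirDeriv_pull hs, H.h_p, H.X_xi]
  funext q
  simp [bigDir, dir, apply_ite Complex.ofReal]

theorem dirDeriv_pull_H (H : IsShift X h) {s : Phase d → ℂ} (hs : ContDiff ℝ ∞ s)
    (i : Fin d ⊕ Fin d) : dirDeriv (bigDir (Sum.inr (Sum.inr i))) (pull X h s) = fun q =>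
      ∑ k, (h (bigDir (Sum.inr (Sum.inr i))) k : ℂ) * pull X h (pderiv (Sum.inr k) s) q := by
  rw [dirDeriv_pull hs, H.X_H]
  simp [bigDir]

/-- Peetre's inequality; it is the source of the exponent `|m|` of `1+|H|` in all substituted
symbols. -/
theorem bracket_shift_le (H : IsShift X h) (m : ℝ) (q : Big d) :
    bracket (q.1.2 + h q) ^ m ≤ 2 ^ |m| * wt m 0 |m| q := by
  refine (bracket_add_rpow_le m q.1.2 (h q)).trans (mul_le_mul_of_nonneg_left ?_ (by positivity))
  have h1 := Real.rpow_nonneg (bracket_pos q.1.2).le m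
  have h2 := H.norm_le q
  rw [wt, Real.rpow_zero, mul_one]
  gcongr

theorem abs_sub_one_le (m : ℝ) : |m - 1| ≤ |m| + 1 := by
  simpa using abs_sub m 1

/-- Substitution in a symbol. -/
theorem IsSymbol.amp_pull (H : IsShift X h) {m : ℝ} {s : Phase d → ℂ} (hs : IsSymbol m s) :
    Amp₁ m 0 |m| (pull X h s) := by
  intro n
  change AmpN n m 0 |m| _
  induction n using Nat.strong_induction_on generalizing m s with
  | _ n ih =>
    obtain ⟨C, hC, hb⟩ := hs.norm_le
    refine AmpN.intro (C := C * 2 ^ |m|) (contDiff_pull hs.smooth) (by positivity) (fun q => ?_)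
      fun k i hk => ?_
    · rw [mul_assoc]
      exact (hb _).trans (mul_le_mul_of_nonneg_left (bracket_shift_le H m q) hC)
    · have ihk : ∀ {m : ℝ} {s : Phase d → ℂ}, IsSymbol m s → AmpN k m 0 |m| (pull X h s) :=
        fun hs => ih k (by omega) hs
      rcases i with (j | j) | (i | i)
      · rw [dirDeriv_pull_x H hs.smooth]
        refine AmpN.sum _ fun l _ => (AmpN.const_mul _ (ihk (m := m) ?_)).weaken ?_ ?_ ?_
        · simpa [ord] using hs.pderiv (Sum.inl l)
        all_goals simp [expo, ord]
      · rw [dirDeriv_pull_xi H hs.smooth]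
        refine (ihk (hs.pderiv (Sum.inr j))).weaken ?_ ?_ ?_
        · simp [expo, ord, sub_eq_add_neg]
        · simp [expo]
        -- The change of order from `m` to `m - 1` may raise the exponent of `1+|H|` by one, within
        -- the two powers allowed to a `ξ`-derivative.
        · simp [expo, ord]; linarith [abs_sub_one_le m]
      · rw [dirDeriv_pull_Y H hs.smooth]
        refine AmpN.sum _ fun l _ => (AmpN.const_mul _ (ihk (m := m) ?_)).weaken ?_ ?_ ?_
        · simpa [ord] using hs.pderiv (Sum.inl l)
        all_goals simp [expo]
      · rw [dirDeriv_pull_H H hs.smooth]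
        refine AmpN.sum _ fun l _ => (AmpN.const_mul _ (ihk (m := m) ?_)).weaken ?_ ?_ ?_
        -- The order gained is discarded: an `H`-derivative has no allowance for growth in `H`, and
        -- `|m - 1|` may exceed `|m|`.
        · exact (hs.pderiv (Sum.inr l)).mono (by simp [ord])
        all_goals simp [expo]

/-- All derivatives of `s` satisfy the estimates of a symbol of order `m`. -/
structure IsPreSymbol (m : ℝ) (s : Phase d → ℂ) : Prop where
  smooth : ContDiff ℝ ∞ s
  pderiv : ∀ i, IsSymbol (m - ord i) (pderiv i s)

theorem IsSymbol.pre {m : ℝ} {s : Phase d → ℂ} (hs : IsSymbol m s) : IsPreSymbol m s :=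
  ⟨hs.smooth, hs.pderiv⟩

theorem hasDerivAt_segment {s : Phase d → ℂ} (hs : ContDiff ℝ ∞ s) (p : Phase d) (v : Cfg d)
    (t : ℝ) : HasDerivAt (fun t : ℝ => s (p.1, p.2 + t • v))
      (∑ k, (v k : ℂ) * pderiv (Sum.inr k) s (p.1, p.2 + t • v)) t := by
  have h1 : HasDerivAt (fun t : ℝ => ((p.1, p.2 + t • v) : Phase d)) ((0, v) : Phase d) t := by
    have := ((hasDerivAt_id t).smul_const v).const_add p.2
    rw [one_smul] at this
    exact (hasDerivAt_const t p.1).prodMk this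
  have h2 := (hs.diff_at (p.1, p.2 + t • v)).hasFDerivAt.comp_hasDerivAt t h1
  refine h2.congr_deriv ?_
  conv_lhs => rw [← sum_coord_smul_dir ((0, v) : Phase d)]
  rw [map_sum, Fintype.sum_sum_type]
  simp only [map_smul, Complex.real_smul]
  simp [coord_inl, coord_inr, pderiv]

theorem bracket_segment_le (m : ℝ) (ξ v : Cfg d) {t : ℝ} (ht : t ∈ Icc (0 : ℝ) 1) :
    bracket (ξ + t • v) ^ m ≤ 2 ^ |m| * (bracket ξ ^ m * (1 + ‖v‖) ^ |m|) := by
  refine (bracket_add_rpow_le m ξ (t • v)).trans (mul_le_mul_of_nonneg_left ?_ (by positivity))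
  have h1 := Real.rpow_nonneg (bracket_pos ξ).le m
  gcongr
  rw [norm_smul, Real.norm_of_nonneg ht.1]
  exact mul_le_of_le_one_left (norm_nonneg _) ht.2

/-- The mean value inequality along the momentum segment: one factor `1+|v|` comes from the
displacement, and `(1+|v|)^{|m-1|}` from Peetre's inequality. Only derivatives of `s` enter, so `s`
itself need not be a symbol. -/
theorem IsPreSymbol.norm_sub_le {m : ℝ} {s : Phase d → ℂ} (hs : IsPreSymbol m s) :
    ∃ C, 0 ≤ C ∧ ∀ (p : Phase d) (v : Cfg d), ‖s (p.1, p.2 + v) - s p‖ ≤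
      C * (bracket p.2 ^ (m - 1) * (1 + ‖v‖) ^ (1 + |m - 1|)) := by
  choose C hC hb using fun k : Fin d => (hs.pderiv (Sum.inr k)).norm_le
  refine ⟨(∑ k, C k) * 2 ^ |m - 1|,
    mul_nonneg (Finset.sum_nonneg fun k _ => hC k) (by positivity), fun p v => ?_⟩
  have h1 := norm_image_sub_le_of_norm_deriv_le_segment_01'
    (f := fun t : ℝ => s (p.1, p.2 + t • v))
    (C := (∑ k, C k) * 2 ^ |m - 1| * (bracket p.2 ^ (m - 1) * (1 + ‖v‖) ^ (1 + |m - 1|)))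
    (fun t _ => (hasDerivAt_segment hs.smooth p v t).hasDerivWithinAt) (fun t ht => ?_)
  · simpa using h1
  · have h0 : (0 : ℝ) < 1 + ‖v‖ := by positivity
    rw [Real.rpow_add h0, Real.rpow_one, mul_assoc, Finset.sum_mul]
    refine (norm_sum_le _ _).trans (Finset.sum_le_sum fun k _ => ?_)
    rw [norm_mul, Complex.norm_real]
    have h2 : ‖v k‖ ≤ 1 + ‖v‖ := (PiLp.norm_apply_le v k).trans (by linarith)
    have h3 : ‖dirDeriv (dir (Sum.inr k)) s (p.1, p.2 + t • v)‖ ≤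
        C k * (2 ^ |m - 1| * (bracket p.2 ^ (m - 1) * (1 + ‖v‖) ^ |m - 1|)) :=
      (hb k _).trans (mul_le_mul_of_nonneg_left
        (bracket_segment_le (m - 1) p.2 v (Ico_subset_Icc_self ht)) (hC k))
    calc ‖v k‖ * ‖dirDeriv (dir (Sum.inr k)) s (p.1, p.2 + t • v)‖
        ≤ (1 + ‖v‖) * (C k * (2 ^ |m - 1| * (bracket p.2 ^ (m - 1) * (1 + ‖v‖) ^ |m - 1|))) :=
          mul_le_mul h2 h3 (norm_nonneg _) h0.le
      _ = _ := by ring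

/-- Along the segment, the derivative of the first-order Taylor remainder consists of increments of
`∂_ξ s`. The first-order estimate therefore applies with `m - 1` in place of `m`. -/
theorem IsPreSymbol.norm_remainder_le {m : ℝ} {s : Phase d → ℂ} (hs : IsPreSymbol m s) :
    ∃ C, 0 ≤ C ∧ ∀ (p : Phase d) (v : Cfg d),
      ‖s (p.1, p.2 + v) - s p - ∑ k, (v k : ℂ) * MagneticFIO.pderiv (Sum.inr k) s p‖ ≤
      C * (bracket p.2 ^ (m - 2) * (1 + ‖v‖) ^ (2 + |m - 2|)) := by
  choose C hC hb using fun k : Fin d => (hs.pderiv (Sum.inr k)).pre.norm_sub_le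
  refine ⟨∑ k, C k, Finset.sum_nonneg fun k _ => hC k, fun p v => ?_⟩
  set S : ℂ := ∑ k, (v k : ℂ) * MagneticFIO.pderiv (Sum.inr k) s p with hS
  have hder : ∀ t : ℝ, HasDerivAt (fun t : ℝ => s (p.1, p.2 + t • v) - t • S)
      ((∑ k, (v k : ℂ) * MagneticFIO.pderiv (Sum.inr k) s (p.1, p.2 + t • v)) - S) t := by
    intro t
    have h2 : HasDerivAt (fun t : ℝ => t • S) S t := by
      simpa using (hasDerivAt_id t).smul_const S
    exact (hasDerivAt_segment hs.smooth p v t).sub h2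
  have h1 := norm_image_sub_le_of_norm_deriv_le_segment_01'
    (C := (∑ k, C k) * (bracket p.2 ^ (m - 2) * (1 + ‖v‖) ^ (2 + |m - 2|)))
    (fun t _ => (hder t).hasDerivWithinAt) (fun t ht => ?_)
  · simp only [one_smul, zero_smul, add_zero, sub_zero, Prod.mk.eta] at h1
    rwa [sub_right_comm]
  · have h0 : (0 : ℝ) < 1 + ‖v‖ := by positivity
    rw [hS, ← Finset.sum_sub_distrib, Finset.sum_mul]
    refine (norm_sum_le _ _).trans (Finset.sum_le_sum fun k _ => ?_)
    rw [← mul_sub, norm_mul, Complex.norm_real]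
    have h2 : ‖v k‖ ≤ 1 + ‖v‖ := (PiLp.norm_apply_le v k).trans (by linarith)
    have h4 : ‖t • v‖ ≤ ‖v‖ := by
      rw [norm_smul, Real.norm_of_nonneg ht.1]
      exact mul_le_of_le_one_left (norm_nonneg _) ht.2.le
    have h5 := Real.rpow_nonneg (bracket_pos p.2).le (m - 2)
    have h3 : ‖dirDeriv (dir (Sum.inr k)) s (p.1, p.2 + t • v) -
        MagneticFIO.pderiv (Sum.inr k) s p‖ ≤
        C k * (bracket p.2 ^ (m - 2) * (1 + ‖v‖) ^ (1 + |m - 2|)) := by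
      have h6 := hb k p (t • v)
      rw [show m - ord (Sum.inr k : Fin d ⊕ Fin d) - 1 = m - 2 by simp [ord]; ring] at h6
      refine h6.trans (mul_le_mul_of_nonneg_left ?_ (hC k))
      gcongr
    calc _ ≤ (1 + ‖v‖) * (C k * (bracket p.2 ^ (m - 2) * (1 + ‖v‖) ^ (1 + |m - 2|))) :=
          mul_le_mul h2 h3 (norm_nonneg _) h0.le
      _ = C k * (bracket p.2 ^ (m - 2) * ((1 + ‖v‖) ^ (1 : ℝ) * (1 + ‖v‖) ^ (1 + |m - 2|))) := by
          rw [Real.rpow_one]; ring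
      _ = _ := by rw [← Real.rpow_add h0]; ring_nf

end Shift

end

section

variable {d : ℕ}

/-! ### Increments and Taylor remainders as amplitudes. -/

section Increment

variable {n : ℕ} {μ a b m : ℝ} {s : Phase d → ℂ} {X h : Big d →L[ℝ] Cfg d}

theorem dirDeriv_sub {E : Type*} [NormedAddCommGroup E] [NormedSpace ℝ E] {f g : E → ℂ}
    (hf : ContDiff ℝ ∞ f) (hg : ContDiff ℝ ∞ g) (v : E) :
    dirDeriv v (fun p => f p - g p) = fun p => dirDeriv v f p - dirDeriv v g p := by
  funext p
  simp [dirDeriv, fderiv_fun_sub (hf.diff_at p) (hg.diff_at p)]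

/-- The increment of `s` under a substitution. -/
def incr (X h : Big d →L[ℝ] Cfg d) (s : Phase d → ℂ) (q : Big d) : ℂ :=
  pull X h s q - pull X 0 s q

/-- The first order part of the increment of `s` under a substitution. -/
def linIncr (X h : Big d →L[ℝ] Cfg d) (s : Phase d → ℂ) (q : Big d) : ℂ :=
  ∑ k, (h q k : ℂ) * pull X 0 (pderiv (Sum.inr k) s) q

theorem contDiff_incr (hs : ContDiff ℝ ∞ s) : ContDiff ℝ ∞ (incr X h s) :=
  (contDiff_pull hs).sub (contDiff_pull hs)

theorem contDiff_clm_apply (ℓ : Big d →L[ℝ] Cfg d) (k : Fin d) :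
    ContDiff ℝ ∞ (fun q => (ℓ q k : ℂ)) :=
  (Complex.ofRealCLM ∘L EuclideanSpace.proj k ∘L ℓ).contDiff

theorem dirDeriv_clm_apply (ℓ : Big d →L[ℝ] Cfg d) (k : Fin d) (v : Big d) :
    dirDeriv v (fun q => (ℓ q k : ℂ)) = fun _ => (ℓ v k : ℂ) := by
  funext q
  have : (fun q => (ℓ q k : ℂ)) = (Complex.ofRealCLM ∘L EuclideanSpace.proj k ∘L ℓ) := rfl
  rw [dirDeriv, this, ContinuousLinearMap.fderiv]
  rfl

theorem contDiff_linIncr (hs : ContDiff ℝ ∞ s) : ContDiff ℝ ∞ (linIncr X h s) :=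
  ContDiff.sum fun k _ => (contDiff_clm_apply h k).mul (contDiff_pull (contDiff_pderiv hs _))

/-- Directions that move `X` or `ξ` yield increments of derivatives. Directions that move `h` act on
the shifted term alone, hence the last sum contains no difference. -/
theorem dirDeriv_incr (hs : ContDiff ℝ ∞ s) (v : Big d) :
    dirDeriv v (incr X h s) = fun q => ∑ l, (X v l : ℂ) * incr X h (pderiv (Sum.inl l) s) q +
      ∑ l, (v.1.2 l : ℂ) * incr X h (pderiv (Sum.inr l) s) q +
      ∑ l, (h v l : ℂ) * pull X h (pderiv (Sum.inr l) s) q := by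
  funext q
  change dirDeriv v (fun q => pull X h s q - pull X 0 s q) q = _
  rw [dirDeriv_sub (contDiff_pull hs) (contDiff_pull hs), dirDeriv_pull hs, dirDeriv_pull hs]
  simp only [incr, mul_sub, Finset.sum_sub_distrib, zero_apply, add_zero,
    PiLp.add_apply, Complex.ofReal_add, add_mul, Finset.sum_add_distrib]
  ring

theorem pderiv_comm (hs : ContDiff ℝ ∞ s) (i j : Fin d ⊕ Fin d) :
    pderiv i (pderiv j s) = pderiv j (pderiv i s) :=
  dirDeriv_comm hs (dir i) (dir j)

theorem dirDeriv_linIncr (hs : ContDiff ℝ ∞ s) (v : Big d) :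
    dirDeriv v (linIncr X h s) = fun q =>
      ∑ l, (X v l : ℂ) * linIncr X h (pderiv (Sum.inl l) s) q +
      ∑ l, (v.1.2 l : ℂ) * linIncr X h (pderiv (Sum.inr l) s) q +
      ∑ l, (h v l : ℂ) * pull X 0 (pderiv (Sum.inr l) s) q := by
  funext q
  have h1 : ∀ k : Fin d, ContDiff ℝ ∞ (pderiv (Sum.inr k) s) := fun k => contDiff_pderiv hs _
  change dirDeriv v (fun q => ∑ k, (h q k : ℂ) * pull X 0 (pderiv (Sum.inr k) s) q) q = _
  rw [dirDeriv_sum _ fun k _ => (contDiff_clm_apply h k).mul (contDiff_pull (h1 k))]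
  simp only [dirDeriv_mul (contDiff_clm_apply h _) (contDiff_pull (h1 _)), dirDeriv_clm_apply,
    dirDeriv_pull (h1 _), Finset.sum_add_distrib, mul_add, linIncr, Finset.mul_sum,
    zero_apply, add_zero]
  rw [add_comm]
  congr 2
  · rw [Finset.sum_comm]
    refine Finset.sum_congr rfl fun l _ => Finset.sum_congr rfl fun k _ => ?_
    rw [pderiv_comm hs]
    ring
  · rw [Finset.sum_comm]
    refine Finset.sum_congr rfl fun l _ => Finset.sum_congr rfl fun k _ => ?_
    rw [pderiv_comm hs]
    ring

/-- The second order remainder of the increment of `s` under a substitution. -/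
def remIncr (X h : Big d →L[ℝ] Cfg d) (s : Phase d → ℂ) (q : Big d) : ℂ :=
  incr X h s q - linIncr X h s q

/-- In the directions of `h` the second-order remainder differentiates to a first-order increment of
`∂_ξ s`, because the linear part subtracts the unshifted value. -/
theorem dirDeriv_remIncr (hs : ContDiff ℝ ∞ s) (v : Big d) :
    dirDeriv v (remIncr X h s) = fun q =>
      ∑ l, (X v l : ℂ) * remIncr X h (pderiv (Sum.inl l) s) q +
      ∑ l, (v.1.2 l : ℂ) * remIncr X h (pderiv (Sum.inr l) s) q +
      ∑ l, (h v l : ℂ) * incr X h (pderiv (Sum.inr l) s) q := by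
  funext q
  change dirDeriv v (fun q => incr X h s q - linIncr X h s q) q = _
  rw [dirDeriv_sub (contDiff_incr hs) (contDiff_linIncr hs), dirDeriv_incr hs, dirDeriv_linIncr hs]
  simp only [remIncr, mul_sub, Finset.sum_sub_distrib]
  simp only [incr, mul_sub, Finset.sum_sub_distrib]
  ring

theorem wt_shift_le (H : IsShift X h) {r : ℝ} (hr : 0 ≤ r) (q : Big d) :
    bracket q.1.2 ^ m * (1 + ‖h q‖) ^ r ≤ wt m 0 r q := by
  have h1 := Real.rpow_nonneg (bracket_pos q.1.2).le m
  have h2 := H.norm_le q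
  rw [wt, Real.rpow_zero, mul_one]
  gcongr

theorem bigDir_x_snd (j : Fin d) : (bigDir (Sum.inl (Sum.inl j)) : Big d).1.2 = 0 := rfl

theorem bigDir_xi_snd (j : Fin d) :
    (bigDir (Sum.inl (Sum.inr j)) : Big d).1.2 = EuclideanSpace.single j 1 := rfl

theorem bigDir_rest_snd (i : (Fin d ⊕ Fin d) ⊕ (Fin d ⊕ Fin d)) :
    (bigDir (Sum.inr i) : Big d).1.2 = 0 := by
  rcases i with i | i <;> rfl

theorem abs_sub_sub_one_le (m r : ℝ) : |m - r - 1| ≤ |m - r| + 1 := abs_sub_one_le _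

/-- Parameter and `Y`-derivatives reproduce increments of the same kind, so induction covers them.
`H`-derivatives give the substituted symbol `∂_ξ s`, already of order `m - 1`. -/
theorem IsPreSymbol.amp_incr (H : IsShift X h) (hs : IsPreSymbol m s) :
    Amp₁ (m - 1) 0 (1 + |m - 1|) (incr X h s) := by
  intro n
  change AmpN n (m - 1) 0 (1 + |m - 1|) _
  induction n using Nat.strong_induction_on generalizing m s with
  | _ n ih =>
    obtain ⟨C, hC, hb⟩ := hs.norm_sub_le
    refine AmpN.intro (C := C) (contDiff_incr hs.smooth) hC (fun q => ?_) fun k i hk => ?_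
    · have h1 := hb (X q, q.1.2) (h q)
      simp only [incr, pull, zero_apply, add_zero]
      exact h1.trans (mul_le_mul_of_nonneg_left (wt_shift_le H (by positivity) q) hC)
    · have ihk : ∀ {m : ℝ} {s : Phase d → ℂ}, IsPreSymbol m s →
          AmpN k (m - 1) 0 (1 + |m - 1|) (incr X h s) := fun hs => ih k (by omega) hs
      have hx : ∀ l, AmpN k (m - 1) 0 (1 + |m - 1|) (incr X h (MagneticFIO.pderiv (Sum.inl l) s)) :=
        fun l => by simpa [ord] using ihk (hs.pderiv (Sum.inl l)).pre
      rw [dirDeriv_incr hs.smooth]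
      rcases i with (j | j) | (i | i)
      · simp only [H.h_p, bigDir_x_snd, PiLp.zero_apply, Complex.ofReal_zero, zero_mul,
          Finset.sum_const_zero, add_zero]
        refine AmpN.sum _ fun l _ => (AmpN.const_mul _ (hx l)).weaken ?_ ?_ ?_
        all_goals simp [expo, ord]
      · simp only [H.h_p, H.X_xi, bigDir_xi_snd, PiLp.zero_apply, Complex.ofReal_zero, zero_mul,
          Finset.sum_const_zero, add_zero, zero_add]
        refine AmpN.sum _ fun l _ =>
          (AmpN.const_mul _ (ihk (hs.pderiv (Sum.inr l)).pre)).weaken ?_ ?_ ?_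
        · simp [expo, ord]
        · simp [expo]
        · simp only [expo, ord, Sum.elim_inr]
          linarith [abs_sub_sub_one_le m 1]
      · simp only [H.h_Y, bigDir_rest_snd, PiLp.zero_apply, Complex.ofReal_zero, zero_mul,
          Finset.sum_const_zero, add_zero]
        refine AmpN.sum _ fun l _ => (AmpN.const_mul _ (hx l)).weaken ?_ ?_ ?_
        all_goals simp [expo]
      · simp only [H.X_H, bigDir_rest_snd, PiLp.zero_apply, Complex.ofReal_zero, zero_mul,
          Finset.sum_const_zero, zero_add]
        refine AmpN.sum _ fun l _ =>
          (AmpN.const_mul _ ((hs.pderiv (Sum.inr l)).amp_pull H k)).weaken ?_ ?_ ?_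
        all_goals simp [expo, ord]

/-- The same induction one Taylor order higher; `H`-derivatives now reduce to `amp_incr` for `∂_ξ
s`. -/
theorem IsPreSymbol.amp_remIncr (H : IsShift X h) (hs : IsPreSymbol m s) :
    Amp₁ (m - 2) 0 (2 + |m - 2|) (remIncr X h s) := by
  intro n
  change AmpN n (m - 2) 0 (2 + |m - 2|) _
  induction n using Nat.strong_induction_on generalizing m s with
  | _ n ih =>
    obtain ⟨C, hC, hb⟩ := hs.norm_remainder_le
    refine AmpN.intro (C := C) ((contDiff_incr hs.smooth).sub (contDiff_linIncr hs.smooth)) hC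
      (fun q => ?_) fun k i hk => ?_
    · have h1 := hb (X q, q.1.2) (h q)
      simp only [remIncr, incr, linIncr, pull, zero_apply, add_zero]
      exact h1.trans (mul_le_mul_of_nonneg_left (wt_shift_le H (by positivity) q) hC)
    · have ihk : ∀ {m : ℝ} {s : Phase d → ℂ}, IsPreSymbol m s →
          AmpN k (m - 2) 0 (2 + |m - 2|) (remIncr X h s) := fun hs => ih k (by omega) hs
      have hx : ∀ l, AmpN k (m - 2) 0 (2 + |m - 2|)
          (remIncr X h (MagneticFIO.pderiv (Sum.inl l) s)) :=
        fun l => by simpa [ord] using ihk (hs.pderiv (Sum.inl l)).pre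
      rw [dirDeriv_remIncr hs.smooth]
      rcases i with (j | j) | (i | i)
      · simp only [H.h_p, bigDir_x_snd, PiLp.zero_apply, Complex.ofReal_zero, zero_mul,
          Finset.sum_const_zero, add_zero]
        refine AmpN.sum _ fun l _ => (AmpN.const_mul _ (hx l)).weaken ?_ ?_ ?_
        all_goals simp [expo, ord]
      · simp only [H.h_p, H.X_xi, bigDir_xi_snd, PiLp.zero_apply, Complex.ofReal_zero, zero_mul,
          Finset.sum_const_zero, add_zero, zero_add]
        refine AmpN.sum _ fun l _ =>
          (AmpN.const_mul _ (ihk (hs.pderiv (Sum.inr l)).pre)).weaken ?_ ?_ ?_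
        · simp only [expo, ord, Sum.elim_inr]
          linarith
        · simp [expo]
        · simp only [expo, ord, Sum.elim_inr]
          have := abs_sub_sub_one_le m 2
          rw [sub_right_comm] at this
          linarith
      · simp only [H.h_Y, bigDir_rest_snd, PiLp.zero_apply, Complex.ofReal_zero, zero_mul,
          Finset.sum_const_zero, add_zero]
        refine AmpN.sum _ fun l _ => (AmpN.const_mul _ (hx l)).weaken ?_ ?_ ?_
        all_goals simp [expo]
      · simp only [H.X_H, bigDir_rest_snd, PiLp.zero_apply, Complex.ofReal_zero, zero_mul,
          Finset.sum_const_zero, zero_add]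
        refine AmpN.sum _ fun l _ =>
          (AmpN.const_mul _ ((hs.pderiv (Sum.inr l)).pre.amp_incr H k)).weaken ?_ ?_ ?_
        · simp only [expo, ord, Sum.elim_inr]
          linarith
        · simp [expo]
        · simp only [expo, ord, Sum.elim_inr]
          rw [show m - 1 - 1 = m - 2 by ring]
          linarith

theorem IsShift.amp_apply (H : IsShift X h) (k : Fin d) : Amp₁ 0 0 1 (fun q => (h q k : ℂ)) := by
  refine Amp.linear (Complex.ofRealCLM ∘L EuclideanSpace.proj k ∘L h) le_rfl le_rfl zero_le_one
    zero_le_one (fun q => ?_) fun j => ?_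
  · simp only [ContinuousLinearMap.comp_apply, Complex.ofRealCLM_apply, Complex.norm_real]
    refine (PiLp.norm_apply_le (h q) k).trans ?_
    simp only [wt, Real.rpow_zero, Real.rpow_one, one_mul]
    linarith [H.norm_le q]
  · simp [H.h_p]

theorem IsPreSymbol.amp_linIncr (H : IsShift X h) (hs : IsPreSymbol m s) :
    Amp₁ (m - 1) 0 (1 + |m - 1|) (linIncr X h s) :=
  Amp.sum _ fun k _ => ((H.amp_apply k).mul ((hs.pderiv (Sum.inr k)).amp_pull H.zero)).weaken
    (by simp [ord]) (by simp) (by simp [ord])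

/-- Derivatives of increments of functions of order one without dependence on the shifted
position are those of an admissible phase. -/
theorem IsPreSymbol.amp_deriv_incr (H : IsShift X h) (hY : ∀ i, X (bigDir (Sum.inr (Sum.inl i))) = 0)
    (hs : IsPreSymbol 1 s) (i : BigIdx d) :
    Amp₁ (expo i).1 (expo i).2.1 (expo i).2.2 (dirDeriv (bigDir i) (incr X h s)) := by
  rw [Amp₁, dirDeriv_incr hs.smooth]
  rcases i with (j | j) | (i | i)
  · simp only [H.h_p, bigDir_x_snd, PiLp.zero_apply, Complex.ofReal_zero, zero_mul,
      Finset.sum_const_zero, add_zero]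
    refine Amp.sum _ fun l _ =>
      (Amp.const_mul _ ((hs.pderiv (Sum.inl l)).pre.amp_incr H)).weaken ?_ ?_ ?_
    all_goals simp [expo, ord]
  · simp only [H.h_p, H.X_xi, bigDir_xi_snd, PiLp.zero_apply, Complex.ofReal_zero, zero_mul,
      Finset.sum_const_zero, add_zero, zero_add]
    refine Amp.sum _ fun l _ =>
      (Amp.const_mul _ ((hs.pderiv (Sum.inr l)).pre.amp_incr H)).weaken ?_ ?_ ?_
    · simp [expo, ord]
    · simp [expo]
    -- Here `∂_ξ s` has order zero, so its increment has growth `1 + |0 - 1| = 2` in `H`: exactly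
    -- the exponent of `1+|H|` allowed to a parameter derivative.
    · norm_num [expo, ord]
  · simp only [H.h_Y, hY, bigDir_rest_snd, PiLp.zero_apply, Complex.ofReal_zero, zero_mul,
      Finset.sum_const_zero, add_zero]
    exact Amp.zero
  · simp only [H.X_H, bigDir_rest_snd, PiLp.zero_apply, Complex.ofReal_zero, zero_mul,
      Finset.sum_const_zero, zero_add]
    refine Amp.sum _ fun l _ =>
      (Amp.const_mul _ ((hs.pderiv (Sum.inr l)).amp_pull H)).weaken ?_ ?_ ?_
    all_goals simp [expo, ord]

theorem IsPreSymbol.amp_deriv_linIncr (H : IsShift X h)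
    (hY : ∀ i, X (bigDir (Sum.inr (Sum.inl i))) = 0) (hs : IsPreSymbol 1 s) (i : BigIdx d) :
    Amp₁ (expo i).1 (expo i).2.1 (expo i).2.2 (dirDeriv (bigDir i) (linIncr X h s)) := by
  rw [Amp₁, dirDeriv_linIncr hs.smooth]
  rcases i with (j | j) | (i | i)
  · simp only [H.h_p, bigDir_x_snd, PiLp.zero_apply, Complex.ofReal_zero, zero_mul,
      Finset.sum_const_zero, add_zero]
    refine Amp.sum _ fun l _ =>
      (Amp.const_mul _ ((hs.pderiv (Sum.inl l)).pre.amp_linIncr H)).weaken ?_ ?_ ?_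
    all_goals simp [expo, ord]
  · simp only [H.h_p, H.X_xi, bigDir_xi_snd, PiLp.zero_apply, Complex.ofReal_zero, zero_mul,
      Finset.sum_const_zero, add_zero, zero_add]
    refine Amp.sum _ fun l _ =>
      (Amp.const_mul _ ((hs.pderiv (Sum.inr l)).pre.amp_linIncr H)).weaken ?_ ?_ ?_
    · simp [expo, ord]
    · simp [expo]
    · norm_num [expo, ord]
  · simp only [H.h_Y, hY, bigDir_rest_snd, PiLp.zero_apply, Complex.ofReal_zero, zero_mul,
      Finset.sum_const_zero, add_zero]
    exact Amp.zero
  · simp only [H.X_H, bigDir_rest_snd, PiLp.zero_apply, Complex.ofReal_zero, zero_mul,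
      Finset.sum_const_zero, zero_add]
    refine Amp.sum _ fun l _ =>
      (Amp.const_mul _ ((hs.pderiv (Sum.inr l)).amp_pull H.zero)).weaken ?_ ?_ ?_
    all_goals simp [expo, ord]

/-- If `R` is real and `e^{iR}` is an amplitude of order zero, then `e^{iR} - 1` satisfies the
estimates of `R`. -/
theorem Amp.cexp_sub_one {R : Big d → ℝ} (hR : Amp₁ μ a b (fun q => (R q : ℂ)))
    (he : Amp₁ 0 0 0 (fun q => Complex.exp (Complex.I * (R q : ℂ)))) :
    Amp₁ μ a b (fun q => Complex.exp (Complex.I * (R q : ℂ)) - 1) := by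
  obtain ⟨C, hC, hb⟩ := hR.bound
  have hsm : ContDiff ℝ ∞ (fun q => (R q : ℂ)) := hR.smooth ()
  refine Amp.of_deriv (fun _ => (he.smooth ()).sub contDiff_const) hC (fun _ q => ?_) fun i => ?_
  -- This uses `|e^{iR} - 1| ≤ |R|` for real `R`.
  · refine le_trans ?_ (hb () q)
    rw [Complex.norm_real, mul_comm Complex.I]
    simpa [mul_comm] using Real.norm_exp_I_mul_ofReal_sub_one_le (x := R q)
  · have : (fun _ : Unit => dirDeriv (bigDir i) fun q => Complex.exp (Complex.I * (R q : ℂ)) - 1) =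
        fun _ q => (Complex.I * dirDeriv (bigDir i) (fun q => (R q : ℂ)) q) *
          Complex.exp (Complex.I * (R q : ℂ)) := by
      funext _
      rw [dirDeriv_sub (he.smooth ()) contDiff_const, dirDeriv_const,
        dirDeriv_cexp (contDiff_const.mul hsm), dirDeriv_const_mul hsm]
      simp
    rw [this]
    exact ((Amp.const_mul Complex.I (hR.deriv i)).mul he).weaken (by simp) (by simp) (by simp)

end Increment

end

section

variable {d : ℕ}

/-! ### The amplitude of the composition and its leading part. -/

section Amplitudes

theorem Amp.congr_fun {μ a b : ℝ} {f h : Big d → ℂ} (hf : Amp₁ μ a b f) (hfh : ∀ q, f q = h q) :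
    Amp₁ μ a b h := by
  rwa [← funext hfh]

/-- The position `x`. -/
def posX : Big d →L[ℝ] Cfg d :=
  ContinuousLinearMap.fst ℝ (Cfg d) (Cfg d) ∘L
    ContinuousLinearMap.fst ℝ (Phase d) (Phase d × Phase d)

/-- The shifted position `x + y`. -/
def posXY : Big d →L[ℝ] Cfg d :=
  posX + ContinuousLinearMap.fst ℝ (Cfg d) (Cfg d) ∘L
    ContinuousLinearMap.fst ℝ (Phase d) (Phase d) ∘L
    ContinuousLinearMap.snd ℝ (Phase d) (Phase d × Phase d)

/-- The momentum shift `η`. -/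
def momEta : Big d →L[ℝ] Cfg d :=
  ContinuousLinearMap.fst ℝ (Cfg d) (Cfg d) ∘L
    ContinuousLinearMap.snd ℝ (Phase d) (Phase d) ∘L
    ContinuousLinearMap.snd ℝ (Phase d) (Phase d × Phase d)

/-- The momentum shift `ζ`. -/
def momZeta : Big d →L[ℝ] Cfg d :=
  ContinuousLinearMap.snd ℝ (Cfg d) (Cfg d) ∘L
    ContinuousLinearMap.snd ℝ (Phase d) (Phase d) ∘L
    ContinuousLinearMap.snd ℝ (Phase d) (Phase d × Phase d)

theorem posX_apply (q : Big d) : posX q = q.1.1 := rfl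
theorem posXY_apply (q : Big d) : posXY q = q.1.1 + q.2.1.1 := rfl
theorem momEta_apply (q : Big d) : momEta q = q.2.2.1 := rfl
theorem momZeta_apply (q : Big d) : momZeta q = q.2.2.2 := rfl

theorem isShift_eta : IsShift (posX : Big d →L[ℝ] Cfg d) momEta where
  norm_le q := norm_fst_le q.2.2
  h_p _ := rfl
  h_Y _ := rfl
  X_xi _ := rfl
  X_H _ := rfl

theorem isShift_zeta : IsShift (posXY : Big d →L[ℝ] Cfg d) momZeta where
  norm_le q := norm_snd_le q.2.2
  h_p _ := rfl
  h_Y _ := rfl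
  X_xi _ := by simp [posXY_apply, bigDir, dir]
  X_H _ := by simp [posXY_apply, bigDir]

theorem posX_Y (i : Fin d ⊕ Fin d) :
    (posX : Big d →L[ℝ] Cfg d) (bigDir (Sum.inr (Sum.inl i))) = 0 := rfl

variable {f : Phase d → ℝ}

/-- `𝖽` need not itself be a symbol, which is why increments are estimated under the weaker
assumption on derivatives alone. -/
theorem IsSPlus.isPreSymbol (hf : IsSPlus f) : IsPreSymbol 1 (fun p => (f p : ℂ)) where
  smooth := Complex.ofRealCLM.contDiff.comp hf.smooth
  pderiv i := by
    rw [pderiv_ofReal hf.smooth]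
    rcases i with j | j
    · simpa [ord] using (hf.deriv_x j).ofReal
    · simpa [ord] using (hf.deriv_xi j).ofReal

/-- The phase difference `f(x, ξ + η) - f(x, ξ)`. -/
def phaseDiff (f : Phase d → ℝ) (q : Big d) : ℝ := f (q.1.1, q.1.2 + q.2.2.1) - f q.1

/-- The linearized phase difference `⟨η, ∇_ξ f(x, ξ)⟩`. -/
def phaseLin (f : Phase d → ℝ) (q : Big d) : ℝ :=
  ∑ k, q.2.2.1 k * pderiv (Sum.inr k) f q.1

theorem ofReal_phaseDiff :
    (fun q => (phaseDiff f q : ℂ)) = incr posX momEta (fun p => (f p : ℂ)) := by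
  funext q
  simp [phaseDiff, incr, pull, posX_apply, momEta_apply]

theorem ofReal_phaseLin (hf : ContDiff ℝ ∞ f) :
    (fun q => (phaseLin f q : ℂ)) = linIncr posX momEta (fun p => (f p : ℂ)) := by
  funext q
  simp [phaseLin, linIncr, pull, posX_apply, momEta_apply, pderiv_ofReal hf]

theorem contDiff_phaseDiff (hf : ContDiff ℝ ∞ f) : ContDiff ℝ ∞ (phaseDiff f) := by
  unfold phaseDiff
  fun_prop

theorem contDiff_phaseLin (hf : ContDiff ℝ ∞ f) : ContDiff ℝ ∞ (phaseLin f) := by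
  have h := fun k : Fin d => contDiff_pderiv hf (Sum.inr k)
  unfold phaseLin
  fun_prop

theorem IsSPlus.amp_cexp_phaseDiff (hf : IsSPlus f) :
    Amp₁ 0 0 0 (fun q => Complex.exp (Complex.I * (phaseDiff f q : ℂ))) := by
  refine Amp.cexp_I (ψ := fun _ : Unit => phaseDiff f) (fun _ => contDiff_phaseDiff hf.smooth)
    fun i => ?_
  rw [ofReal_phaseDiff]
  exact hf.isPreSymbol.amp_deriv_incr isShift_eta posX_Y i

theorem IsSPlus.amp_cexp_phaseLin (hf : IsSPlus f) :
    Amp₁ 0 0 0 (fun q => Complex.exp (Complex.I * (phaseLin f q : ℂ))) := by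
  refine Amp.cexp_I (ψ := fun _ : Unit => phaseLin f) (fun _ => contDiff_phaseLin hf.smooth)
    fun i => ?_
  rw [ofReal_phaseLin hf.smooth]
  exact hf.isPreSymbol.amp_deriv_linIncr isShift_eta posX_Y i

/-- Factor out the linearized exponential: the difference is `e^{i·lin}(e^{iR} - 1)`, with `R` the
second-order Taylor remainder of a function of order one, hence of order `-1` and growth `2 + |1 -
2| = 3` in `H`. -/
theorem IsSPlus.amp_cexp_sub (hf : IsSPlus f) :
    Amp₁ (-1) 0 3 (fun q => Complex.exp (Complex.I * (phaseDiff f q : ℂ)) -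
      Complex.exp (Complex.I * (phaseLin f q : ℂ))) := by
  have hs := hf.isPreSymbol
  have hR : Amp₁ (-1) 0 3 (fun q => ((phaseDiff f q - phaseLin f q : ℝ) : ℂ)) := by
    have h1 := (hs.amp_remIncr isShift_eta).weaken (μ' := -1) (a' := 0) (b' := 3)
      (by norm_num) le_rfl (by norm_num)
    have h2 : remIncr posX momEta (fun p => (f p : ℂ)) =
        fun q => ((phaseDiff f q - phaseLin f q : ℝ) : ℂ) := by
      funext q
      rw [remIncr, ← ofReal_phaseDiff, ← ofReal_phaseLin hf.smooth]
      push_cast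
      ring
    rwa [h2] at h1
  have he : Amp₁ 0 0 0
      (fun q => Complex.exp (Complex.I * ((phaseDiff f q - phaseLin f q : ℝ) : ℂ))) := by
    refine Amp.cexp_I (ψ := fun _ : Unit => fun q => phaseDiff f q - phaseLin f q)
      (fun _ => (contDiff_phaseDiff hf.smooth).sub (contDiff_phaseLin hf.smooth)) fun i => ?_
    have h2 : (fun q => ((phaseDiff f q - phaseLin f q : ℝ) : ℂ)) = fun q =>
        incr posX momEta (fun p => (f p : ℂ)) q - linIncr posX momEta (fun p => (f p : ℂ)) q := by
      funext q
      rw [← ofReal_phaseDiff, ← ofReal_phaseLin hf.smooth]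
      push_cast
      ring
    rw [h2, dirDeriv_sub (contDiff_incr hs.smooth) (contDiff_linIncr hs.smooth)]
    exact (hs.amp_deriv_incr isShift_eta posX_Y i).sub (hs.amp_deriv_linIncr isShift_eta posX_Y i)
  have h3 := (hf.amp_cexp_phaseLin.mul (Amp.cexp_sub_one hR he)).weaken (μ' := -1) (a' := 0)
    (b' := 3) (by simp) (by simp) (by simp)
  refine h3.congr_fun fun q => ?_
  rw [mul_sub, ← Complex.exp_add]
  congr 2
  · push_cast
    ring
  · simp

variable {m' m'' : ℝ} {a b : Phase d → ℂ} {Ω : Big d → ℂ}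

/-- The amplitude of the composition. -/
def fullAmp (f : Phase d → ℝ) (a b : Phase d → ℂ) (Ω : Big d → ℂ) (q : Big d) : ℂ :=
  Complex.exp (Complex.I * (phaseDiff f q : ℂ)) * (a (q.1.1, q.1.2 + q.2.2.1) *
    (b (q.1.1 + q.2.1.1, q.1.2 + q.2.2.2) * Ω q))

/-- The leading part of the amplitude of the composition. -/
def modelAmp (f : Phase d → ℝ) (a b : Phase d → ℂ) (Ω : Big d → ℂ) (q : Big d) : ℂ :=
  Complex.exp (Complex.I * (phaseLin f q : ℂ)) * (a q.1 *
    (b (q.1.1 + q.2.1.1, q.1.2) * Ω q))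

theorem amp_fullAmp (hf : IsSPlus f) (ha : IsSymbol m'' a) (hb : IsSymbol m' b)
    (hΩ : Amp₁ 0 0 0 Ω) : Amp₁ (m' + m'') 0 (|m'| + |m''|) (fullAmp f a b Ω) :=
  (hf.amp_cexp_phaseDiff.mul ((ha.amp_pull isShift_eta).mul
    ((hb.amp_pull isShift_zeta).mul hΩ))).weaken (by linarith) (by simp) (by linarith)

theorem pull_posX_zero (s : Phase d → ℂ) : pull posX 0 s = fun q => s q.1 := by
  funext q
  simp [pull, posX_apply]

theorem pull_posXY_zero (s : Phase d → ℂ) :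
    pull posXY 0 s = fun q => s (q.1.1 + q.2.1.1, q.1.2) := by
  funext q
  simp [pull, posXY_apply]

theorem amp_modelAmp (hf : IsSPlus f) (ha : IsSymbol m'' a) (hb : IsSymbol m' b)
    (hΩ : Amp₁ 0 0 0 Ω) : Amp₁ (m' + m'') 0 (|m'| + |m''|) (modelAmp f a b Ω) := by
  have h1 := ha.amp_pull isShift_eta.zero
  have h2 := hb.amp_pull isShift_zeta.zero
  rw [pull_posX_zero] at h1
  rw [pull_posXY_zero] at h2
  exact (hf.amp_cexp_phaseLin.mul (h1.mul (h2.mul hΩ))).weaken (by linarith) (by simp)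
    (by linarith)

/-- Telescoping: the phase, then `a`, then `b` is replaced by its simplified form, and each
replacement gains one order in `ξ`. -/
theorem exists_amp_sub (hf : IsSPlus f) (ha : IsSymbol m'' a) (hb : IsSymbol m' b)
    (hΩ : Amp₁ 0 0 0 Ω) : ∃ r, Amp₁ (m' + m'' - 1) 0 r
      (fun q => fullAmp f a b Ω q - modelAmp f a b Ω q) := by
  have ha1 := ha.amp_pull isShift_eta
  have hb1 := hb.amp_pull isShift_zeta
  have ha0 := ha.amp_pull isShift_eta.zero
  have ha2 := ha.pre.amp_incr isShift_eta
  have hb2 := hb.pre.amp_incr isShift_zeta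
  have hE := hf.amp_cexp_sub
  have hE0 := hf.amp_cexp_phaseLin
  have h1 := hE.mul (ha1.mul (hb1.mul hΩ))
  have h2 := hE0.mul (ha2.mul (hb1.mul hΩ))
  have h3 := hE0.mul (ha0.mul (hb2.mul hΩ))
  -- The sum of the three growth exponents, as a common upper bound; its value is immaterial.
  let r := (3 + (|m''| + (|m'| + 0))) + (0 + (1 + |m'' - 1| + (|m'| + 0))) +
    (0 + (|m''| + (1 + |m' - 1| + 0)))
  have p1 := abs_nonneg m'
  have p2 := abs_nonneg m''
  have p3 := abs_nonneg (m' - 1)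
  have p4 := abs_nonneg (m'' - 1)
  refine ⟨r, (((h1.weaken (μ' := m' + m'' - 1) (a' := 0) (b' := r) ?_ ?_ ?_).add
    (h2.weaken ?_ ?_ ?_)).add (h3.weaken ?_ ?_ ?_)).congr_fun fun q => ?_⟩
  case refine_10 =>
    simp only [fullAmp, modelAmp, incr, pull, posX_apply, posXY_apply, momEta_apply, momZeta_apply,
      zero_apply, add_zero]
    ring
  all_goals linarith

end Amplitudes

end

section

set_option linter.unusedSectionVars false

/-! ### Parameter integrals of functions of temperate growth. -/

section Parametric

variable {T E : Type} [NormedAddCommGroup T] [NormedSpace ℝ T] [MeasurableSpace T] [BorelSpace T]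
  [SecondCountableTopology T] [NormedAddCommGroup E] [NormedSpace ℝ E]

/-- A smooth family of functions whose derivatives of every order are polynomially bounded,
uniformly for almost all parameters. -/
structure IsTemperateFamily {F : Type} [NormedAddCommGroup F] [NormedSpace ℝ F]
    (ν : Measure T) (G : T × E → F) : Prop where
  smooth : ContDiff ℝ ∞ G
  bound : ∀ n : ℕ, ∃ (k : ℕ) (C : ℝ), ∀ᵐ τ ∂ν, ∀ p,
    ‖iteratedFDeriv ℝ n (fun p => G (τ, p)) p‖ ≤ C * (1 + ‖p‖) ^ k

variable {ν : Measure T} [IsFiniteMeasure ν]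

theorem hasFDerivAt_slice {F : Type} [NormedAddCommGroup F] [NormedSpace ℝ F] {G : T × E → F}
    (hG : ContDiff ℝ ∞ G) (τ : T) (p : E) : HasFDerivAt (fun p => G (τ, p))
      ((fderiv ℝ G (τ, p)).comp (ContinuousLinearMap.inr ℝ T E)) p :=
  (hG.diff_at _).hasFDerivAt.comp p (hasFDerivAt_prodMk_right τ p)

theorem fderiv_slice {F : Type} [NormedAddCommGroup F] [NormedSpace ℝ F] {G : T × E → F}
    (hG : ContDiff ℝ ∞ G) (τ : T) : fderiv ℝ (fun p => G (τ, p)) =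
      fun p => (fderiv ℝ G (τ, p)).comp (ContinuousLinearMap.inr ℝ T E) :=
  funext fun p => (hasFDerivAt_slice hG τ p).fderiv

theorem IsTemperateFamily.fderiv {F : Type} [NormedAddCommGroup F] [NormedSpace ℝ F]
    {G : T × E → F} (hG : IsTemperateFamily ν G) : IsTemperateFamily ν
      (fun q => (fderiv ℝ G q).comp (ContinuousLinearMap.inr ℝ T E)) where
  smooth := (hG.smooth.fderiv_right (m := ∞) (by simp)).clm_comp contDiff_const
  bound n := by
    obtain ⟨k, C, h⟩ := hG.bound (n + 1)
    refine ⟨k, C, h.mono fun τ h p => ?_⟩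
    rw [← fderiv_slice hG.smooth τ, norm_iteratedFDeriv_fderiv]
    exact h p

theorem IsTemperateFamily.hasFDerivAt {F : Type} [NormedAddCommGroup F] [NormedSpace ℝ F]
    {G : T × E → F} (hG : IsTemperateFamily ν G) (p : E) : HasFDerivAt (fun p => ∫ τ, G (τ, p) ∂ν)
      (∫ τ, (_root_.fderiv ℝ G (τ, p)).comp (ContinuousLinearMap.inr ℝ T E) ∂ν) p := by
  obtain ⟨k, C, h1⟩ := hG.bound 1
  obtain ⟨k0, C0, h0⟩ := hG.bound 0
  have hcont : ∀ p, Continuous fun τ => G (τ, p) := fun p =>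
    hG.smooth.continuous.comp (by fun_prop)
  refine hasFDerivAt_integral_of_dominated_of_fderiv_le (Metric.ball_mem_nhds p one_pos)
    (bound := fun _ => max C 0 * (1 + (‖p‖ + 1)) ^ k)
    (Eventually.of_forall fun x => ((hcont x).aestronglyMeasurable)) ?_
    ((hG.fderiv.smooth.continuous.comp (by fun_prop : Continuous fun τ : T => (τ, p))).aestronglyMeasurable)
    ?_ (integrable_const _)
    (Eventually.of_forall fun τ x _ => hasFDerivAt_slice hG.smooth τ x)
  · refine Integrable.of_bound (hcont p).aestronglyMeasurable (C0 * (1 + ‖p‖) ^ k0) ?_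
    filter_upwards [h0] with τ h
    simpa using h p
  · filter_upwards [h1] with τ h x hx
    rw [← (hasFDerivAt_slice hG.smooth τ x).fderiv]
    have h2 := h x
    rw [← norm_iteratedFDeriv_fderiv, norm_iteratedFDeriv_zero] at h2
    have h3 : ‖x‖ ≤ ‖p‖ + 1 := by
      have h4 : ‖x - p‖ < 1 := by rwa [← dist_eq_norm]
      have h5 := norm_add_le p (x - p)
      rw [add_sub_cancel] at h5
      linarith
    calc _ ≤ C * (1 + ‖x‖) ^ k := h2
      _ ≤ max C 0 * (1 + ‖x‖) ^ k := by gcongr; exact le_max_left _ _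
      _ ≤ _ := by gcongr

/-- The derivative of the integral is the integral of the derivative family, with values in a space
of linear maps. The induction therefore ranges over the target space `F`. -/
theorem IsTemperateFamily.integral_aux (n : ℕ) {F : Type} [NormedAddCommGroup F] [NormedSpace ℝ F]
    {G : T × E → F} (hG : IsTemperateFamily ν G) : ContDiff ℝ n (fun p => ∫ τ, G (τ, p) ∂ν) ∧
      ∀ (k : ℕ) (C : ℝ), (∀ᵐ τ ∂ν, ∀ p, ‖iteratedFDeriv ℝ n (fun p => G (τ, p)) p‖ ≤
        C * (1 + ‖p‖) ^ k) → ∀ p, ‖iteratedFDeriv ℝ n (fun p => ∫ τ, G (τ, p) ∂ν) p‖ ≤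
          C * ν.real univ * (1 + ‖p‖) ^ k := by
  induction n generalizing F with
  | zero =>
    refine ⟨contDiff_zero.2 (continuous_iff_continuousAt.2 fun p => (hG.hasFDerivAt p).continuousAt),
      fun k C h p => ?_⟩
    have h2 : ‖∫ τ, G (τ, p) ∂ν‖ ≤ C * (1 + ‖p‖) ^ k * ν.real univ := by
      refine norm_integral_le_of_norm_le_const (h.mono fun τ h => ?_)
      have h3 := h p
      rwa [norm_iteratedFDeriv_zero] at h3
    rw [norm_iteratedFDeriv_zero]
    exact h2.trans_eq (by ring)
  | succ n ih =>
    have hd : _root_.fderiv ℝ (fun p => ∫ τ, G (τ, p) ∂ν) =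
        fun p => ∫ τ, (_root_.fderiv ℝ G (τ, p)).comp (ContinuousLinearMap.inr ℝ T E) ∂ν :=
      funext fun p => (hG.hasFDerivAt p).fderiv
    obtain ⟨h1, h2⟩ := ih hG.fderiv
    refine ⟨(contDiff_succ_iff_fderiv (n := (n : WithTop ℕ∞))).2
      ⟨fun p => (hG.hasFDerivAt p).differentiableAt, by simp, ?_⟩,
      fun k C h p => ?_⟩
    · rw [hd]
      exact h1
    · rw [← norm_iteratedFDeriv_fderiv, hd]
      refine h2 k C (h.mono fun τ h p => ?_) p
      rw [← fderiv_slice hG.smooth τ, norm_iteratedFDeriv_fderiv]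
      exact h p

theorem IsTemperateFamily.contDiff {F : Type} [NormedAddCommGroup F] [NormedSpace ℝ F]
    {G : T × E → F} (hG : IsTemperateFamily ν G) : ContDiff ℝ ∞ (fun p => ∫ τ, G (τ, p) ∂ν) :=
  contDiff_infty.2 fun n => (hG.integral_aux n).1

theorem IsTemperateFamily.hasTemperateGrowth {F : Type} [NormedAddCommGroup F] [NormedSpace ℝ F]
    {G : T × E → F} (hG : IsTemperateFamily ν G) :
    Function.HasTemperateGrowth (fun p => ∫ τ, G (τ, p) ∂ν) := by
  refine ⟨hG.contDiff, fun n => ?_⟩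
  obtain ⟨k, C, h⟩ := hG.bound n
  exact ⟨k, _, (hG.integral_aux n).2 k C h⟩

theorem norm_iteratedFDeriv_smul_comp_le {X F : Type} [NormedAddCommGroup X] [NormedSpace ℝ X]
    [NormedAddCommGroup F] [NormedSpace ℝ F] {f : X → F} (hf : ContDiff ℝ ∞ f) (κ : ℝ)
    (ℓ : E →L[ℝ] X) {c : ℝ} (hκ : ‖κ‖ ≤ 1) (hℓ : ‖ℓ‖ ≤ c) (n : ℕ) (p : E) :
    ‖iteratedFDeriv ℝ n (fun p => κ • f (ℓ p)) p‖ ≤ c ^ n * ‖iteratedFDeriv ℝ n f (ℓ p)‖ := by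
  have h1 : ContDiff ℝ n (f ∘ ℓ) := (hf.comp ℓ.contDiff).of_le (by exact_mod_cast le_top)
  have h2 : (fun p => κ • f (ℓ p)) = κ • (f ∘ ℓ) := rfl
  rw [h2, iteratedFDeriv_const_smul_apply h1.contDiffAt, norm_smul,
    ℓ.iteratedFDeriv_comp_right hf p (by exact_mod_cast le_top)]
  refine (mul_le_of_le_one_left (norm_nonneg _) hκ).trans ?_
  refine (ContinuousMultilinearMap.norm_compContinuousLinearMap_le _ _).trans ?_
  rw [Finset.prod_const, Finset.card_univ, Fintype.card_fin, mul_comm]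
  gcongr

/-- Families of linear substitutions in a function of temperate growth. -/
theorem isTemperateFamily_comp {X F : Type} [NormedAddCommGroup X] [NormedSpace ℝ X]
    [NormedAddCommGroup F] [NormedSpace ℝ F] {f : X → F} (hf : Function.HasTemperateGrowth f)
    {κ : T → ℝ} {ℓ : T → E →L[ℝ] X} (hκ : ContDiff ℝ ∞ κ)
    (hℓ : ContDiff ℝ ∞ (fun q : T × E => ℓ q.1 q.2)) {c : ℝ} (hb : ∀ᵐ τ ∂ν, ‖κ τ‖ ≤ 1 ∧ ‖ℓ τ‖ ≤ c)
    (hc : 1 ≤ c) :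
    IsTemperateFamily ν (fun q : T × E => κ q.1 • f (ℓ q.1 q.2)) where
  smooth := (hκ.comp contDiff_fst).smul (hf.1.comp hℓ)
  bound n := by
    obtain ⟨k, C, h⟩ := hf.2 n
    have hC : 0 ≤ C := by simpa using (norm_nonneg _).trans (h 0)
    refine ⟨k, c ^ n * (C * c ^ k), hb.mono fun τ hτ p => ?_⟩
    refine (norm_iteratedFDeriv_smul_comp_le hf.1 _ _ hτ.1 hτ.2 n p).trans ?_
    rw [mul_assoc]
    refine mul_le_mul_of_nonneg_left ((h _).trans ?_) (by positivity)
    rw [mul_assoc, ← mul_pow]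
    gcongr
    have := (ℓ τ).le_of_opNorm_le hτ.2 p
    nlinarith [norm_nonneg p]

theorem exists_norm_iteratedFDeriv_integral_le {X F : Type} [NormedAddCommGroup X]
    [NormedSpace ℝ X] [NormedAddCommGroup F] [NormedSpace ℝ F] {f : X → F} (hf : ContDiff ℝ ∞ f)
    (hfb : ∀ n : ℕ, ∃ C : ℝ, ∀ x, ‖iteratedFDeriv ℝ n f x‖ ≤ C)
    {κ : T → ℝ} {ℓ : T → E →L[ℝ] X} (hκ : ContDiff ℝ ∞ κ)
    (hℓ : ContDiff ℝ ∞ (fun q : T × E => ℓ q.1 q.2)) {c : ℝ} (hb : ∀ᵐ τ ∂ν, ‖κ τ‖ ≤ 1 ∧ ‖ℓ τ‖ ≤ c)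
    (hc : 1 ≤ c) :
    ContDiff ℝ ∞ (fun p => ∫ τ, κ τ • f (ℓ τ p) ∂ν) ∧ ∀ n : ℕ, ∃ C : ℝ, ∀ p,
      ‖iteratedFDeriv ℝ n (fun p => ∫ τ, κ τ • f (ℓ τ p) ∂ν) p‖ ≤ C := by
  have ht : Function.HasTemperateGrowth f := ⟨hf, fun n =>
    ⟨0, (hfb n).imp fun C h x => by rw [pow_zero, mul_one]; exact h x⟩⟩
  have hG := isTemperateFamily_comp ht hκ hℓ hb hc
  refine ⟨hG.contDiff, fun n => ?_⟩
  obtain ⟨C, h⟩ := hfb n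
  have h2 := (hG.integral_aux n).2 0 (c ^ n * C) (hb.mono fun τ hτ p => ?_)
  · simp only [pow_zero, mul_one] at h2
    exact ⟨_, h2⟩
  · rw [pow_zero, mul_one]
    refine (norm_iteratedFDeriv_smul_comp_le hf _ _ hτ.1 hτ.2 n p).trans ?_
    exact mul_le_mul_of_nonneg_left (h _) (by positivity)

end Parametric

end

section

variable {d : ℕ}

/-! ### Magnetic phase factors and Stokes' theorem for triangles. -/

section Magnetic

theorem contDiff_dirDeriv' {E F : Type*} [NormedAddCommGroup E] [NormedSpace ℝ E]
    [NormedAddCommGroup F] [NormedSpace ℝ F] {f : E → F} (hf : ContDiff ℝ ∞ f) (v : E) :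
    ContDiff ℝ ∞ (fun p => fderiv ℝ f p v) :=
  (hf.fderiv_right (m := ∞) (by simp)).clm_apply contDiff_const

theorem hasTemperateGrowth_cexp : Function.HasTemperateGrowth
    (fun r : ℝ => Complex.exp (Complex.I * (r : ℂ))) := by
  have h : ∀ r : ℝ, HasDerivAt (fun r : ℝ => Complex.exp (Complex.I * (r : ℂ)))
      (Complex.I * Complex.exp (Complex.I * (r : ℂ))) r := fun r => by
    have h1 : HasDerivAt (fun r : ℝ => Complex.I * (r : ℂ)) Complex.I r := by
      simpa using (Complex.ofRealCLM.hasDerivAt (x := r)).const_mul Complex.I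
    simpa [mul_comm] using h1.cexp
  have hd : ∀ n : ℕ, iteratedDeriv n (fun r : ℝ => Complex.exp (Complex.I * (r : ℂ))) =
      fun r : ℝ => Complex.I ^ n * Complex.exp (Complex.I * (r : ℂ)) := fun n => by
    induction n with
    | zero => simp
    | succ n ih =>
      rw [iteratedDeriv_succ, ih]
      funext r
      rw [((h r).const_mul (Complex.I ^ n)).deriv]
      ring
  refine ⟨Complex.contDiff_exp.comp (contDiff_const.mul Complex.ofRealCLM.contDiff),
    fun n => ⟨0, 1, fun r => ?_⟩⟩
  rw [norm_iteratedFDeriv_eq_norm_iteratedDeriv, hd]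
  simp [Complex.norm_exp]

variable {A : Cfg d → Cfg d}

theorem circulation_eq (x e : Cfg d) (hA : Continuous A) :
    circulation A x (x + e) = ∫ s in (0 : ℝ)..1, inner ℝ (A (x + s • e)) e := by
  have h : ∀ s : ℝ, (1 - s) • x + s • (x + e) = x + s • e := fun s => by module
  simp only [circulation, h, sub_add_cancel_left, inner_neg_left, neg_neg]
  simp only [real_inner_comm e]
  exact ((innerSL ℝ e).intervalIntegral_comp_comm
    (Continuous.intervalIntegrable (by fun_prop) 0 1)).symm

theorem circulation_self (x : Cfg d) : circulation A x x = 0 := by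
  simp [circulation]

theorem hasTemperateGrowth_circulation (hA : Function.HasTemperateGrowth A) :
    Function.HasTemperateGrowth (fun p : Phase d => circulation A p.1 p.2) := by
  have hf : Function.HasTemperateGrowth (fun p : Phase d => p.1) :=
    (ContinuousLinearMap.fst ℝ (Cfg d) (Cfg d)).hasTemperateGrowth
  have hs : Function.HasTemperateGrowth (fun p : Phase d => p.2) :=
    (ContinuousLinearMap.snd ℝ (Cfg d) (Cfg d)).hasTemperateGrowth
  have hG : IsTemperateFamily (volume.restrict (Ioc (0 : ℝ) 1))
      (fun q : ℝ × Phase d => (1 : ℝ) • A (((1 - q.1) • ContinuousLinearMap.fst ℝ (Cfg d) (Cfg d) +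
        q.1 • ContinuousLinearMap.snd ℝ (Cfg d) (Cfg d)) q.2)) := by
    refine isTemperateFamily_comp (κ := fun _ => 1)
      (ℓ := fun s => (1 - s) • ContinuousLinearMap.fst ℝ (Cfg d) (Cfg d) +
        s • ContinuousLinearMap.snd ℝ (Cfg d) (Cfg d)) hA contDiff_const ?_ (c := 2) ?_ one_le_two
    · simp only [add_apply, smul_apply, ContinuousLinearMap.coe_fst', ContinuousLinearMap.coe_snd']
      fun_prop
    · refine (ae_restrict_mem measurableSet_Ioc).mono fun s hs => ⟨by simp, ?_⟩
      refine ContinuousLinearMap.opNorm_le_bound _ zero_le_two fun p => ?_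
      refine (norm_add_le ((1 - s) • p.1) (s • p.2)).trans ?_
      rw [norm_smul, norm_smul, Real.norm_of_nonneg hs.1.le,
        Real.norm_of_nonneg (by linarith [hs.2] : 0 ≤ 1 - s)]
      have h1 := norm_fst_le p
      have h2 := norm_snd_le p
      nlinarith [hs.1, hs.2, norm_nonneg p.1, norm_nonneg p.2]
  have hM := hG.hasTemperateGrowth
  have h : (fun p : Phase d => circulation A p.1 p.2) = fun p : Phase d =>
      -(innerSL ℝ (p.1 - p.2) (∫ s in Ioc (0 : ℝ) 1, (1 : ℝ) • A
        (((1 - s) • ContinuousLinearMap.fst ℝ (Cfg d) (Cfg d) +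
        s • ContinuousLinearMap.snd ℝ (Cfg d) (Cfg d)) p))) := by
    funext p
    simp only [circulation, intervalIntegral.integral_of_le zero_le_one, one_smul]
    rfl
  rw [h]
  exact ((innerSL ℝ).bilinear_hasTemperateGrowth (hf.sub hs) hM).neg

theorem omegaA_eq (x y : Cfg d) :
    omegaA A x y = Complex.exp (Complex.I * ((-circulation A x y : ℝ) : ℂ)) := by
  simp [omegaA]

theorem hasTemperateGrowth_omegaA (hA : Function.HasTemperateGrowth A) :
    Function.HasTemperateGrowth (fun p : Phase d => omegaA A p.1 p.2) := by
  simp only [omegaA_eq]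
  exact hasTemperateGrowth_cexp.comp (hasTemperateGrowth_circulation hA).neg

theorem norm_omegaA (x y : Cfg d) : ‖omegaA A x y‖ = 1 := by
  rw [omegaA_eq, Complex.norm_exp]
  simp

/-- The flux through the triangle with vertices `x`, `x + y`, `x + y + z`. -/
def flux (A : Cfg d → Cfg d) (q : Big d) : ℝ :=
  circulation A q.1.1 (q.1.1 + q.2.1.1) + circulation A (q.1.1 + q.2.1.1) (q.1.1 + q.2.1.1 + q.2.1.2)
    - circulation A q.1.1 (q.1.1 + q.2.1.1 + q.2.1.2)

/-- The magnetic phase factor of a triangle. -/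
def triangle (A : Cfg d → Cfg d) (q : Big d) : ℂ :=
  Complex.exp (Complex.I * ((-flux A q : ℝ) : ℂ))

theorem omegaA_mul_omegaA (q : Big d) :
    omegaA A q.1.1 (q.1.1 + q.2.1.1) * omegaA A (q.1.1 + q.2.1.1) (q.1.1 + q.2.1.1 + q.2.1.2) =
      omegaA A q.1.1 (q.1.1 + q.2.1.1 + q.2.1.2) * triangle A q := by
  simp only [omegaA_eq, triangle, ← Complex.exp_add, flux]
  congr 1
  push_cast
  ring

/-- A degenerate triangle carries no flux; hence the magnetic field is absent from the leading term.
-/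
theorem triangle_eq_one (q : Big d) (hq : q.2.1.2 = 0) : triangle A q = 1 := by
  simp [triangle, flux, hq, circulation_self]

/-- The antisymmetric part of the Jacobian of `A` is `dA = B`. -/
theorem inner_fderiv_sub {B : Fin d → Fin d → Cfg d → ℝ} (hA : IsVectorPotential A B)
    (x e f : Cfg d) : inner ℝ (fderiv ℝ A x e) f - inner ℝ (fderiv ℝ A x f) e =
      ∑ j, ∑ k, e j * f k * B j k x := by
  have hd := hA.temperate.1.diff_at x
  have hp : ∀ j k, partialX j (fun y => A y k) x = fderiv ℝ A x (EuclideanSpace.single j 1) k := by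
    intro j k
    have h1 : HasFDerivAt (fun y => A y k) ((EuclideanSpace.proj k : Cfg d →L[ℝ] ℝ) ∘L fderiv ℝ A x) x :=
      (EuclideanSpace.proj k : Cfg d →L[ℝ] ℝ).hasFDerivAt.comp x hd.hasFDerivAt
    rw [partialX, h1.fderiv]
    rfl
  have he : ∀ e : Cfg d, ∀ k, fderiv ℝ A x e k =
      ∑ j, e j * fderiv ℝ A x (EuclideanSpace.single j 1) k := by
    intro e k
    have h3 : e = ∑ j, e j • EuclideanSpace.single j (1 : ℝ) := by
      ext i
      simp [Pi.single_apply]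
    conv_lhs => rw [h3]
    simp [map_sum]
  simp only [hA.curl, hp, PiLp.inner_apply, RCLike.inner_apply, conj_trivial]
  simp only [he e, he f, Finset.mul_sum, mul_sub, Finset.sum_sub_distrib]
  congr 1
  · rw [Finset.sum_comm]
    exact Finset.sum_congr rfl fun j _ => Finset.sum_congr rfl fun k _ => by ring
  · exact Finset.sum_congr rfl fun j _ => Finset.sum_congr rfl fun k _ => by ring

/-- Stokes' theorem for a triangle. -/
theorem flux_eq {B : Fin d → Fin d → Cfg d → ℝ} (hA : IsVectorPotential A B) (q : Big d) :
    flux A q = ∫ s in (0 : ℝ)..1, ∫ t in (0 : ℝ)..1,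
      s * ∑ j, ∑ k, q.2.1.1 j * q.2.1.2 k *
        B j k (q.1.1 + s • q.2.1.1 + (s * t) • q.2.1.2) := by
  obtain ⟨⟨x, ξ⟩, ⟨e, f⟩, H⟩ := q
  have hAs := hA.temperate.1
  have hAc := hAs.continuous
  -- With `γ(s,t) = x + s(e + tf)`, `F = ⟨A∘γ, ∂_t γ⟩` and `G = -⟨A∘γ, ∂_s γ⟩` are the components of
  -- the pullback of `A`, so the divergence of `(F, G)` is the pullback of `dA`. The Jacobian factor
  -- is `s`.
  let F : ℝ × ℝ → ℝ := fun τ => τ.1 * inner ℝ (A (x + τ.1 • (e + τ.2 • f))) f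
  let G : ℝ × ℝ → ℝ := fun τ => -inner ℝ (A (x + τ.1 • (e + τ.2 • f))) (e + τ.2 • f)
  have hγ : ContDiff ℝ ∞ fun τ : ℝ × ℝ => A (x + τ.1 • (e + τ.2 • f)) := hAs.comp (by fun_prop)
  have hF : ContDiff ℝ ∞ F := contDiff_fst.mul (hγ.inner ℝ contDiff_const)
  have hG : ContDiff ℝ ∞ G := (hγ.inner ℝ (by fun_prop)).neg
  have hdiv : ∀ s t : ℝ, fderiv ℝ F (s, t) (1, 0) + fderiv ℝ G (s, t) (0, 1) =
      s * ∑ j, ∑ k, e j * f k * B j k (x + s • e + (s * t) • f) := by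
    intro s t
    have hpt : x + s • e + (s * t) • f = x + s • (e + t • f) := by module
    have hs : HasDerivAt (fun s : ℝ => ((s, t) : ℝ × ℝ)) (1, 0) s :=
      (hasDerivAt_id s).prodMk (hasDerivAt_const s t)
    have ht : HasDerivAt (fun t : ℝ => ((s, t) : ℝ × ℝ)) (0, 1) t :=
      (hasDerivAt_const t s).prodMk (hasDerivAt_id t)
    have hF1 := (hF.diff_at (s, t)).hasFDerivAt.comp_hasDerivAt s hs
    have hG1 := (hG.diff_at (s, t)).hasFDerivAt.comp_hasDerivAt t ht
    have hd := (hAs.diff_at (x + s • (e + t • f))).hasFDerivAt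
    have hA1 : HasDerivAt (fun s : ℝ => A (x + s • (e + t • f)))
        (fderiv ℝ A (x + s • (e + t • f)) (e + t • f)) s := by
      refine hd.comp_hasDerivAt s ?_
      simpa using ((hasDerivAt_id s).smul_const (e + t • f)).const_add x
    have hw : HasDerivAt (fun t : ℝ => e + t • f) f t := by
      simpa using ((hasDerivAt_id t).smul_const f).const_add e
    have hA2 : HasDerivAt (fun t : ℝ => A (x + s • (e + t • f)))
        (fderiv ℝ A (x + s • (e + t • f)) (s • f)) t :=
      HasFDerivAt.comp_hasDerivAt (l := A) t hd ((hw.const_smul s).const_add x)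
    have hF2 := (hasDerivAt_id s).mul (hA1.inner ℝ (hasDerivAt_const s f))
    have hG2 := (hA2.inner ℝ hw).neg
    rw [hF1.unique hF2, hG1.unique hG2, hpt, ← inner_fderiv_sub hA]
    simp only [id, inner_zero_right, map_add, map_smul, inner_add_left, inner_add_right,
      inner_smul_left, inner_smul_right, conj_trivial]
    ring
  have hcont : Continuous fun τ => fderiv ℝ F τ (1, 0) + fderiv ℝ G τ (0, 1) :=
    (contDiff_dirDeriv' hF (1, 0)).continuous.add (contDiff_dirDeriv' hG (0, 1)).continuous
  have key := integral2_divergence_prod_of_hasFDerivAt F G (fderiv ℝ F) (fderiv ℝ G) 0 0 1 1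
    hF.continuous.continuousOn hG.continuous.continuousOn
    (fun τ _ => (hF.diff_at τ).hasFDerivAt) (fun τ _ => (hG.diff_at τ).hasFDerivAt)
    (hcont.continuousOn.integrableOn_compact (isCompact_uIcc.prod isCompact_uIcc))
  simp only [hdiv] at key
  rw [key]
  -- Of the four sides of the square, `s = 0` is collapsed to the vertex `x`; the other three give
  -- the edges of the triangle.
  simp only [flux, add_assoc x e f, circulation_eq x e hAc, circulation_eq x (e + f) hAc]
  rw [← add_assoc x e f, circulation_eq (x + e) f hAc]
  simp only [F, G, zero_smul, one_smul, add_zero, zero_mul, one_mul,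
    intervalIntegral.integral_zero, sub_zero, intervalIntegral.integral_neg, ← add_assoc]
  ring

end Magnetic

end

section

variable {d : ℕ}

/-! ### The flux factor as an amplitude. -/

section Flux

/-- The position variables `(x, (y, z))`. -/
def posVars : Big d →L[ℝ] Cfg d × Phase d :=
  (posX).prod (ContinuousLinearMap.fst ℝ (Phase d) (Phase d) ∘L
    ContinuousLinearMap.snd ℝ (Phase d) (Phase d × Phase d))

theorem posVars_apply (q : Big d) : posVars q = (q.1.1, q.2.1) := rfl

theorem posVars_xi (j : Fin d) : posVars (bigDir (Sum.inl (Sum.inr j)) : Big d) = 0 := rfl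

theorem posVars_H (i : Fin d ⊕ Fin d) : posVars (bigDir (Sum.inr (Sum.inr i)) : Big d) = 0 := rfl

theorem dirDeriv_comp_posVars {ρ : Cfg d × Phase d → ℝ} (hρ : ContDiff ℝ ∞ ρ) (v : Big d) :
    dirDeriv v (fun q => (ρ (posVars q) : ℂ)) =
      fun q => ((fderiv ℝ ρ (posVars q) (posVars v) : ℝ) : ℂ) := by
  funext q
  have h := (Complex.ofRealCLM.hasFDerivAt.comp q
    ((hρ.diff_at (posVars q)).hasFDerivAt.comp q posVars.hasFDerivAt)).fderiv
  simp only [dirDeriv]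
  exact congrArg (fun L => L v) h

/-- No decay in `ξ` is needed: derivatives in `ξ` and in `H` vanish, and the remaining ones need not
gain anything. -/
theorem amp_comp_posVars {ρ : Cfg d × Phase d → ℝ} (hρ : ContDiff ℝ ∞ ρ)
    (hb : ∀ n : ℕ, ∃ C : ℝ, ∀ x, ‖iteratedFDeriv ℝ n ρ x‖ ≤ C) :
    Amp₁ 0 0 0 (fun q => (ρ (posVars q) : ℂ)) := by
  intro n
  change AmpN n 0 0 0 _
  induction n generalizing ρ with
  | zero =>
    obtain ⟨C, hC⟩ := hb 0
    refine AmpN.intro (C := C) (Complex.ofRealCLM.contDiff.comp (hρ.comp posVars.contDiff))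
      ((norm_nonneg _).trans (hC 0)) (fun q => ?_) (fun k i h => by omega)
    have := hC (posVars q)
    rw [norm_iteratedFDeriv_zero] at this
    simpa [wt] using this
  | succ n ih =>
    obtain ⟨C, hC⟩ := hb 0
    refine AmpN.intro (C := C) (Complex.ofRealCLM.contDiff.comp (hρ.comp posVars.contDiff))
      ((norm_nonneg _).trans (hC 0)) (fun q => ?_) (fun k i hk => ?_)
    · have := hC (posVars q)
      rw [norm_iteratedFDeriv_zero] at this
      simpa [wt] using this
    obtain rfl : n = k := by omega
    have hi : AmpN n 0 0 0
        (fun q => ((fderiv ℝ ρ (posVars q) (posVars (bigDir i)) : ℝ) : ℂ)) := by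
      refine ih (contDiff_dirDeriv' hρ _) fun m => ?_
      obtain ⟨D, hD⟩ := hb (m + 1)
      refine ⟨‖posVars (bigDir i : Big d)‖ * D, fun x => ?_⟩
      refine (norm_iteratedFDeriv_clm_apply_const ((hρ.fderiv_right (m := m)
        (by exact_mod_cast le_top)).contDiffAt) le_rfl).trans ?_
      rw [norm_iteratedFDeriv_fderiv]
      exact mul_le_mul_of_nonneg_left (hD x) (norm_nonneg _)
    rw [dirDeriv_comp_posVars hρ]
    rcases i with (j | j) | (i | i)
    · exact hi.weaken (by simp [expo, ord]) (by simp [expo]) (by simp [expo])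
    · simp only [posVars_xi, map_zero, Complex.ofReal_zero]
      exact (Amp.zero (T := Unit) (d := d)) n
    · exact hi.weaken (by simp [expo]) (by simp [expo]) (by simp [expo])
    · exact hi.weaken (by simp [expo]) (by simp [expo]) (by simp [expo])

/-- Uniform measure on the unit square. -/
abbrev squareMeasure : Measure (ℝ × ℝ) :=
  volume.restrict (Ioc (0 : ℝ) 1 ×ˢ Ioc (0 : ℝ) 1)

instance : IsFiniteMeasure squareMeasure :=
  ⟨by
    rw [squareMeasure, Measure.restrict_apply_univ, Measure.volume_eq_prod, Measure.prod_prod]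
    simp⟩

/-- The points of a triangle, as linear functions of `(x, (y, z))`. -/
def trianglePoint (τ : ℝ × ℝ) : Cfg d × Phase d →L[ℝ] Cfg d :=
  ContinuousLinearMap.fst ℝ (Cfg d) (Phase d) +
    τ.1 • (ContinuousLinearMap.fst ℝ (Cfg d) (Cfg d) ∘L
      ContinuousLinearMap.snd ℝ (Cfg d) (Phase d)) +
    (τ.1 * τ.2) • (ContinuousLinearMap.snd ℝ (Cfg d) (Cfg d) ∘L
      ContinuousLinearMap.snd ℝ (Cfg d) (Phase d))

theorem trianglePoint_apply (τ : ℝ × ℝ) (p : Cfg d × Phase d) :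
    trianglePoint τ p = p.1 + τ.1 • p.2.1 + (τ.1 * τ.2) • p.2.2 := rfl

theorem norm_trianglePoint_le {τ : ℝ × ℝ} (hτ : τ ∈ Ioc (0 : ℝ) 1 ×ˢ Ioc (0 : ℝ) 1) :
    ‖(trianglePoint τ : Cfg d × Phase d →L[ℝ] Cfg d)‖ ≤ 3 := by
  refine ContinuousLinearMap.opNorm_le_bound _ (by norm_num) fun p => ?_
  rw [trianglePoint_apply]
  have h1 : ‖p.1‖ ≤ ‖p‖ := norm_fst_le p
  have h2 : ‖p.2.1‖ ≤ ‖p‖ := (norm_fst_le p.2).trans (norm_snd_le p)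
  have h3 : ‖p.2.2‖ ≤ ‖p‖ := (norm_snd_le p.2).trans (norm_snd_le p)
  have h4 : ‖τ.1‖ ≤ 1 := by rw [Real.norm_of_nonneg hτ.1.1.le]; exact hτ.1.2
  have h5 : ‖τ.2‖ ≤ 1 := by rw [Real.norm_of_nonneg hτ.2.1.le]; exact hτ.2.2
  have h6 : ‖τ.1 • p.2.1‖ ≤ ‖p‖ := by
    rw [norm_smul]
    exact (mul_le_of_le_one_left (norm_nonneg _) h4).trans h2
  have h7 : ‖(τ.1 * τ.2) • p.2.2‖ ≤ ‖p‖ := by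
    rw [norm_smul, norm_mul]
    exact (mul_le_of_le_one_left (norm_nonneg _)
      (mul_le_one₀ h4 (norm_nonneg _) h5)).trans h3
  linarith [norm_add₃_le (a := p.1) (b := τ.1 • p.2.1) (c := (τ.1 * τ.2) • p.2.2)]

/-- The weighted mean of a function over a triangle. -/
def triangleMean (h : Cfg d → ℝ) (p : Cfg d × Phase d) : ℝ :=
  ∫ τ, τ.1 • h (trianglePoint τ p) ∂squareMeasure

/-- On the unit square the maps `trianglePoint` are linear of norm at most `3`, so the bounds on the
derivatives of `h` survive substitution and averaging, uniformly in the size of the triangle. -/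
theorem triangleMean_bounds {h : Cfg d → ℝ} (hh : IsBCInfty h) :
    ContDiff ℝ ∞ (triangleMean h) ∧
      ∀ n : ℕ, ∃ C : ℝ, ∀ p, ‖iteratedFDeriv ℝ n (triangleMean h) p‖ ≤ C := by
  refine exists_norm_iteratedFDeriv_integral_le (κ := Prod.fst) (ℓ := trianglePoint) hh.1 hh.2
    contDiff_fst ?_ (c := 3) ?_ (by norm_num)
  · simp only [trianglePoint_apply]
    fun_prop
  · refine (ae_restrict_mem (measurableSet_Ioc.prod measurableSet_Ioc)).mono fun τ hτ =>
      ⟨?_, norm_trianglePoint_le hτ⟩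
    rw [Real.norm_of_nonneg hτ.1.1.le]
    exact hτ.1.2

theorem integrable_triangle {h : Cfg d → ℝ} (hh : IsBCInfty h) (p : Cfg d × Phase d) :
    Integrable (fun τ => τ.1 * h (trianglePoint τ p)) squareMeasure := by
  obtain ⟨C, hC⟩ := hh.2 0
  have hcont : Continuous fun τ : ℝ × ℝ => τ.1 * h (trianglePoint τ p) := by
    have := hh.1.continuous
    simp only [trianglePoint_apply]
    fun_prop
  refine Integrable.of_bound hcont.aestronglyMeasurable (1 * C) ?_
  refine (ae_restrict_mem (measurableSet_Ioc.prod measurableSet_Ioc)).mono fun τ hτ => ?_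
  rw [norm_mul, Real.norm_of_nonneg hτ.1.1.le]
  have h1 := hC (trianglePoint τ p)
  rw [norm_iteratedFDeriv_zero] at h1
  exact mul_le_mul hτ.1.2 h1 (norm_nonneg _) zero_le_one

variable {A : Cfg d → Cfg d} {B : Fin d → Fin d → Cfg d → ℝ}

theorem flux_eq_sum (hB : IsMagneticField B) (hA : IsVectorPotential A B) (q : Big d) :
    flux A q = ∑ j, ∑ k, q.2.1.1 j * q.2.1.2 k * triangleMean (B j k) (posVars q) := by
  have hint : ∀ j k, Integrable (fun τ : ℝ × ℝ => q.2.1.1 j * q.2.1.2 k *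
      (τ.1 * B j k (trianglePoint τ (posVars q)))) squareMeasure :=
    fun j k => (integrable_triangle (hB.bounded j k) _).const_mul _
  have h1 : (fun τ : ℝ × ℝ => τ.1 * ∑ j, ∑ k, q.2.1.1 j * q.2.1.2 k *
      B j k (q.1.1 + τ.1 • q.2.1.1 + (τ.1 * τ.2) • q.2.1.2)) = fun τ => ∑ j, ∑ k,
        q.2.1.1 j * q.2.1.2 k * (τ.1 * B j k (trianglePoint τ (posVars q))) := by
    funext τ
    simp only [Finset.mul_sum, trianglePoint_apply, posVars_apply]
    exact Finset.sum_congr rfl fun j _ => Finset.sum_congr rfl fun k _ => by ring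
  have hint2 := integrable_finsetSum Finset.univ fun j _ =>
    integrable_finsetSum Finset.univ fun k _ => hint j k
  rw [flux_eq hA]
  simp only [intervalIntegral.integral_of_le zero_le_one]
  rw [← setIntegral_prod (fun τ : ℝ × ℝ => τ.1 * ∑ j, ∑ k, q.2.1.1 j * q.2.1.2 k *
      B j k (q.1.1 + τ.1 • q.2.1.1 + (τ.1 * τ.2) • q.2.1.2)) (by rw [h1]; exact hint2)]
  rw [← Measure.volume_eq_prod, h1, integral_finsetSum _ fun j _ =>
    integrable_finsetSum Finset.univ fun k _ => hint j k]
  refine Finset.sum_congr rfl fun j _ => ?_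
  rw [integral_finsetSum _ fun k _ => hint j k]
  refine Finset.sum_congr rfl fun k _ => ?_
  rw [integral_const_mul]
  rfl

theorem ofReal_flux (hB : IsMagneticField B) (hA : IsVectorPotential A B) :
    (fun q => (flux A q : ℂ)) = fun q => ∑ j, ∑ k, coordY (Sum.inl j) q * coordY (Sum.inr k) q *
      (triangleMean (B j k) (posVars q) : ℂ) := by
  funext q
  rw [flux_eq_sum hB hA]
  push_cast
  rfl

theorem contDiff_circulation_comp (hA : Function.HasTemperateGrowth A) {u v : Big d → Cfg d}
    (hu : ContDiff ℝ ∞ u) (hv : ContDiff ℝ ∞ v) :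
    ContDiff ℝ ∞ (fun q => circulation A (u q) (v q)) := by
  have h : ContDiff ℝ ∞ (fun p : Phase d => circulation A p.1 p.2) := by
    have := hasTemperateGrowth_circulation hA
    exact this.1
  have h2 : ContDiff ℝ ∞ ((fun p : Phase d => circulation A p.1 p.2) ∘ fun q => (u q, v q)) :=
    h.comp (hu.prodMk hv)
  exact h2

theorem contDiff_flux (hA : Function.HasTemperateGrowth A) : ContDiff ℝ ∞ (flux A) := by
  have hx : ContDiff ℝ ∞ (fun q : Big d => q.1.1) := contDiff_fst.comp contDiff_fst
  have hy : ContDiff ℝ ∞ (fun q : Big d => q.2.1.1) :=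
    contDiff_fst.comp (contDiff_fst.comp contDiff_snd)
  have hz : ContDiff ℝ ∞ (fun q : Big d => q.2.1.2) :=
    contDiff_snd.comp (contDiff_fst.comp contDiff_snd)
  exact ((contDiff_circulation_comp hA hx (hx.add hy)).add
    (contDiff_circulation_comp hA (hx.add hy) ((hx.add hy).add hz))).sub
    (contDiff_circulation_comp hA hx ((hx.add hy).add hz))

/-- The flux is a sum of terms `y_j z_k` times functions bounded with all derivatives, so each
derivative is of size at most `(1+|Y|)²`: this is the exponent of `1+|Y|` allowed to parameter and
`Y`-derivatives. The estimate sees `B` and not the growth of `A`. -/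
theorem amp_triangle (hB : IsMagneticField B) (hA : IsVectorPotential A B) :
    Amp₁ 0 0 0 (triangle A) := by
  have hflux := contDiff_flux hA.temperate
  refine Amp.cexp_I (ψ := fun _ : Unit => fun q => -flux A q) (fun _ => hflux.neg) fun i => ?_
  have hJ : ∀ j k, Amp₁ 0 0 0 (fun q : Big d => (triangleMean (B j k) (posVars q) : ℂ)) :=
    fun j k => amp_comp_posVars (triangleMean_bounds (hB.bounded j k)).1
      (triangleMean_bounds (hB.bounded j k)).2
  have hJd := fun j k v =>
    dirDeriv_comp_posVars (triangleMean_bounds (hB.bounded j k)).1 v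
  have hneg : (fun q => ((-flux A q : ℝ) : ℂ)) = fun q => (-1 : ℂ) * (flux A q : ℂ) := by
    funext q
    simp
  have hfl : ContDiff ℝ ∞ (fun q => (flux A q : ℂ)) := Complex.ofRealCLM.contDiff.comp hflux
  rw [hneg, dirDeriv_const_mul hfl]
  refine Amp.const_mul _ ?_
  rw [ofReal_flux hB hA]
  have hyz : ∀ j k, ContDiff ℝ ∞ (fun q : Big d => coordY (Sum.inl j) q * coordY (Sum.inr k) q) :=
    fun j k => (contDiff_coordY _).mul (contDiff_coordY _)
  have hterm : ∀ j k, ContDiff ℝ ∞ (fun q : Big d => coordY (Sum.inl j) q * coordY (Sum.inr k) q *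
      (triangleMean (B j k) (posVars q) : ℂ)) := fun j k => (hyz j k).mul ((hJ j k).smooth ())
  rw [dirDeriv_sum _ fun j _ => ContDiff.sum fun k _ => hterm j k]
  refine Amp.sum _ fun j _ => ?_
  rw [dirDeriv_sum _ fun k _ => hterm j k]
  refine Amp.sum _ fun k _ => ?_
  rw [dirDeriv_mul (hyz j k) ((hJ j k).smooth ()),
    dirDeriv_mul (contDiff_coordY _) (contDiff_coordY _)]
  have hy : ∀ (l : Fin d ⊕ Fin d) (v : Big d), dirDeriv v (coordY l) = fun _ => coordY l v := by
    intro l v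
    exact dirDeriv_clm (Complex.ofRealCLM ∘L coord l ∘L ContinuousLinearMap.fst ℝ _ _ ∘L
      ContinuousLinearMap.snd ℝ _ _) v
  have hY := fun l : Fin d ⊕ Fin d => amp_coordY (T := Unit) (d := d) l
  simp only [hy]
  have hzero : ∀ v : Big d, posVars v = 0 → (fun q : Big d =>
      (coordY (Sum.inl j) v * coordY (Sum.inr k) q + coordY (Sum.inl j) q * coordY (Sum.inr k) v) *
        (triangleMean (B j k) (posVars q) : ℂ) + coordY (Sum.inl j) q * coordY (Sum.inr k) q *
        dirDeriv v (fun q => (triangleMean (B j k) (posVars q) : ℂ)) q) = fun _ => 0 := by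
    intro v hv
    have h0 : ∀ l, coordY l v = 0 := fun l => by
      have : v.2.1 = 0 := congrArg Prod.snd hv
      simp [coordY, this]
    funext q
    rw [hJd, hv]
    simp [h0]
  have hmain : ∀ i : BigIdx d, Amp₁ 0 0 0
      (dirDeriv (bigDir i) (fun q => (triangleMean (B j k) (posVars q) : ℂ))) → Amp₁ 0 2 0
      (fun q : Big d => (coordY (Sum.inl j) (bigDir i) * coordY (Sum.inr k) q +
        coordY (Sum.inl j) q * coordY (Sum.inr k) (bigDir i)) *
        (triangleMean (B j k) (posVars q) : ℂ) + coordY (Sum.inl j) q * coordY (Sum.inr k) q *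
        dirDeriv (bigDir i) (fun q => (triangleMean (B j k) (posVars q) : ℂ)) q) := by
    intro i hi
    refine Amp.add (((Amp.add (Amp.const_mul _ (hY _)) (?_)).mul (hJ j k)).weaken (by simp)
      (by norm_num) (by simp)) ((((hY _).mul (hY _)).mul hi).weaken (by simp) (by norm_num)
      (by simp))
    simp only [mul_comm _ (coordY _ (bigDir i))]
    exact Amp.const_mul _ (hY _)
  have hbd : ∀ v, Amp₁ 0 0 0 (dirDeriv v (fun q => (triangleMean (B j k) (posVars q) : ℂ))) := by
    intro v
    rw [hJd]
    refine amp_comp_posVars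
      (contDiff_dirDeriv' (triangleMean_bounds (hB.bounded j k)).1 (posVars v)) fun m => ?_
    obtain ⟨D, hD⟩ := (triangleMean_bounds (hB.bounded j k)).2 (m + 1)
    refine ⟨‖posVars v‖ * D, fun x => ?_⟩
    refine (norm_iteratedFDeriv_clm_apply_const
      (((triangleMean_bounds (hB.bounded j k)).1.fderiv_right (m := m)
        (by exact_mod_cast le_top)).contDiffAt) le_rfl).trans ?_
    rw [norm_iteratedFDeriv_fderiv]
    exact mul_le_mul_of_nonneg_left (hD x) (norm_nonneg _)
  rcases i with (l | l) | (l | l)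
  · exact (hmain _ (hbd _)).weaken (by simp [expo, ord]) (by simp [expo]) (by simp [expo])
  · rw [hzero _ (posVars_xi l)]
    exact Amp.zero
  · exact (hmain _ (hbd _)).weaken (by simp [expo]) (by simp [expo]) (by simp [expo])
  · rw [hzero _ (posVars_H l)]
    exact Amp.zero

end Flux

end

section

variable {d : ℕ}

/-! ### Bounds by continuous seminorms, and operators on Schwartz functions. -/

section SchwartzBounds

/-- A family of functionals that is dominated by one continuous seminorm. -/
def SBound {X : Type*} (φ : X → 𝓢(Cfg d, ℂ) → ℝ) : Prop :=
  ∃ s : Seminorm ℂ 𝓢(Cfg d, ℂ), Continuous s ∧ ∀ x u, φ x u ≤ s u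

variable {X Y : Type*} {φ ψ : X → 𝓢(Cfg d, ℂ) → ℝ}

theorem SBound.mono (hφ : SBound φ) (h : ∀ x u, ψ x u ≤ φ x u) : SBound ψ := by
  obtain ⟨s, hs, hb⟩ := hφ
  exact ⟨s, hs, fun x u => (h x u).trans (hb x u)⟩

theorem SBound.reindex (hφ : SBound φ) (f : Y → X) : SBound (fun y u => φ (f y) u) := by
  obtain ⟨s, hs, hb⟩ := hφ
  exact ⟨s, hs, fun y u => hb (f y) u⟩

theorem SBound.add (hφ : SBound φ) (hψ : SBound ψ) : SBound (fun x u => φ x u + ψ x u) := by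
  obtain ⟨s, hs, hb⟩ := hφ
  obtain ⟨t, ht, hc⟩ := hψ
  exact ⟨s + t, hs.add ht, fun x u => add_le_add (hb x u) (hc x u)⟩

theorem SBound.zero : SBound (fun (_ : X) (_ : 𝓢(Cfg d, ℂ)) => (0 : ℝ)) :=
  ⟨0, continuous_const, fun _ _ => le_rfl⟩

theorem SBound.sum {κ : Type*} (s : Finset κ) {φ : κ → X → 𝓢(Cfg d, ℂ) → ℝ}
    (h : ∀ k ∈ s, SBound (φ k)) : SBound (fun x u => ∑ k ∈ s, φ k x u) := by
  classical
  induction s using Finset.induction_on with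
  | empty => simpa using SBound.zero
  | insert k s hk ih =>
    simp only [Finset.sum_insert hk]
    exact (h k (by simp)).add (ih fun j hj => h j (by simp [hj]))

theorem SBound.const_mul (hφ : SBound φ) {C : ℝ} (hC : 0 ≤ C) :
    SBound (fun x u => C * φ x u) := by
  obtain ⟨s, hs, hb⟩ := hφ
  lift C to NNReal using hC
  exact ⟨C • s, hs.const_smul C, fun x u => mul_le_mul_of_nonneg_left (hb x u) C.2⟩

theorem SBound.comp (hφ : SBound φ) (L : 𝓢(Cfg d, ℂ) →L[ℂ] 𝓢(Cfg d, ℂ)) :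
    SBound (fun x u => φ x (L u)) := by
  obtain ⟨s, hs, hb⟩ := hφ
  exact ⟨s.comp L.toLinearMap, hs.comp L.continuous, fun x u => hb x (L u)⟩

theorem sBound_apply (k : ℕ) :
    SBound (fun (y : Cfg d) (u : 𝓢(Cfg d, ℂ)) => (1 + ‖y‖) ^ k * ‖u y‖) := by
  have hs : ∀ m : ℕ × ℕ, SBound (fun (_ : Cfg d) (u : 𝓢(Cfg d, ℂ)) =>
      SchwartzMap.seminorm ℂ (E := Cfg d) (F := ℂ) m.1 m.2 u) := fun m =>
    ⟨_, (schwartz_withSeminorms ℂ (Cfg d) ℂ).continuous_seminorm m, fun _ _ => le_rfl⟩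
  refine ((SBound.sum (Finset.Iic (k, 0)) fun m _ => hs m).const_mul
    (C := 2 ^ k) (by positivity)).mono fun y u => ?_
  have h1 := SchwartzMap.one_add_le_sup_seminorm_apply (𝕜 := ℂ) (m := (k, 0)) (k := k) (n := 0)
    le_rfl le_rfl u y
  rw [norm_iteratedFDeriv_zero] at h1
  refine h1.trans (mul_le_mul_of_nonneg_left ?_ (by positivity))
  refine (Seminorm.finset_sup_le_sum _ _ u).trans_eq ?_
  simp

/-- Maps from Schwartz functions to functions with rapidly decaying derivatives up to order `n`. -/
def RapidN : ℕ → (𝓢(Cfg d, ℂ) → Cfg d → ℂ) → Prop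
  | 0, Φ => ∀ N : ℕ, SBound (fun x u => (1 + ‖x‖) ^ N * ‖Φ u x‖)
  | n + 1, Φ => (∀ N : ℕ, SBound (fun x u => (1 + ‖x‖) ^ N * ‖Φ u x‖)) ∧
      ∃ Ψ : Fin d → 𝓢(Cfg d, ℂ) → Cfg d → ℂ, (∀ j, RapidN n (Ψ j)) ∧ ∀ u x,
        HasFDerivAt (Φ u) (∑ j, (EuclideanSpace.proj j : Cfg d →L[ℝ] ℝ).smulRight (Ψ j u x)) x

theorem RapidN.add {n : ℕ} {Φ Φ' : 𝓢(Cfg d, ℂ) → Cfg d → ℂ} (h : RapidN n Φ) (h' : RapidN n Φ') :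
    RapidN n (fun u x => Φ u x + Φ' u x) := by
  have h0 : ∀ {Φ Φ' : 𝓢(Cfg d, ℂ) → Cfg d → ℂ},
      (∀ N : ℕ, SBound (fun x u => (1 + ‖x‖) ^ N * ‖Φ u x‖)) →
      (∀ N : ℕ, SBound (fun x u => (1 + ‖x‖) ^ N * ‖Φ' u x‖)) →
      (∀ N : ℕ, SBound (fun x u => (1 + ‖x‖) ^ N * ‖Φ u x + Φ' u x‖)) := fun h h' N => by
    refine ((h N).add (h' N)).mono fun x u => ?_
    rw [← mul_add]
    exact mul_le_mul_of_nonneg_left (norm_add_le _ _) (by positivity)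
  induction n generalizing Φ Φ' with
  | zero => exact h0 h h'
  | succ n ih =>
    obtain ⟨h1, Ψ, hΨ, hd⟩ := h
    obtain ⟨h1', Ψ', hΨ', hd'⟩ := h'
    refine ⟨h0 h1 h1', fun j u x => Ψ j u x + Ψ' j u x, fun j => ih (hΨ j) (hΨ' j),
      fun u x => ((hd u x).add (hd' u x)).congr_fderiv ?_⟩
    ext v
    simp [Finset.sum_add_distrib]

/-- One level more than `n` is needed because level zero contains only bounds; continuity of the
last derivative is read off from its differentiability. -/
theorem RapidN.iteratedFDeriv {n : ℕ} {Φ : 𝓢(Cfg d, ℂ) → Cfg d → ℂ} (h : RapidN (n + 1) Φ) :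
    (∀ u, ContDiff ℝ n (Φ u)) ∧
      ∀ N : ℕ, SBound (fun x u => (1 + ‖x‖) ^ N * ‖_root_.iteratedFDeriv ℝ n (Φ u) x‖) := by
  induction n generalizing Φ with
  | zero =>
    obtain ⟨h1, Ψ, -, hd⟩ := h
    refine ⟨fun u => contDiff_zero.2 (continuous_iff_continuousAt.2 fun x => (hd u x).continuousAt),
      fun N => ?_⟩
    simpa only [norm_iteratedFDeriv_zero] using h1 N
  | succ n ih =>
    obtain ⟨h1, Ψ, hΨ, hd⟩ := h
    let P := fun j : Fin d => ContinuousLinearMap.smulRightL ℝ (Cfg d) ℂ (EuclideanSpace.proj j)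
    have hf : ∀ u, fderiv ℝ (Φ u) = fun x => ∑ j, P j (Ψ j u x) := fun u => by
      funext x
      rw [(hd u x).fderiv]
      rfl
    have hc : ∀ j u, ContDiff ℝ n (fun x => P j (Ψ j u x)) := fun j u =>
      (P j).contDiff.comp ((ih (hΨ j)).1 u)
    refine ⟨fun u => (contDiff_succ_iff_fderiv (n := (n : WithTop ℕ∞))).2
      ⟨fun x => (hd u x).differentiableAt, by simp, ?_⟩, fun N => ?_⟩
    · rw [hf]
      exact ContDiff.sum fun j _ => hc j u
    · refine (SBound.sum Finset.univ fun j _ =>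
        ((ih (hΨ j)).2 N).const_mul (norm_nonneg (P j))).mono fun x u => ?_
      rw [← norm_iteratedFDeriv_fderiv, hf, iteratedFDeriv_fun_sum_apply fun j _ => (hc j u).contDiffAt]
      calc (1 + ‖x‖) ^ N * ‖∑ j, _root_.iteratedFDeriv ℝ n (fun x => P j (Ψ j u x)) x‖
          ≤ (1 + ‖x‖) ^ N * ∑ j, ‖P j‖ * ‖_root_.iteratedFDeriv ℝ n (Ψ j u) x‖ := by
            gcongr
            refine (norm_sum_le _ _).trans (Finset.sum_le_sum fun j _ => ?_)
            exact (P j).norm_iteratedFDeriv_comp_left ((ih (hΨ j)).1 u).contDiffAt le_rfl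
        _ = _ := by
            rw [Finset.mul_sum]
            exact Finset.sum_congr rfl fun j _ => by ring

theorem exists_clm_of_rapid {Φ : 𝓢(Cfg d, ℂ) → Cfg d → ℂ} (h : ∀ n, RapidN n Φ)
    (hadd : ∀ u v x, Φ (u + v) x = Φ u x + Φ v x) (hsmul : ∀ (c : ℂ) u x, Φ (c • u) x = c * Φ u x) :
    ∃ T : 𝓢(Cfg d, ℂ) →L[ℂ] 𝓢(Cfg d, ℂ), ∀ u x, T u x = Φ u x := by
  refine ⟨SchwartzMap.mkCLM Φ hadd hsmul
    (fun u => contDiff_infty.2 fun n => (h (n + 1)).iteratedFDeriv.1 u) ?_, fun u x => rfl⟩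
  rintro ⟨k, n⟩
  obtain ⟨s, hs, hb⟩ := (h (n + 1)).iteratedFDeriv.2 k
  -- A continuous seminorm on `𝓢` is dominated by finitely many of the standard ones, the form in
  -- which continuity is to be supplied.
  obtain ⟨t, C, -, ht⟩ := Seminorm.bound_of_continuous (schwartz_withSeminorms ℂ (Cfg d) ℂ) s hs
  refine ⟨t, C, C.2, fun u x => ?_⟩
  refine le_trans ?_ ((hb x u).trans (ht u))
  refine mul_le_mul_of_nonneg_right ?_ (norm_nonneg _)
  exact pow_le_pow_left₀ (norm_nonneg _) (by linarith) _

end SchwartzBounds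

end

section

variable {d : ℕ}

/-! ### Integrals of Schwartz functions against kernels of temperate growth. -/

section KernelIntegrals

theorem integrable_decay : Integrable (fun y : Cfg d => (1 + ‖y‖) ^ (-((d + 1 : ℕ) : ℝ))) := by
  refine integrable_one_add_norm ?_
  rw [finrank_euclideanSpace_fin]
  exact_mod_cast Nat.lt_succ_self d

theorem sBound_weight_integral (k : ℕ) : SBound (fun (_ : Unit) (u : 𝓢(Cfg d, ℂ)) =>
    ∫ y, (1 + ‖y‖) ^ k * ‖u y‖) := by
  have hr := integrable_decay (d := d)
  obtain ⟨s, hs, hb⟩ := sBound_apply (d := d) (k + (d + 1))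
  have hI : 0 ≤ ∫ y : Cfg d, (1 + ‖y‖) ^ (-((d + 1 : ℕ) : ℝ)) :=
    integral_nonneg fun y => by positivity
  refine SBound.mono (φ := fun _ u => (∫ y : Cfg d, (1 + ‖y‖) ^ (-((d + 1 : ℕ) : ℝ))) * s u)
    (SBound.const_mul ⟨s, hs, fun _ _ => le_rfl⟩ hI) fun _ u => ?_
  rw [← integral_mul_const]
  refine integral_mono_of_nonneg (Eventually.of_forall fun y => by positivity) (hr.mul_const _)
    (Eventually.of_forall fun y => ?_)
  have h0 : (0 : ℝ) < 1 + ‖y‖ := by positivity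
  have h1 : (1 + ‖y‖) ^ (k + (d + 1)) * ‖u y‖ ≤ s u := hb y u
  rw [pow_add] at h1
  simp only [Real.rpow_neg h0.le, Real.rpow_natCast]
  rw [le_inv_mul_iff₀ (pow_pos h0 _)]
  linarith

theorem integrable_weight_mul (k : ℕ) (u : 𝓢(Cfg d, ℂ)) :
    Integrable (fun y => (1 + ‖y‖) ^ k * ‖u y‖) := by
  have hr := integrable_decay (d := d)
  obtain ⟨s, hs, hb⟩ := sBound_apply (d := d) (k + (d + 1))
  refine (hr.mul_const (s u)).mono' (by fun_prop) (Eventually.of_forall fun y => ?_)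
  have h0 : (0 : ℝ) < 1 + ‖y‖ := by positivity
  have h1 : (1 + ‖y‖) ^ (k + (d + 1)) * ‖u y‖ ≤ s u := hb y u
  rw [pow_add] at h1
  rw [Real.norm_of_nonneg (by positivity)]
  simp only [Real.rpow_neg h0.le, Real.rpow_natCast]
  rw [le_inv_mul_iff₀ (pow_pos h0 _)]
  linarith

theorem one_add_norm_prod_le {V W : Type*} [NormedAddCommGroup V] [NormedAddCommGroup W] (p : V × W) :
    1 + ‖p‖ ≤ (1 + ‖p.1‖) * (1 + ‖p.2‖) := by
  have h : ‖p‖ ≤ ‖p.1‖ + ‖p.2‖ := by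
    rw [Prod.norm_def]
    exact max_le_add_of_nonneg (norm_nonneg _) (norm_nonneg _)
  nlinarith [norm_nonneg p.1, norm_nonneg p.2]

theorem exists_bound_of_temperate {V W F : Type*} [NormedAddCommGroup V] [NormedSpace ℝ V]
    [NormedAddCommGroup W] [NormedSpace ℝ W] [NormedAddCommGroup F] [NormedSpace ℝ F] {f : V × W → F}
    (hf : Function.HasTemperateGrowth f) :
    ∃ (k : ℕ) (C : ℝ), 0 ≤ C ∧ ∀ p, ‖f p‖ ≤ C * ((1 + ‖p.1‖) ^ k * (1 + ‖p.2‖) ^ k) ∧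
      ‖fderiv ℝ f p‖ ≤ C * ((1 + ‖p.1‖) ^ k * (1 + ‖p.2‖) ^ k) := by
  obtain ⟨k, C, hC, h⟩ := hf.norm_iteratedFDeriv_le_uniform 1
  have h2 : ∀ p : V × W, C * (1 + ‖p‖) ^ k ≤ C * ((1 + ‖p.1‖) ^ k * (1 + ‖p.2‖) ^ k) := fun p => by
    rw [← mul_pow]
    have := one_add_norm_prod_le p
    gcongr
  refine ⟨k, C, hC, fun p => ⟨?_, ?_⟩⟩
  · have := h 0 zero_le_one p
    rw [norm_iteratedFDeriv_zero] at this
    exact this.trans (h2 p)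
  · have := h 1 le_rfl p
    rw [← norm_iteratedFDeriv_fderiv, norm_iteratedFDeriv_zero] at this
    exact this.trans (h2 p)

theorem integrable_temperate_mul {f : Cfg d → ℂ} (hf : Function.HasTemperateGrowth f)
    (u : 𝓢(Cfg d, ℂ)) : Integrable (fun y => f y * u y) := by
  have := (SchwartzMap.smulLeftCLM ℂ f u).integrable (μ := volume)
  simpa [SchwartzMap.smulLeftCLM_apply hf] using this

theorem hasTemperateGrowth_slice {V W F : Type*} [NormedAddCommGroup V] [NormedSpace ℝ V]
    [NormedAddCommGroup W] [NormedSpace ℝ W] [NormedAddCommGroup F] [NormedSpace ℝ F] {f : V × W → F}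
    (hf : Function.HasTemperateGrowth f) (p : V) : Function.HasTemperateGrowth (fun y => f (p, y)) := by
  have h : Function.HasTemperateGrowth (fun y : W => ((p, 0) : V × W) +
      ContinuousLinearMap.inr ℝ V W y) :=
    (Function.HasTemperateGrowth.const _).add (ContinuousLinearMap.inr ℝ V W).hasTemperateGrowth
  have h2 := hf.comp h
  have h3 : (f ∘ fun y : W => ((p, 0) : V × W) + ContinuousLinearMap.inr ℝ V W y) =
      fun y => f (p, y) := by
    funext y
    simp
  rwa [h3] at h2

theorem hasTemperateGrowth_fderiv_apply {V F : Type*} [NormedAddCommGroup V] [NormedSpace ℝ V]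
    [NormedAddCommGroup F] [NormedSpace ℝ F] {f : V → F} (hf : Function.HasTemperateGrowth f) (v : V) :
    Function.HasTemperateGrowth (fun p => fderiv ℝ f p v) := by
  refine ⟨contDiff_dirDeriv' hf.1 v, fun n => ?_⟩
  obtain ⟨k, C, h⟩ := hf.2 (n + 1)
  refine ⟨k, ‖v‖ * C, fun p => ?_⟩
  refine (norm_iteratedFDeriv_clm_apply_const ((hf.1.fderiv_right (m := n)
    (by exact_mod_cast le_top)).contDiffAt) le_rfl).trans ?_
  rw [norm_iteratedFDeriv_fderiv, mul_assoc]
  exact mul_le_mul_of_nonneg_left (h p) (norm_nonneg _)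

/-- The integral of a Schwartz function against a kernel of temperate growth. -/
def kerInt (E : Phase d × Cfg d → ℂ) (u : 𝓢(Cfg d, ℂ)) (p : Phase d) : ℂ := ∫ y, E (p, y) * u y

/-- Differentiation under the integral: the kernel derivative grows polynomially in `y`, uniformly
for parameters in a unit ball, and the decay of `u` dominates it. -/
theorem hasFDerivAt_kerInt {E : Phase d × Cfg d → ℂ} (hE : Function.HasTemperateGrowth E)
    (u : 𝓢(Cfg d, ℂ)) (p : Phase d) : HasFDerivAt (kerInt E u) (∫ y, u y •
      (fderiv ℝ E (p, y)).comp (ContinuousLinearMap.inl ℝ (Phase d) (Cfg d))) p ∧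
      Integrable (fun y => u y •
        (fderiv ℝ E (p, y)).comp (ContinuousLinearMap.inl ℝ (Phase d) (Cfg d))) := by
  obtain ⟨k, C, hC, hb⟩ := exists_bound_of_temperate hE
  have hcont : Continuous fun q : Phase d × Cfg d =>
      (fderiv ℝ E q).comp (ContinuousLinearMap.inl ℝ (Phase d) (Cfg d)) :=
    ((hE.1.fderiv_right (m := ∞) (by simp)).clm_comp contDiff_const).continuous
  have hm : ∀ p, AEStronglyMeasurable (fun y => u y •
      (fderiv ℝ E (p, y)).comp (ContinuousLinearMap.inl ℝ (Phase d) (Cfg d))) :=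
    fun p => (u.continuous.smul (hcont.comp (by fun_prop))).aestronglyMeasurable
  have hbd : ∀ (x : Phase d) (y : Cfg d), ‖x‖ ≤ ‖p‖ + 1 → ‖u y •
      (fderiv ℝ E (x, y)).comp (ContinuousLinearMap.inl ℝ (Phase d) (Cfg d))‖ ≤
      C * (1 + (‖p‖ + 1)) ^ k * ((1 + ‖y‖) ^ k * ‖u y‖) := by
    intro x y hx
    have h1 : ‖(fderiv ℝ E (x, y)).comp (ContinuousLinearMap.inl ℝ (Phase d) (Cfg d))‖ ≤
        ‖fderiv ℝ E (x, y)‖ :=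
      (ContinuousLinearMap.opNorm_comp_le _ _).trans (mul_le_of_le_one_right (norm_nonneg _)
        (ContinuousLinearMap.norm_inl_le_one ℝ _ _))
    rw [norm_smul]
    calc _ ≤ ‖u y‖ * (C * ((1 + ‖x‖) ^ k * (1 + ‖y‖) ^ k)) := by
          gcongr
          exact h1.trans (hb (x, y)).2
      _ ≤ ‖u y‖ * (C * ((1 + (‖p‖ + 1)) ^ k * (1 + ‖y‖) ^ k)) := by gcongr
      _ = _ := by ring
  have hint := (integrable_weight_mul k u).const_mul (C * (1 + (‖p‖ + 1)) ^ k)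
  refine ⟨?_, hint.mono' (hm p) (Eventually.of_forall fun y => hbd p y (by linarith))⟩
  refine hasFDerivAt_integral_of_dominated_of_fderiv_le (Metric.ball_mem_nhds p one_pos)
    (bound := fun y => C * (1 + (‖p‖ + 1)) ^ k * ((1 + ‖y‖) ^ k * ‖u y‖))
    (Eventually.of_forall fun x => ?_) (integrable_temperate_mul (hasTemperateGrowth_slice hE p) u)
    (hm p) (Eventually.of_forall fun y x hx => hbd x y ?_) hint
    (Eventually.of_forall fun y x _ => ?_)
  · exact (integrable_temperate_mul (hasTemperateGrowth_slice hE x) u).aestronglyMeasurable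
  · have h4 : ‖x - p‖ < 1 := by rwa [← dist_eq_norm]
    have h5 := norm_add_le p (x - p)
    rw [add_sub_cancel] at h5
    linarith
  · have h1 : HasFDerivAt (fun x => E (x, y))
        ((fderiv ℝ E (x, y)).comp (ContinuousLinearMap.inl ℝ (Phase d) (Cfg d))) x :=
      (hE.1.diff_at _).hasFDerivAt.comp x (hasFDerivAt_prodMk_left x y)
    exact h1.mul_const (u y)

theorem pderiv_kerInt {E : Phase d × Cfg d → ℂ} (hE : Function.HasTemperateGrowth E)
    (u : 𝓢(Cfg d, ℂ)) (i : Fin d ⊕ Fin d) :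
    pderiv i (kerInt E u) = kerInt (fun q => fderiv ℝ E q (dir i, 0)) u := by
  funext p
  obtain ⟨h1, h2⟩ := hasFDerivAt_kerInt hE u p
  rw [pderiv, h1.fderiv, ContinuousLinearMap.integral_apply h2]
  refine integral_congr_ae (Eventually.of_forall fun y => ?_)
  simp [mul_comm]

theorem contDiff_kerInt {E : Phase d × Cfg d → ℂ} (hE : Function.HasTemperateGrowth E)
    (u : 𝓢(Cfg d, ℂ)) : ContDiff ℝ ∞ (kerInt E u) := by
  have key : ∀ L : List (Fin d ⊕ Fin d), ∃ E' : Phase d × Cfg d → ℂ,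
      Function.HasTemperateGrowth E' ∧ iterPderiv L (kerInt E u) = kerInt E' u := by
    intro L
    induction L with
    | nil => exact ⟨E, hE, rfl⟩
    | cons i L ih =>
      obtain ⟨E', hE', h⟩ := ih
      exact ⟨_, hasTemperateGrowth_fderiv_apply hE' (dir i, 0), by
        rw [iterPderiv, h, pderiv_kerInt hE']⟩
  refine contDiff_infty.2 fun n => contDiff_of_pderiv n fun L => ?_
  obtain ⟨E', hE', h⟩ := key L
  rw [h]
  exact fun p => (hasFDerivAt_kerInt hE' u p).1.differentiableAt

end KernelIntegrals

end

section

variable {d : ℕ}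

/-! ### The partial Fourier transform of `q(x, ·) u` and its decay. -/

section PartialTransform

open LineDeriv

/-- Multiplication of Schwartz functions by a coordinate. -/
def mulCoord (j : Fin d) : 𝓢(Cfg d, ℂ) →L[ℂ] 𝓢(Cfg d, ℂ) :=
  SchwartzMap.smulLeftCLM ℂ (fun y : Cfg d => ((y j : ℝ) : ℂ))

theorem hasTemperateGrowth_coord (j : Fin d) :
    Function.HasTemperateGrowth (fun y : Cfg d => ((y j : ℝ) : ℂ)) :=
  (Complex.ofRealCLM ∘L (EuclideanSpace.proj j : Cfg d →L[ℝ] ℝ)).hasTemperateGrowth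

theorem mulCoord_apply (j : Fin d) (u : 𝓢(Cfg d, ℂ)) (y : Cfg d) :
    mulCoord j u y = ((y j : ℝ) : ℂ) * u y := by
  simp [mulCoord, hasTemperateGrowth_coord]

/-- Partial derivatives of Schwartz functions. -/
def schDeriv (j : Fin d) : 𝓢(Cfg d, ℂ) →L[ℂ] 𝓢(Cfg d, ℂ) :=
  lineDerivOpCLM ℂ 𝓢(Cfg d, ℂ) (EuclideanSpace.single j (1 : ℝ))

theorem schDeriv_apply (j : Fin d) (u : 𝓢(Cfg d, ℂ)) (y : Cfg d) :
    schDeriv j u y = fderiv ℝ u y (EuclideanSpace.single j 1) := by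
  simp [schDeriv, SchwartzMap.lineDerivOp_apply_eq_fderiv]

/-- The kernel `e^{-i⟨y,η⟩} q(x,y)`. -/
def fourierKernel (q : Phase d → ℂ) (r : Phase d × Cfg d) : ℂ :=
  Complex.exp (Complex.I * ((-inner ℝ r.2 r.1.2 : ℝ) : ℂ)) * q (r.1.1, r.2)

theorem hasTemperateGrowth_phase : Function.HasTemperateGrowth (fun r : Phase d × Cfg d =>
    Complex.exp (Complex.I * ((-inner ℝ r.2 r.1.2 : ℝ) : ℂ))) := by
  have h1 : Function.HasTemperateGrowth (fun r : Phase d × Cfg d => r.2) :=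
    (ContinuousLinearMap.snd ℝ (Phase d) (Cfg d)).hasTemperateGrowth
  have h2 : Function.HasTemperateGrowth (fun r : Phase d × Cfg d => r.1.2) :=
    (ContinuousLinearMap.snd ℝ (Cfg d) (Cfg d) ∘L
      ContinuousLinearMap.fst ℝ (Phase d) (Cfg d)).hasTemperateGrowth
  have h3 : Function.HasTemperateGrowth (fun r : Phase d × Cfg d => -inner ℝ r.2 r.1.2) :=
    ((innerSL ℝ).bilinear_hasTemperateGrowth h1 h2).neg
  exact hasTemperateGrowth_cexp.comp h3

/-- The projection `((x, η), y) ↦ (x, y)`. -/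
def kerPos : Phase d × Cfg d →L[ℝ] Phase d :=
  (ContinuousLinearMap.fst ℝ (Cfg d) (Cfg d) ∘L ContinuousLinearMap.fst ℝ (Phase d) (Cfg d)).prod
    (ContinuousLinearMap.snd ℝ (Phase d) (Cfg d))

theorem hasTemperateGrowth_fourierKernel {q : Phase d → ℂ} (hq : Function.HasTemperateGrowth q) :
    Function.HasTemperateGrowth (fourierKernel q) :=
  hasTemperateGrowth_phase.mul (hq.comp kerPos.hasTemperateGrowth)

theorem dirDeriv_fourierKernel {q : Phase d → ℂ} (hq : ContDiff ℝ ∞ q) (v : Phase d × Cfg d)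
    (r : Phase d × Cfg d) : fderiv ℝ (fourierKernel q) r v =
      Complex.I * ((-(inner ℝ r.2 v.1.2 + inner ℝ v.2 r.1.2) : ℝ) : ℂ) * fourierKernel q r +
      Complex.exp (Complex.I * ((-inner ℝ r.2 r.1.2 : ℝ) : ℂ)) *
        fderiv ℝ q (r.1.1, r.2) (v.1.1, v.2) := by
  have h1 : HasFDerivAt (fun r : Phase d × Cfg d => q (r.1.1, r.2)) (fderiv ℝ q (r.1.1, r.2) ∘L kerPos)
      r := (hq.diff_at (r.1.1, r.2)).hasFDerivAt.comp r kerPos.hasFDerivAt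
  have h2 := (hasFDerivAt_snd (𝕜 := ℝ) (p := r)).inner ℝ
    ((hasFDerivAt_snd (𝕜 := ℝ) (p := r.1)).comp r (hasFDerivAt_fst (𝕜 := ℝ) (p := r)))
  have h3 := ((Complex.ofRealCLM.hasFDerivAt.comp r h2.neg).const_mul Complex.I).cexp.mul h1
  have h4 : fderiv ℝ (fourierKernel q) r = _ := h3.fderiv
  rw [h4]
  simp [fourierKernel, kerPos]
  ring

/-- The partial Fourier transform `∫ e^{-i⟨y,η⟩} q(x,y) u(y) dy`. -/
def qHat (q : Phase d → ℂ) (u : 𝓢(Cfg d, ℂ)) (p : Phase d) : ℂ := kerInt (fourierKernel q) u p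

variable {q : Phase d → ℂ}

theorem contDiff_qHat (hq : Function.HasTemperateGrowth q) (u : 𝓢(Cfg d, ℂ)) :
    ContDiff ℝ ∞ (qHat q u) :=
  contDiff_kerInt (hasTemperateGrowth_fourierKernel hq) u

theorem hasTemperateGrowth_pderiv (hq : Function.HasTemperateGrowth q) (i : Fin d ⊕ Fin d) :
    Function.HasTemperateGrowth (pderiv i q) :=
  hasTemperateGrowth_fderiv_apply hq (dir i)

theorem pderiv_qHat_inl (hq : Function.HasTemperateGrowth q) (u : 𝓢(Cfg d, ℂ)) (j : Fin d) :
    pderiv (Sum.inl j) (qHat q u) = qHat (pderiv (Sum.inl j) q) u := by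
  unfold qHat
  rw [show (fun p => kerInt (fourierKernel q) u p) = kerInt (fourierKernel q) u from rfl,
    pderiv_kerInt (hasTemperateGrowth_fourierKernel hq)]
  congr 1
  funext r
  rw [dirDeriv_fourierKernel hq.1]
  simp [dir, fourierKernel, pderiv]

theorem pderiv_qHat_inr (hq : Function.HasTemperateGrowth q) (u : 𝓢(Cfg d, ℂ)) (j : Fin d) :
    pderiv (Sum.inr j) (qHat q u) = fun p => -Complex.I * qHat q (mulCoord j u) p := by
  unfold qHat
  rw [show (fun p => kerInt (fourierKernel q) u p) = kerInt (fourierKernel q) u from rfl,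
    pderiv_kerInt (hasTemperateGrowth_fourierKernel hq)]
  funext p
  rw [kerInt, kerInt, ← integral_const_mul]
  refine integral_congr_ae (Eventually.of_forall fun y => ?_)
  have hz : fderiv ℝ q (p.1, y) ((0 : Cfg d), (0 : Cfg d)) = 0 := map_zero _
  simp only [dirDeriv_fourierKernel hq.1, mulCoord_apply]
  simp [dir, EuclideanSpace.inner_single_right, hz]
  ring

/-- Since `η_j e^{-i⟨y,η⟩} = i ∂_{y_j} e^{-i⟨y,η⟩}`, integration by parts in `y` moves the
derivative onto `q(x,·) u`. -/
theorem coord_mul_qHat (hq : Function.HasTemperateGrowth q) (u : 𝓢(Cfg d, ℂ)) (j : Fin d)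
    (p : Phase d) : ((p.2 j : ℝ) : ℂ) * qHat q u p =
      -Complex.I * (qHat (pderiv (Sum.inr j) q) u p + qHat q (schDeriv j u) p) := by
  set e : Cfg d → ℂ := fun y => Complex.exp (Complex.I * ((-inner ℝ y p.2 : ℝ) : ℂ)) with he
  have hqs := hasTemperateGrowth_slice hq p.1
  have hqd := hasTemperateGrowth_slice (hasTemperateGrowth_pderiv hq (Sum.inr j)) p.1
  have het : Function.HasTemperateGrowth e := hasTemperateGrowth_slice hasTemperateGrowth_phase p
  have hed : ∀ y v, fderiv ℝ e y v = Complex.I * ((-inner ℝ v p.2 : ℝ) : ℂ) * e y := by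
    intro y v
    have h2 := (hasFDerivAt_id (𝕜 := ℝ) y).inner ℝ (hasFDerivAt_const p.2 y)
    have h3 : fderiv ℝ e y = _ :=
      ((Complex.ofRealCLM.hasFDerivAt.comp y h2.neg).const_mul Complex.I).cexp.fderiv
    rw [h3]
    simp [he]
    ring
  have hgd : ∀ y, fderiv ℝ (fun y => q (p.1, y) * u y) y (EuclideanSpace.single j 1) =
      pderiv (Sum.inr j) q (p.1, y) * u y + q (p.1, y) * schDeriv j u y := by
    intro y
    have h1 : HasFDerivAt (fun y => q (p.1, y))
        ((fderiv ℝ q (p.1, y)).comp (ContinuousLinearMap.inr ℝ (Cfg d) (Cfg d))) y :=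
      (hq.1.diff_at _).hasFDerivAt.comp y (hasFDerivAt_prodMk_right p.1 y)
    have h2 : fderiv ℝ (fun y => q (p.1, y) * u y) y = _ :=
      (h1.mul u.differentiableAt.hasFDerivAt).fderiv
    rw [h2, schDeriv_apply]
    simp [pderiv, dir]
    ring
  have i0 : ∀ {q : Phase d → ℂ} (u : 𝓢(Cfg d, ℂ)), Function.HasTemperateGrowth q →
      Integrable (fun y => fourierKernel q (p, y) * u y) := fun u hq =>
    integrable_temperate_mul (hasTemperateGrowth_slice (hasTemperateGrowth_fourierKernel hq) p) u
  have i1 := i0 u hq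
  have i2 := i0 u (hasTemperateGrowth_pderiv hq (Sum.inr j))
  have i3 := i0 (schDeriv j u) hq
  have key := integral_mul_fderiv_eq_neg_fderiv_mul_of_integrable (μ := volume) (f := e)
    (g := fun y => q (p.1, y) * u y) (v := EuclideanSpace.single j (1 : ℝ)) ?_ ?_ ?_
    (fun y _ => het.1.diff_at y) (fun y _ => (hqs.1.diff_at y).mul u.differentiableAt)
  · simp only [hgd, hed] at key
    have e1 : ∫ y, e y * (pderiv (Sum.inr j) q (p.1, y) * u y + q (p.1, y) * schDeriv j u y) =
        qHat (pderiv (Sum.inr j) q) u p + qHat q (schDeriv j u) p := by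
      rw [qHat, qHat, kerInt, kerInt, ← integral_add i2 i3]
      refine integral_congr_ae (Eventually.of_forall fun y => ?_)
      simp only [fourierKernel, he]
      ring
    have e2 : ∫ y, Complex.I * ((-inner ℝ (EuclideanSpace.single j (1 : ℝ)) p.2 : ℝ) : ℂ) * e y *
        (q (p.1, y) * u y) = -Complex.I * ((p.2 j : ℝ) : ℂ) * qHat q u p := by
      rw [qHat, kerInt, ← integral_const_mul]
      refine integral_congr_ae (Eventually.of_forall fun y => ?_)
      simp only [fourierKernel, he]
      simp [EuclideanSpace.inner_single_left]
      ring
    rw [e1, e2] at key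
    rw [key]
    ring_nf
    simp
  · simp only [hed]
    refine (i1.const_mul (Complex.I * ((-inner ℝ (EuclideanSpace.single j (1 : ℝ)) p.2 : ℝ) : ℂ))).congr
      (Eventually.of_forall fun y => ?_)
    simp only [fourierKernel, he]
    ring
  · simp only [hgd]
    refine (i2.add i3).congr (Eventually.of_forall fun y => ?_)
    simp only [fourierKernel, Pi.add_apply, he]
    ring
  · refine i1.congr (Eventually.of_forall fun y => ?_)
    simp only [fourierKernel, he]
    ring

theorem norm_fourierKernel (p : Phase d) (y : Cfg d) : ‖fourierKernel q (p, y)‖ = ‖q (p.1, y)‖ := by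
  rw [fourierKernel, norm_mul, Complex.norm_exp]
  simp

theorem one_add_norm_le_sum (v : Cfg d) : 1 + ‖v‖ ≤ 1 + ∑ j, ‖v j‖ := by
  have h : v = ∑ j, v j • EuclideanSpace.single j (1 : ℝ) := by
    ext i
    simp [Pi.single_apply]
  have h2 : ‖v‖ ≤ ∑ j, ‖v j‖ := by
    conv_lhs => rw [h]
    refine (norm_sum_le _ _).trans (Finset.sum_le_sum fun j _ => ?_)
    rw [norm_smul]
    simp
  linarith

theorem SBound.weaken_pow {X : Type*} {φ : X → 𝓢(Cfg d, ℂ) → ℝ} {x : X → Cfg d} {k l : ℕ}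
    (hφ : ∀ p u, 0 ≤ φ p u) (hkl : k ≤ l)
    (h : SBound (fun p u => φ p u * ((1 + ‖x p‖) ^ k)⁻¹)) :
    SBound (fun p u => φ p u * ((1 + ‖x p‖) ^ l)⁻¹) := by
  refine h.mono fun p u => mul_le_mul_of_nonneg_left ?_ (hφ p u)
  gcongr
  simp

/-- Rapid decay of the partial Fourier transform in the momentum variable. -/
theorem exists_sBound_qHat (N : ℕ) (hq : Function.HasTemperateGrowth q) :
    ∃ k : ℕ, SBound (fun (p : Phase d) u =>
      ((1 + ‖p.2‖) ^ N * ‖qHat q u p‖) * ((1 + ‖p.1‖) ^ k)⁻¹) := by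
  induction N generalizing q with
  | zero =>
    obtain ⟨k, C, hC, hb⟩ := exists_bound_of_temperate hq
    refine ⟨k, (((sBound_weight_integral k).const_mul hC).reindex fun _ => ()).mono fun p u => ?_⟩
    have h1 : ‖qHat q u p‖ ≤ ∫ y, C * (1 + ‖p.1‖) ^ k * ((1 + ‖y‖) ^ k * ‖u y‖) := by
      refine norm_integral_le_of_norm_le ((integrable_weight_mul k u).const_mul _)
        (Eventually.of_forall fun y => ?_)
      rw [norm_mul, norm_fourierKernel]
      refine (mul_le_mul_of_nonneg_right (hb (p.1, y)).1 (norm_nonneg _)).trans_eq ?_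
      ring
    rw [integral_const_mul] at h1
    rw [pow_zero, one_mul, mul_inv_le_iff₀ (by positivity)]
    exact h1.trans_eq (by ring)
  | succ N ih =>
    obtain ⟨k0, h0⟩ := ih hq
    choose k1 h1 using fun j : Fin d => ih (hasTemperateGrowth_pderiv hq (Sum.inr j))
    have hk1 : ∀ j, k1 j ≤ ∑ j, k1 j := fun j =>
      Finset.single_le_sum (f := k1) (fun _ _ => Nat.zero_le _) (Finset.mem_univ j)
    have hn : ∀ {q : Phase d → ℂ} (p : Phase d) (u : 𝓢(Cfg d, ℂ)),
      0 ≤ (1 + ‖p.2‖) ^ N * ‖qHat q u p‖ := fun p u => by positivity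
    -- One exponent serving all terms: that of `q` and those of its finitely many derivatives.
    refine ⟨k0 + ∑ j, k1 j, ((SBound.weaken_pow hn (Nat.le_add_right _ (∑ j, k1 j)) h0).add
      (SBound.sum Finset.univ fun j _ =>
        (SBound.weaken_pow hn ((hk1 j).trans (Nat.le_add_left _ k0)) (h1 j)).add
        ((SBound.weaken_pow hn (Nat.le_add_right _ (∑ j, k1 j)) h0).comp (schDeriv j)))).mono
      fun p u => ?_⟩
    have key : (1 + ‖p.2‖) * ‖qHat q u p‖ ≤ ‖qHat q u p‖ + ∑ j,
        (‖qHat (pderiv (Sum.inr j) q) u p‖ + ‖qHat q (schDeriv j u) p‖) := by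
      refine (mul_le_mul_of_nonneg_right (one_add_norm_le_sum p.2) (norm_nonneg _)).trans ?_
      rw [add_mul, one_mul, Finset.sum_mul]
      refine add_le_add le_rfl (Finset.sum_le_sum fun j _ => ?_)
      have := congrArg norm (coord_mul_qHat hq u j p)
      rw [norm_mul, Complex.norm_real, norm_mul, norm_neg, Complex.norm_I, one_mul] at this
      rw [this]
      exact norm_add_le _ _
    have h2 : 0 ≤ ((1 + ‖p.1‖) ^ (k0 + ∑ j, k1 j))⁻¹ := by positivity
    calc _ = (1 + ‖p.2‖) ^ N * ((1 + ‖p.2‖) * ‖qHat q u p‖) *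
          ((1 + ‖p.1‖) ^ (k0 + ∑ j, k1 j))⁻¹ := by ring
      _ ≤ (1 + ‖p.2‖) ^ N * (‖qHat q u p‖ + ∑ j,
        (‖qHat (pderiv (Sum.inr j) q) u p‖ + ‖qHat q (schDeriv j u) p‖)) *
          ((1 + ‖p.1‖) ^ (k0 + ∑ j, k1 j))⁻¹ := by gcongr
      _ = _ := by
        simp only [mul_add, add_mul, Finset.mul_sum, Finset.sum_mul, Finset.sum_add_distrib]

end PartialTransform

end

section

variable {d : ℕ}

/-! ### Fourier integrals map Schwartz functions to Schwartz functions. -/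

section FourierIntegral

variable {U : Phase d → ℝ} {q : Phase d → ℂ} {a : Phase d → ℂ} {m : ℝ}

/-- The integrand `e^{iU(x,η)} a(x,η) q̂u(x,η)` of a Fourier integral operator. -/
def fioIntegrand (U : Phase d → ℝ) (q a : Phase d → ℂ) (u : 𝓢(Cfg d, ℂ)) (p : Phase d) : ℂ :=
  Complex.exp (Complex.I * (U p : ℂ)) * (a p * qHat q u p)

theorem contDiff_cexp_phase (hU : ContDiff ℝ ∞ U) :
    ContDiff ℝ ∞ (fun p => Complex.exp (Complex.I * (U p : ℂ))) :=
  Complex.contDiff_exp.comp (contDiff_const.mul (Complex.ofRealCLM.contDiff.comp hU))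

theorem contDiff_fioIntegrand (hU : ContDiff ℝ ∞ U) (hq : Function.HasTemperateGrowth q)
    (ha : ContDiff ℝ ∞ a) (u : 𝓢(Cfg d, ℂ)) : ContDiff ℝ ∞ (fioIntegrand U q a u) :=
  (contDiff_cexp_phase hU).mul (ha.mul (contDiff_qHat hq u))

theorem pderiv_fioIntegrand (hU : ContDiff ℝ ∞ U) (hq : Function.HasTemperateGrowth q)
    (ha : ContDiff ℝ ∞ a) (u : 𝓢(Cfg d, ℂ)) (i : Fin d ⊕ Fin d) (p : Phase d) :
    pderiv i (fioIntegrand U q a u) p = Complex.exp (Complex.I * (U p : ℂ)) *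
      ((pderiv i a p + Complex.I * ((pderiv i U p : ℝ) : ℂ) * a p) * qHat q u p +
        a p * pderiv i (qHat q u) p) := by
  have hUc : ContDiff ℝ ∞ (fun p => (U p : ℂ)) := Complex.ofRealCLM.contDiff.comp hU
  have hI : ContDiff ℝ ∞ (fun p => Complex.I * (U p : ℂ)) := contDiff_const.mul hUc
  have h1 : pderiv i (fioIntegrand U q a u) = dirDeriv (dir i) (fun p =>
      Complex.exp (Complex.I * (U p : ℂ)) * (a p * qHat q u p)) := rfl
  have h2 : dirDeriv (dir i) (fun p => (U p : ℂ)) = fun p => ((pderiv i U p : ℝ) : ℂ) := pderiv_ofReal hU i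
  have h3 : dirDeriv (dir i) a = pderiv i a := rfl
  have h4 : dirDeriv (dir i) (qHat q u) = pderiv i (qHat q u) := rfl
  rw [h1, dirDeriv_mul (contDiff_cexp_phase hU) (ha.mul (contDiff_qHat hq u)),
    dirDeriv_mul ha (contDiff_qHat hq u), dirDeriv_cexp hI, dirDeriv_const_mul hUc, h2, h3, h4]
  ring

theorem pderiv_eq_add (hU : ContDiff ℝ ∞ U) (i : Fin d ⊕ Fin d) (p : Phase d) : pderiv i U p =
    Sum.elim (fun j => p.2 j) (fun j => p.1 j) i + pderiv i (nonlinearPart U) p := by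
  have h1 : HasFDerivAt (fun p : Phase d => (inner ℝ p.1 p.2 : ℝ)) _ p :=
    (hasFDerivAt_fst (𝕜 := ℝ) (p := p)).inner ℝ (hasFDerivAt_snd (𝕜 := ℝ) (p := p))
  have h2 : HasFDerivAt (nonlinearPart U) _ p := (hU.diff_at p).hasFDerivAt.sub h1
  rw [pderiv, pderiv, h2.fderiv]
  rcases i with j | j
  · simp [dir, EuclideanSpace.inner_single_left]
  · simp [dir, EuclideanSpace.inner_single_right]

/-- The symbol of an `x`-derivative of a Fourier integral operator. -/
def symX (U : Phase d → ℝ) (a : Phase d → ℂ) (j : Fin d) (p : Phase d) : ℂ :=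
  pderiv (Sum.inl j) a p + Complex.I * ((pderiv (Sum.inl j) U p : ℝ) : ℂ) * a p

/-- The symbol that arises from integration by parts in the momentum variable. -/
def symXi (U : Phase d → ℝ) (a : Phase d → ℂ) (j : Fin d) (p : Phase d) : ℂ :=
  pderiv (Sum.inr j) a p + Complex.I * ((pderiv (Sum.inr j) (nonlinearPart U) p : ℝ) : ℂ) * a p

/-- The order rises by one, since `∂_x U = η + ∂_x 𝖽` has order one. -/
theorem isSymbol_symX (hU : ContDiff ℝ ∞ U) (hP : IsSPlus (nonlinearPart U)) (ha : IsSymbol m a)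
    (j : Fin d) : IsSymbol (m + 1) (symX U a j) := by
  have h1 := (ha.pderiv (Sum.inl j)).mono (m' := m + 1) (by simp [ord])
  have h2 := (((IsSymbol.coord j).add (hP.deriv_x j).ofReal).const_mul Complex.I).mul ha
  rw [add_comm 1 m] at h2
  have h3 := h1.add h2
  have h4 : symX U a j = fun p => pderiv (Sum.inl j) a p + Complex.I * (((p.2 j : ℝ) : ℂ) +
      ((pderiv (Sum.inl j) (nonlinearPart U) p : ℝ) : ℂ)) * a p := by
    funext p
    rw [symX, pderiv_eq_add hU]
    simp
  rw [h4]
  exact h3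

/-- The order does not rise, because `∂_ξ 𝖽` has order zero. This is what makes the integration by
parts in `η` repeatable without loss. -/
theorem isSymbol_symXi (hP : IsSPlus (nonlinearPart U)) (ha : IsSymbol m a) (j : Fin d) :
    IsSymbol m (symXi U a j) := by
  have h1 := (ha.pderiv (Sum.inr j)).mono (m' := m) (by simp [ord])
  have h2 := ((hP.deriv_xi j).ofReal.const_mul Complex.I).mul ha
  rw [zero_add] at h2
  exact h1.add h2

theorem pderiv_fioIntegrand_inl (hU : ContDiff ℝ ∞ U) (hq : Function.HasTemperateGrowth q)
    (ha : ContDiff ℝ ∞ a) (u : 𝓢(Cfg d, ℂ)) (j : Fin d) (p : Phase d) :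
    pderiv (Sum.inl j) (fioIntegrand U q a u) p =
      fioIntegrand U (pderiv (Sum.inl j) q) a u p + fioIntegrand U q (symX U a j) u p := by
  rw [pderiv_fioIntegrand hU hq ha, pderiv_qHat_inl hq, fioIntegrand, fioIntegrand, symX]
  ring

theorem pderiv_fioIntegrand_inr (hU : ContDiff ℝ ∞ U) (hq : Function.HasTemperateGrowth q)
    (ha : ContDiff ℝ ∞ a) (u : 𝓢(Cfg d, ℂ)) (j : Fin d) (p : Phase d) :
    pderiv (Sum.inr j) (fioIntegrand U q a u) p =
      Complex.I * ((p.1 j : ℝ) : ℂ) * fioIntegrand U q a u p +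
        fioIntegrand U q (symXi U a j) u p - Complex.I * fioIntegrand U q a (mulCoord j u) p := by
  rw [pderiv_fioIntegrand hU hq ha, pderiv_qHat_inr hq, pderiv_eq_add hU, fioIntegrand,
    fioIntegrand, fioIntegrand, symXi]
  push_cast
  simp only [Sum.elim_inr]
  ring

theorem bracket_rpow_le (m : ℝ) (ξ : Cfg d) : bracket ξ ^ m ≤ (1 + ‖ξ‖) ^ ⌈|m|⌉₊ :=
  calc bracket ξ ^ m ≤ bracket ξ ^ (⌈|m|⌉₊ : ℝ) :=
        Real.rpow_le_rpow_of_exponent_le (one_le_bracket _) ((le_abs_self m).trans (Nat.le_ceil _))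
    _ = bracket ξ ^ ⌈|m|⌉₊ := Real.rpow_natCast _ _
    _ ≤ _ := pow_le_pow_left₀ (bracket_pos _).le (bracket_le_one_add_norm _) _

theorem IsSymbol.norm_le_pow (ha : IsSymbol m a) :
    ∃ C, 0 ≤ C ∧ ∀ p, ‖a p‖ ≤ C * (1 + ‖p.2‖) ^ ⌈|m|⌉₊ := by
  obtain ⟨C, hC, h⟩ := ha.norm_le
  exact ⟨C, hC, fun p => (h p).trans (mul_le_mul_of_nonneg_left (bracket_rpow_le m p.2) hC)⟩

theorem norm_fioIntegrand (u : 𝓢(Cfg d, ℂ)) (p : Phase d) :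
    ‖fioIntegrand U q a u p‖ = ‖a p‖ * ‖qHat q u p‖ := by
  rw [fioIntegrand, norm_mul, Complex.norm_exp, norm_mul]
  simp

/-- The polynomial loss `k` in the position variable does not depend on the symbol. -/
theorem exists_bound_fioIntegrand (hq : Function.HasTemperateGrowth q) (m : ℝ) :
    ∃ k : ℕ, ∀ a : Phase d → ℂ, IsSymbol m a → ∃ s : Seminorm ℂ 𝓢(Cfg d, ℂ), Continuous s ∧
      ∀ (U : Phase d → ℝ) u p, ‖fioIntegrand U q a u p‖ ≤
        s u * (1 + ‖p.1‖) ^ k * (1 + ‖p.2‖) ^ (-((d + 1 : ℕ) : ℝ)) := by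
  obtain ⟨k, hk⟩ := exists_sBound_qHat (⌈|m|⌉₊ + (d + 1)) hq
  refine ⟨k, fun a ha => ?_⟩
  obtain ⟨C, hC, hb⟩ := ha.norm_le_pow
  obtain ⟨s, hs, h⟩ := hk.const_mul hC
  refine ⟨s, hs, fun U u p => ?_⟩
  have h1 : C * ((1 + ‖p.2‖) ^ (⌈|m|⌉₊ + (d + 1)) * ‖qHat q u p‖ * ((1 + ‖p.1‖) ^ k)⁻¹) ≤ s u := h p u
  have h0 : (0 : ℝ) < 1 + ‖p.2‖ := by positivity
  rw [← mul_assoc, mul_inv_le_iff₀ (by positivity), pow_add] at h1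
  rw [norm_fioIntegrand, Real.rpow_neg h0.le, Real.rpow_natCast, ← div_eq_mul_inv,
    le_div_iff₀ (pow_pos h0 _)]
  refine le_trans ?_ h1
  calc _ ≤ C * (1 + ‖p.2‖) ^ ⌈|m|⌉₊ * ‖qHat q u p‖ * (1 + ‖p.2‖) ^ (d + 1) := by
        gcongr
        exact hb p
    _ = _ := by ring

theorem integrable_fioIntegrand (hU : ContDiff ℝ ∞ U) (hq : Function.HasTemperateGrowth q)
    (ha : IsSymbol m a) (u : 𝓢(Cfg d, ℂ)) (x : Cfg d) :
    Integrable (fun η => fioIntegrand U q a u (x, η)) := by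
  obtain ⟨k, hk⟩ := exists_bound_fioIntegrand hq m
  obtain ⟨s, -, hs⟩ := hk a ha
  exact (integrable_decay.const_mul (s u * (1 + ‖x‖) ^ k)).mono'
    ((contDiff_fioIntegrand hU hq ha.smooth u).continuous.comp (by fun_prop)).aestronglyMeasurable
    (Eventually.of_forall fun η => hs U u (x, η))

/-- The Fourier integral `∫ e^{iU(x,η)} a(x,η) q̂u(x,η) dη`. -/
def fioInt (U : Phase d → ℝ) (q a : Phase d → ℂ) (u : 𝓢(Cfg d, ℂ)) (x : Cfg d) : ℂ :=
  ∫ η, fioIntegrand U q a u (x, η)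

/-- The factor `x_j` is produced by `∂_{η_j} U = x_j + ∂_{η_j} 𝖽`. The integral of the
`η_j`-derivative of the integrand vanishes, and solving for the term with `x_j` gives the identity.
-/
theorem coord_mul_fioInt (hU : ContDiff ℝ ∞ U) (hP : IsSPlus (nonlinearPart U))
    (hq : Function.HasTemperateGrowth q) (ha : IsSymbol m a) (u : 𝓢(Cfg d, ℂ)) (j : Fin d)
    (x : Cfg d) : ((x j : ℝ) : ℂ) * fioInt U q a u x =
      Complex.I * fioInt U q (symXi U a j) u x + fioInt U q a (mulCoord j u) x := by
  have i1 := integrable_fioIntegrand hU hq ha u x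
  have i2 := integrable_fioIntegrand hU hq (isSymbol_symXi hP ha j) u x
  have i3 := integrable_fioIntegrand hU hq ha (mulCoord j u) x
  have hF := contDiff_fioIntegrand hU hq ha.smooth u
  have hd : ∀ η, HasFDerivAt (fun η => fioIntegrand U q a u (x, η))
      ((fderiv ℝ (fioIntegrand U q a u) (x, η)).comp (ContinuousLinearMap.inr ℝ (Cfg d) (Cfg d))) η :=
    fun η => (hF.diff_at _).hasFDerivAt.comp η (hasFDerivAt_prodMk_right x η)
  have hd2 : ∀ η, fderiv ℝ (fun η => fioIntegrand U q a u (x, η)) η (EuclideanSpace.single j 1) =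
      Complex.I * ((x j : ℝ) : ℂ) * fioIntegrand U q a u (x, η) +
        fioIntegrand U q (symXi U a j) u (x, η) -
        Complex.I * fioIntegrand U q a (mulCoord j u) (x, η) := fun η => by
    rw [(hd η).fderiv]
    have h := pderiv_fioIntegrand_inr hU hq ha.smooth u j (x, η)
    exact h
  have i4 : Integrable (fun η =>
      fderiv ℝ (fun η => fioIntegrand U q a u (x, η)) η (EuclideanSpace.single j 1)) := by
    simp only [hd2]
    exact ((i1.const_mul _).add i2).sub (i3.const_mul _)
  have key := integral_mul_fderiv_eq_neg_fderiv_mul_of_integrable (μ := volume)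
    (f := fun _ : Cfg d => (1 : ℂ)) (g := fun η => fioIntegrand U q a u (x, η))
    (v := EuclideanSpace.single j (1 : ℝ)) (by simp) (by simpa using i4) (by simpa using i1)
    (fun _ _ => differentiableAt_const _) (fun η _ => (hd η).differentiableAt)
  simp only [one_mul, fderiv_fun_const, Pi.zero_apply, zero_apply, zero_mul, integral_zero,
    neg_zero, hd2] at key
  have i5 := i1.const_mul (Complex.I * ((x j : ℝ) : ℂ))
  have i6 : Integrable (fun η => Complex.I * ((x j : ℝ) : ℂ) * fioIntegrand U q a u (x, η) +
      fioIntegrand U q (symXi U a j) u (x, η)) := i5.add i2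
  rw [integral_sub i6 (i3.const_mul _), integral_add i5 i2, integral_const_mul,
    integral_const_mul] at key
  rw [fioInt, fioInt, fioInt]
  linear_combination (-Complex.I) * key + (((x j : ℝ) : ℂ) * ∫ η, fioIntegrand U q a u (x, η)) *
    Complex.I_sq - (∫ η, fioIntegrand U q a (mulCoord j u) (x, η)) * Complex.I_sq

theorem hasFDerivAt_fioInt (hU : ContDiff ℝ ∞ U) (hP : IsSPlus (nonlinearPart U))
    (hq : Function.HasTemperateGrowth q) (ha : IsSymbol m a) (u : 𝓢(Cfg d, ℂ)) (x : Cfg d) :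
    HasFDerivAt (fioInt U q a u) (∑ j, (EuclideanSpace.proj j : Cfg d →L[ℝ] ℝ).smulRight
      (fioInt U (pderiv (Sum.inl j) q) a u x + fioInt U q (symX U a j) u x)) x := by
  have hF := contDiff_fioIntegrand hU hq ha.smooth u
  let D : Cfg d → Cfg d → Cfg d →L[ℝ] ℂ := fun x η =>
    ∑ j, (EuclideanSpace.proj j : Cfg d →L[ℝ] ℝ).smulRight
      (fioIntegrand U (pderiv (Sum.inl j) q) a u (x, η) + fioIntegrand U q (symX U a j) u (x, η))
  have hD : ∀ x η, HasFDerivAt (fun x => fioIntegrand U q a u (x, η)) (D x η) x := by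
    intro x η
    have h1 : HasFDerivAt (fun x => fioIntegrand U q a u (x, η)) ((fderiv ℝ (fioIntegrand U q a u)
        (x, η)).comp (ContinuousLinearMap.inl ℝ (Cfg d) (Cfg d))) x :=
      (hF.diff_at _).hasFDerivAt.comp x (hasFDerivAt_prodMk_left x η)
    refine h1.congr_fderiv (ContinuousLinearMap.ext fun v => ?_)
    have h2 : ContinuousLinearMap.inl ℝ (Cfg d) (Cfg d) v = ∑ j, v j • dir (Sum.inl j) := by
      conv_lhs => rw [← sum_coord_smul_dir (ContinuousLinearMap.inl ℝ (Cfg d) (Cfg d) v)]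
      rw [Fintype.sum_sum_type]
      simp [coord_inl, coord_inr]
    rw [ContinuousLinearMap.comp_apply, h2, map_sum, sum_apply]
    refine Finset.sum_congr rfl fun j _ => ?_
    have h3 := pderiv_fioIntegrand_inl hU hq ha.smooth u j (x, η)
    rw [map_smul, ContinuousLinearMap.smulRight_apply, ← h3]
    rfl
  have hqd := fun j => hasTemperateGrowth_pderiv hq (Sum.inl j)
  have haX := fun j => isSymbol_symX hU hP ha j
  have i1 := fun j => integrable_fioIntegrand hU (hqd j) ha u x
  have i2 := fun j => integrable_fioIntegrand hU hq (haX j) u x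
  choose k1 hk1 using fun j => exists_bound_fioIntegrand (hqd j) m
  choose s1 _ hs1 using fun j => hk1 j a ha
  obtain ⟨k2, hk2⟩ := exists_bound_fioIntegrand hq (m + 1)
  choose s2 _ hs2 using fun j => hk2 _ (haX j)
  let P := fun j : Fin d => ContinuousLinearMap.smulRightL ℝ (Cfg d) ℂ (EuclideanSpace.proj j)
  have hDc : ∀ x, Continuous (D x) := by
    intro x
    refine continuous_finsetSum _ fun j _ => (P j).continuous.comp ?_
    exact (((contDiff_fioIntegrand hU (hqd j) ha.smooth u).continuous.comp (by fun_prop)).add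
      ((contDiff_fioIntegrand hU hq (haX j).smooth u).continuous.comp (by fun_prop)))
  have hint : ∀ j, Integrable (fun η => fioIntegrand U (pderiv (Sum.inl j) q) a u (x, η) +
      fioIntegrand U q (symX U a j) u (x, η)) := fun j => (i1 j).add (i2 j)
  have hDi : (∫ η, D x η) = ∑ j, (EuclideanSpace.proj j : Cfg d →L[ℝ] ℝ).smulRight
      (fioInt U (pderiv (Sum.inl j) q) a u x + fioInt U q (symX U a j) u x) := by
    refine (integral_finsetSum _ fun j _ => (P j).integrable_comp (hint j)).trans ?_
    refine Finset.sum_congr rfl fun j _ => ?_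
    refine ((P j).integral_comp_comm (hint j)).trans ?_
    rw [fioInt, fioInt, ← integral_add (i1 j) (i2 j)]
    rfl
  rw [← hDi]
  refine hasFDerivAt_integral_of_dominated_of_fderiv_le (Metric.ball_mem_nhds x one_pos)
    (bound := fun η => ∑ j, ‖P j‖ * (s1 j u * (1 + (‖x‖ + 1)) ^ k1 j *
      (1 + ‖η‖) ^ (-((d + 1 : ℕ) : ℝ)) + s2 j u * (1 + (‖x‖ + 1)) ^ k2 *
      (1 + ‖η‖) ^ (-((d + 1 : ℕ) : ℝ))))
    (Eventually.of_forall fun y => (integrable_fioIntegrand hU hq ha u y).aestronglyMeasurable)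
    (integrable_fioIntegrand hU hq ha u x) (hDc x).aestronglyMeasurable
    (Eventually.of_forall fun η y hy => ?_)
    (integrable_finsetSum _ fun j _ => ((integrable_decay.const_mul _).add
      (integrable_decay.const_mul _)).const_mul _)
    (Eventually.of_forall fun η y _ => hD y η)
  have hy2 : ‖y‖ ≤ ‖x‖ + 1 := by
    have h4 : ‖y - x‖ < 1 := by rwa [← dist_eq_norm]
    have h5 := norm_add_le x (y - x)
    rw [add_sub_cancel] at h5
    linarith
  refine (norm_sum_le _ _).trans (Finset.sum_le_sum fun j _ => ?_)
  refine ((P j).le_opNorm _).trans (mul_le_mul_of_nonneg_left ?_ (norm_nonneg _))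
  refine (norm_add_le _ _).trans (add_le_add ?_ ?_)
  · refine (hs1 j U u (y, η)).trans ?_
    have := apply_nonneg (s1 j) u
    dsimp only
    gcongr
  · refine (hs2 j U u (y, η)).trans ?_
    have := apply_nonneg (s2 j) u
    dsimp only
    gcongr

/-- Fourier integrals map Schwartz functions to rapidly decaying functions. -/
theorem sBound_fioInt (hU : ContDiff ℝ ∞ U) (hP : IsSPlus (nonlinearPart U))
    (hq : Function.HasTemperateGrowth q) (ha : IsSymbol m a) (N : ℕ) :
    SBound (fun x u => (1 + ‖x‖) ^ N * ‖fioInt U q a u x‖) := by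
  obtain ⟨k, hk⟩ := exists_bound_fioIntegrand hq m
  -- The loss `(1+|x|)^k` is common to all symbols of order `m`, so it stays fixed while `a` is
  -- replaced by `symXi U a j` in the induction.
  have key : ∀ (N : ℕ) {a : Phase d → ℂ}, IsSymbol m a →
      SBound (fun x u => (1 + ‖x‖) ^ N * ‖fioInt U q a u x‖ * ((1 + ‖x‖) ^ k)⁻¹) := by
    intro N
    induction N with
    | zero =>
      intro a ha
      obtain ⟨s, hs, h⟩ := hk a ha
      have hI : 0 ≤ ∫ y : Cfg d, (1 + ‖y‖) ^ (-((d + 1 : ℕ) : ℝ)) :=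
        integral_nonneg fun y => by positivity
      refine SBound.mono (φ := fun _ u => (∫ y : Cfg d, (1 + ‖y‖) ^ (-((d + 1 : ℕ) : ℝ))) * s u)
        (SBound.const_mul ⟨s, hs, fun _ _ => le_rfl⟩ hI) fun x u => ?_
      have h1 := norm_integral_le_of_norm_le (integrable_decay.const_mul (s u * (1 + ‖x‖) ^ k))
        (Eventually.of_forall fun η => h U u (x, η))
      rw [integral_const_mul] at h1
      rw [pow_zero, one_mul, mul_inv_le_iff₀ (by positivity)]
      exact h1.trans_eq (by ring)
    | succ N ih =>
      intro a ha
      refine ((ih ha).add (SBound.sum Finset.univ fun j _ =>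
        (ih (isSymbol_symXi hP ha j)).add ((ih ha).comp (mulCoord j)))).mono fun x u => ?_
      have key : (1 + ‖x‖) * ‖fioInt U q a u x‖ ≤ ‖fioInt U q a u x‖ + ∑ j,
          (‖fioInt U q (symXi U a j) u x‖ + ‖fioInt U q a (mulCoord j u) x‖) := by
        refine (mul_le_mul_of_nonneg_right (one_add_norm_le_sum x) (norm_nonneg _)).trans ?_
        rw [add_mul, one_mul, Finset.sum_mul]
        refine add_le_add le_rfl (Finset.sum_le_sum fun j _ => ?_)
        have h1 := congrArg norm (coord_mul_fioInt hU hP hq ha u j x)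
        rw [norm_mul, Complex.norm_real] at h1
        rw [h1]
        refine (norm_add_le _ _).trans_eq ?_
        rw [norm_mul, Complex.norm_I, one_mul]
      have h2 : 0 ≤ ((1 + ‖x‖) ^ k)⁻¹ := by positivity
      calc _ = (1 + ‖x‖) ^ N * ((1 + ‖x‖) * ‖fioInt U q a u x‖) * ((1 + ‖x‖) ^ k)⁻¹ := by ring
        _ ≤ (1 + ‖x‖) ^ N * (‖fioInt U q a u x‖ + ∑ j,
          (‖fioInt U q (symXi U a j) u x‖ + ‖fioInt U q a (mulCoord j u) x‖)) *
            ((1 + ‖x‖) ^ k)⁻¹ := by gcongr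
        _ = _ := by
          simp only [mul_add, add_mul, Finset.mul_sum, Finset.sum_mul, Finset.sum_add_distrib]
  -- Gaining `k` more powers of `1+|x|` than required cancels the loss.
  refine (key (N + k) ha).mono fun x u => le_of_eq ?_
  have h0 : (0 : ℝ) < 1 + ‖x‖ := by positivity
  rw [pow_add]
  field_simp

/-- An `x`-derivative is a sum of Fourier integrals with `q` replaced by `∂_x q` or `a` by a symbol
of order `m + 1`. The induction therefore ranges over `q`, `a` and `m`. -/
theorem rapidN_fioInt (hU : ContDiff ℝ ∞ U) (hP : IsSPlus (nonlinearPart U))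
    (hq : Function.HasTemperateGrowth q) (ha : IsSymbol m a) (n : ℕ) : RapidN n (fioInt U q a) := by
  induction n generalizing q a m with
  | zero => exact sBound_fioInt hU hP hq ha
  | succ n ih =>
    exact ⟨sBound_fioInt hU hP hq ha, _, fun j =>
      (ih (hasTemperateGrowth_pderiv hq (Sum.inl j)) ha).add (ih hq (isSymbol_symX hU hP ha j)),
      hasFDerivAt_fioInt hU hP hq ha⟩

end FourierIntegral

end

section

variable {d : ℕ}

/-! ### The operators as oscillating integrals. -/

section Operators

variable {U : Phase d → ℝ} {q : Phase d → ℂ} {a : Phase d → ℂ} {m : ℝ}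

theorem IsCutoff.continuous {ψ : Cfg d → ℂ} (h : IsCutoff ψ) : Continuous ψ := h.1.continuous

theorem IsCutoff.apply_zero {ψ : Cfg d → ℂ} (h : IsCutoff ψ) : ψ 0 = 1 := h.2.2 0 (by simp)

theorem IsCutoff.exists_norm_le {ψ : Cfg d → ℂ} (h : IsCutoff ψ) : ∃ C, 0 ≤ C ∧ ∀ η, ‖ψ η‖ ≤ C := by
  obtain ⟨C, hC⟩ := h.continuous.bounded_above_of_compact_support h.2.1
  exact ⟨C, (norm_nonneg _).trans (hC 0), hC⟩

theorem IsCutoff.hasCompactSupport_smul {ψ : Cfg d → ℂ} (h : IsCutoff ψ) {ε : ℝ} (hε : ε ≠ 0) :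
    HasCompactSupport fun η => ψ (ε • η) :=
  h.2.1.comp_homeomorph (Homeomorph.smulOfNeZero ε hε)

theorem IsCutoff.integrable_mul {ψ : Cfg d → ℂ} (h : IsCutoff ψ) {ε : ℝ} (hε : ε ≠ 0)
    {f : Cfg d → ℂ} (hf : Continuous f) : Integrable (fun η => ψ (ε • η) * f η) :=
  Continuous.integrable_of_hasCompactSupport
    ((h.continuous.comp (continuous_const_smul ε)).mul hf) (h.hasCompactSupport_smul hε).mul_right

theorem IsCutoff.integrable_norm_mul {ψ : Cfg d → ℂ} (h : IsCutoff ψ) {ε : ℝ} (hε : ε ≠ 0)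
    {f : Cfg d → ℝ} (hf : Continuous f) : Integrable (fun η => ‖ψ (ε • η)‖ * f η) :=
  Continuous.integrable_of_hasCompactSupport
    ((h.continuous.comp (continuous_const_smul ε)).norm.mul hf)
    (h.hasCompactSupport_smul hε).norm.mul_right

theorem IsCutoff.tendsto {ψ : Cfg d → ℂ} (h : IsCutoff ψ) (η : Cfg d) :
    Tendsto (fun ε : ℝ => ψ (ε • η)) (𝓝[>] 0) (𝓝 1) := by
  have h1 : Continuous fun ε : ℝ => ψ (ε • η) := h.continuous.comp (by fun_prop)
  have h2 := (h1.tendsto 0).mono_left (nhdsWithin_le_nhds (s := Ioi 0))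
  simpa [h.apply_zero] using h2

theorem IsCutoff.tendsto_integral {ψ : Cfg d → ℂ} (h : IsCutoff ψ) {f : Cfg d → ℂ}
    (hf : Integrable f) :
    Tendsto (fun ε : ℝ => ∫ η, ψ (ε • η) * f η) (𝓝[>] 0) (𝓝 (∫ η, f η)) := by
  obtain ⟨C, -, hb⟩ := h.exists_norm_le
  refine tendsto_integral_filter_of_dominated_convergence (fun η => C * ‖f η‖)
    (Eventually.of_forall fun ε => ((h.continuous.comp
      (continuous_const_smul ε)).aestronglyMeasurable.mul hf.aestronglyMeasurable))
    (Eventually.of_forall fun ε => Eventually.of_forall fun η => ?_) (hf.norm.const_mul C)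
    (Eventually.of_forall fun η => ?_)
  · rw [norm_mul]
    exact mul_le_mul_of_nonneg_right (hb _) (norm_nonneg _)
  · simpa using (h.tendsto η).mul_const (f η)

theorem fourierKernel_mul_eq (x y η : Cfg d) (u : 𝓢(Cfg d, ℂ)) :
    Complex.exp (Complex.I * ((U (x, η) - inner ℝ y η : ℝ) : ℂ)) * q (x, y) * a (x, η) * u y =
      Complex.exp (Complex.I * (U (x, η) : ℂ)) * (a (x, η) * (fourierKernel q ((x, η), y) * u y)) := by
  have h : Complex.I * ((U (x, η) - inner ℝ y η : ℝ) : ℂ) =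
      Complex.I * (U (x, η) : ℂ) + Complex.I * ((-inner ℝ y η : ℝ) : ℂ) := by
    push_cast
    ring
  rw [fourierKernel, h, Complex.exp_add]
  ring

theorem integrable_cutoff_mul_kernel (hU : Continuous U) (hq : Function.HasTemperateGrowth q)
    (ha : Continuous a) (u : 𝓢(Cfg d, ℂ)) (x : Cfg d) {ψ : Cfg d → ℂ} (hψ : IsCutoff ψ) {ε : ℝ}
    (hε : ε ≠ 0) : Integrable (fun r : Cfg d × Cfg d => ψ (ε • r.2) *
      (Complex.exp (Complex.I * ((U (x, r.2) - inner ℝ r.1 r.2 : ℝ) : ℂ)) *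
        q (x, r.1) * a (x, r.2) * u r.1)) := by
  have hac : Continuous fun η => a (x, η) := ha.comp (by fun_prop)
  have hqs := hasTemperateGrowth_slice hq x
  have hqc : Continuous q := hq.1.continuous
  have h1 : Integrable (fun r : Cfg d × Cfg d =>
      (q (x, r.1) * u r.1) * (ψ (ε • r.2) * a (x, r.2))) :=
    (integrable_temperate_mul hqs u).mul_prod (hψ.integrable_mul hε hac)
  refine h1.mono (Continuous.aestronglyMeasurable ?_) (Eventually.of_forall fun r => ?_)
  · have h2 : Continuous fun r : Cfg d × Cfg d => U (x, r.2) - inner ℝ r.1 r.2 :=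
      (hU.comp (by fun_prop)).sub (continuous_fst.inner continuous_snd)
    exact (hψ.continuous.comp (by fun_prop)).mul ((((Complex.continuous_exp.comp
      (continuous_const.mul (Complex.continuous_ofReal.comp h2))).mul
      (hqc.comp (by fun_prop))).mul (hac.comp continuous_snd)).mul (u.continuous.comp continuous_fst))
  · rw [mul_assoc, mul_assoc, norm_mul, norm_mul, mul_comm Complex.I, Complex.norm_exp_ofReal_mul_I,
      one_mul, norm_mul, norm_mul, norm_mul, norm_mul, norm_mul]
    exact le_of_eq (by ring)

theorem integral_cutoff_mul_kernel (hU : Continuous U) (hq : Function.HasTemperateGrowth q)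
    (ha : Continuous a) (u : 𝓢(Cfg d, ℂ)) (x : Cfg d) {ψ : Cfg d → ℂ} (hψ : IsCutoff ψ) {ε : ℝ}
    (hε : ε ≠ 0) : ∫ r : Cfg d × Cfg d, ψ (ε • r.2) *
      (Complex.exp (Complex.I * ((U (x, r.2) - inner ℝ r.1 r.2 : ℝ) : ℂ)) *
        q (x, r.1) * a (x, r.2) * u r.1) = ∫ η, ψ (ε • η) * fioIntegrand U q a u (x, η) := by
  rw [Measure.volume_eq_prod,
    integral_prod_symm _ (integrable_cutoff_mul_kernel hU hq ha u x hψ hε)]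
  refine integral_congr_ae (Eventually.of_forall fun η => ?_)
  dsimp only
  rw [integral_const_mul]
  simp only [fourierKernel_mul_eq]
  rw [integral_const_mul, integral_const_mul]
  rfl

/-- While the momentum cut-off is active, Fubini performs the `y`-integration and produces `qHat`.
Its decay in `η` makes the limit an instance of dominated convergence. -/
theorem hasOscIntegral_fioInt (hU : ContDiff ℝ ∞ U) (hq : Function.HasTemperateGrowth q)
    (ha : IsSymbol m a) (u : 𝓢(Cfg d, ℂ)) (x : Cfg d) : HasOscIntegral
      (fun y η => Complex.exp (Complex.I * ((U (x, η) - inner ℝ y η : ℝ) : ℂ)) *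
        q (x, y) * a (x, η) * u y) ((((2 * Real.pi) ^ d : ℝ) : ℂ)⁻¹ * fioInt U q a u x) := by
  intro ψ hψ
  refine ⟨fun ε hε => integrable_cutoff_mul_kernel hU.continuous hq ha.smooth.continuous u x hψ hε.ne',
    Tendsto.const_mul _ ?_⟩
  refine (hψ.tendsto_integral (integrable_fioIntegrand hU hq ha u x)).congr' ?_
  filter_upwards [self_mem_nhdsWithin] with ε hε
  exact (integral_cutoff_mul_kernel hU.continuous hq ha.smooth.continuous u x hψ hε.ne').symm

theorem qHat_add (hq : Function.HasTemperateGrowth q) (u v : 𝓢(Cfg d, ℂ)) (p : Phase d) :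
    qHat q (u + v) p = qHat q u p + qHat q v p := by
  have h := fun u => integrable_temperate_mul
    (hasTemperateGrowth_slice (hasTemperateGrowth_fourierKernel hq) p) u
  rw [qHat, qHat, qHat, kerInt, kerInt, kerInt, ← integral_add (h u) (h v)]
  simp [mul_add]

theorem qHat_smul (c : ℂ) (u : 𝓢(Cfg d, ℂ)) (p : Phase d) : qHat q (c • u) p = c * qHat q u p := by
  rw [qHat, qHat, kerInt, kerInt, ← integral_const_mul]
  simp [mul_left_comm]

/-- Fourier integral operators are continuous on Schwartz functions. -/
theorem exists_clm_fioInt (hU : ContDiff ℝ ∞ U) (hP : IsSPlus (nonlinearPart U))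
    (hq : Function.HasTemperateGrowth q) (ha : IsSymbol m a) :
    ∃ T : 𝓢(Cfg d, ℂ) →L[ℂ] 𝓢(Cfg d, ℂ), ∀ u x, T u x =
      (((2 * Real.pi) ^ d : ℝ) : ℂ)⁻¹ * fioInt U q a u x := by
  obtain ⟨T, hT⟩ := exists_clm_of_rapid (rapidN_fioInt hU hP hq ha)
    (fun u v x => by
      rw [fioInt, fioInt, fioInt, ← integral_add (integrable_fioIntegrand hU hq ha u x)
        (integrable_fioIntegrand hU hq ha v x)]
      simp only [fioIntegrand, qHat_add hq]
      ring_nf)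
    (fun c u x => by
      rw [fioInt, fioInt, ← integral_const_mul]
      refine integral_congr_ae (Eventually.of_forall fun η => ?_)
      simp only [fioIntegrand, qHat_smul]
      ring)
  exact ⟨(((2 * Real.pi) ^ d : ℝ) : ℂ)⁻¹ • T, fun u x => by simp [hT]⟩

theorem isMagneticFIO_of_forall_eq (hU : ContDiff ℝ ∞ U) {A : Cfg d → Cfg d}
    (hA : Function.HasTemperateGrowth A) (ha : IsSymbol m a) {T : 𝓢(Cfg d, ℂ) →L[ℂ] 𝓢(Cfg d, ℂ)}
    (hT : ∀ u x, T u x = (((2 * Real.pi) ^ d : ℝ) : ℂ)⁻¹ *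
      fioInt U (fun p => omegaA A p.1 p.2) a u x) : IsMagneticFIO A U a T := by
  intro u x
  rw [hT]
  exact hasOscIntegral_fioInt hU (hasTemperateGrowth_omegaA hA) ha u x

theorem contDiff_inner_phase : ContDiff ℝ ∞ (fun p : Phase d => (inner ℝ p.1 p.2 : ℝ)) :=
  contDiff_fst.inner ℝ contDiff_snd

theorem isSymbol_zero_real : IsSymbol m (fun _ : Phase d => (0 : ℝ)) := by
  have h : ∀ L, iterPderiv L (fun _ : Phase d => (0 : ℝ)) = fun _ => 0 := by
    intro L
    induction L with
    | nil => rfl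
    | cons i L ih =>
      rw [iterPderiv, ih]
      funext p
      simp [MagneticFIO.pderiv]
  exact ⟨contDiff_const, fun L => ⟨0, fun x ξ => by simp [h]⟩⟩

theorem isSPlus_nonlinearPart_inner :
    IsSPlus (nonlinearPart (fun p : Phase d => (inner ℝ p.1 p.2 : ℝ))) := by
  have h : nonlinearPart (fun p : Phase d => (inner ℝ p.1 p.2 : ℝ)) = fun _ => 0 := by
    funext p
    simp [nonlinearPart]
  have h2 : ∀ i, pderiv i (fun _ : Phase d => (0 : ℝ)) = fun _ => 0 := fun i => by
    funext p
    simp [pderiv]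
  rw [h]
  refine ⟨contDiff_const, fun j => ?_, fun j => ?_⟩
  · rw [h2]; exact isSymbol_zero_real
  · rw [h2]; exact isSymbol_zero_real

theorem isMagneticPsiDO_of_isMagneticFIO {A : Cfg d → Cfg d} {b : Phase d → ℂ}
    {T : 𝓢(Cfg d, ℂ) →L[ℂ] 𝓢(Cfg d, ℂ)}
    (h : IsMagneticFIO A (fun p : Phase d => (inner ℝ p.1 p.2 : ℝ)) b T) :
    IsMagneticPsiDO A b T := by
  intro u x
  have := h u x
  simp only [inner_sub_left]
  exact this

end Operators

end

section

variable {d : ℕ}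

/-! ### Fourier inversion for the partial transform. -/

section Inversion

open FourierTransform

variable {q : Phase d → ℂ}

theorem isSymbol_one : IsSymbol 0 (fun _ : Phase d => (1 : ℂ)) := by
  have h : ∀ L, L ≠ [] → iterPderiv L (fun _ : Phase d => (1 : ℂ)) = fun _ => 0 := by
    intro L
    induction L with
    | nil => simp
    | cons i L ih =>
      intro _
      funext p
      rcases eq_or_ne L [] with rfl | hL
      · simp [iterPderiv, MagneticFIO.pderiv]
      · simp [iterPderiv, ih hL, MagneticFIO.pderiv]
  refine ⟨contDiff_const, fun L => ⟨1, fun x ξ => ?_⟩⟩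
  rcases eq_or_ne L [] with rfl | hL
  · simp [iterPderiv, momentumOrder]
  · simp [h L hL]

/-- The case of zero phase and symbol `1` in `integrable_fioIntegrand`. -/
theorem integrable_qHat (hq : Function.HasTemperateGrowth q) (u : 𝓢(Cfg d, ℂ)) (x : Cfg d) :
    Integrable (fun ξ => qHat q u (x, ξ)) := by
  have h := integrable_fioIntegrand (U := fun _ => 0) contDiff_const hq isSymbol_one u x
  simpa [fioIntegrand] using h

theorem qHat_eq_fourier (hq : Function.HasTemperateGrowth q) (u : 𝓢(Cfg d, ℂ)) (x ξ : Cfg d) :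
    qHat q u (x, ξ) =
      𝓕 (SchwartzMap.smulLeftCLM ℂ (fun y => q (x, y)) u : Cfg d → ℂ) ((2 * Real.pi)⁻¹ • ξ) := by
  rw [Real.fourier_eq', qHat, kerInt]
  refine integral_congr_ae (Eventually.of_forall fun y => ?_)
  have h : -2 * Real.pi * inner ℝ y ((2 * Real.pi)⁻¹ • ξ) = -inner ℝ y ξ := by
    rw [inner_smul_right]
    field_simp
  simp only [fourierKernel, h, SchwartzMap.smulLeftCLM_apply (hasTemperateGrowth_slice hq x),
    smul_eq_mul, mul_comm Complex.I]
  ring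

/-- Fourier inversion for the partial transform. -/
theorem integral_cexp_mul_qHat (hq : Function.HasTemperateGrowth q) (u : 𝓢(Cfg d, ℂ)) (x z : Cfg d) :
    ∫ ξ, Complex.exp (Complex.I * ((inner ℝ z ξ : ℝ) : ℂ)) * qHat q u (x, ξ) =
      (((2 * Real.pi) ^ d : ℝ) : ℂ) * (q (x, z) * u z) := by
  set w := SchwartzMap.smulLeftCLM ℂ (fun y => q (x, y)) u with hw
  have h1 := Measure.integral_comp_inv_smul (volume : Measure (Cfg d))
    (fun η => Complex.exp (((2 * Real.pi * inner ℝ η z : ℝ) : ℂ) * Complex.I) * 𝓕 (w : Cfg d → ℂ) η)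
    (2 * Real.pi)
  have h2 : 𝓕⁻ (𝓕 (w : Cfg d → ℂ)) z = w z := by
    rw [← SchwartzMap.fourier_coe, ← SchwartzMap.fourierInv_coe, fourierInv_fourier_eq]
  rw [Real.fourierInv_eq'] at h2
  simp only [smul_eq_mul] at h2
  rw [h2, finrank_euclideanSpace_fin, abs_of_pos (by positivity), Complex.real_smul] at h1
  have h3 : w z = q (x, z) * u z := by
    rw [hw, SchwartzMap.smulLeftCLM_apply (hasTemperateGrowth_slice hq x)]
    rfl
  rw [← h3, ← h1]
  refine integral_congr_ae (Eventually.of_forall fun ξ => ?_)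
  have h4 : 2 * Real.pi * inner ℝ ((2 * Real.pi)⁻¹ • ξ) z = inner ℝ z ξ := by
    rw [inner_smul_left, real_inner_comm]
    simp
    field_simp
  simp only [qHat_eq_fourier hq, h4, mul_comm Complex.I, hw]

end Inversion

/-! ### Exact evaluation of oscillatory integrals with linear phase. -/

section LinearPhase

/-- The cut-off function as a Schwartz function. -/
def cutSchwartz : 𝓢(Cfg d, ℂ) := HasCompactSupport.toSchwartzMap (f := cut) cut_isCutoff.2.1 cut_isCutoff.1

/-- The Fourier transform of the cut-off function. -/
def cutHat (v : Cfg d) : ℂ := ∫ h, Complex.exp (-(Complex.I * ((inner ℝ v h : ℝ) : ℂ))) * cut h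

theorem cutHat_eq (v : Cfg d) : cutHat v = qHat (fun _ => 1) cutSchwartz (0, v) := by
  refine integral_congr_ae (Eventually.of_forall fun h => ?_)
  have : cutSchwartz h = cut h := rfl
  simp [fourierKernel, real_inner_comm, this]

theorem integrable_cutHat : Integrable (cutHat (d := d)) := by
  simp only [funext cutHat_eq]
  exact integrable_qHat (Function.HasTemperateGrowth.const 1) _ _

theorem integral_cutHat : ∫ v, cutHat (d := d) v = (((2 * Real.pi) ^ d : ℝ) : ℂ) := by
  have h := integral_cexp_mul_qHat (d := d) (q := fun _ => 1) (Function.HasTemperateGrowth.const 1)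
    cutSchwartz 0 0
  have h2 : cutSchwartz (0 : Cfg d) = 1 := cut_zero
  simp only [funext cutHat_eq]
  simpa [h2] using h

theorem integral_oscKer_mul_cut (Y : Phase d) :
    ∫ H : Phase d, oscKer (Y, H) * (cut H.1 * cut H.2) = cutHat Y.1 * cutHat Y.2 := by
  rw [cutHat, cutHat, ← integral_prod_mul]
  refine integral_congr_ae (Eventually.of_forall fun H => ?_)
  simp only [oscKer, pair_eq_inner]
  push_cast
  rw [mul_add, neg_add, Complex.exp_add]
  ring

theorem integral_affine {V F : Type*} [NormedAddCommGroup V] [NormedSpace ℝ V] [MeasurableSpace V]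
    [BorelSpace V] [FiniteDimensional ℝ V] (μ : Measure V) [μ.IsAddHaarMeasure] [NormedAddCommGroup F]
    [NormedSpace ℝ F] (f : V → F) (v : V) (r : ℝ) :
    ∫ y, f (v + r • y) ∂μ = |(r ^ Module.finrank ℝ V)⁻¹| • ∫ y, f y ∂μ := by
  rw [Measure.integral_comp_smul μ (fun y => f (v + y)), integral_add_left_eq_self f v]

/-- Change of variables `Y = Y₀ + εY'`, `H = H₀ + ε⁻¹H'`. -/
theorem integral_rescale {F : Phase d × Phase d → ℂ} (hF : Integrable F) (Y₀ H₀ : Phase d) {ε : ℝ}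
    (hε : 0 < ε) : ∫ Q, F Q = ∫ Y, ∫ H, F (Y₀ + ε • Y, H₀ + ε⁻¹ • H) := by
  rw [Measure.volume_eq_prod, integral_prod _ hF]
  simp only [fun Y => integral_affine (volume : Measure (Phase d)) (fun H => F (Y, H)) H₀ ε⁻¹]
  -- The Jacobians of the two dilations are inverse to each other, as `Y` and `H` have the same
  -- dimension.
  rw [integral_smul, integral_affine (volume : Measure (Phase d)) (fun Y => ∫ H, F (Y, H)) Y₀ ε,
    smul_smul, ← abs_mul, ← mul_inv, ← mul_pow, inv_mul_cancel₀ hε.ne']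
  simp

/-- The oscillatory integral of an amplitude whose phase is linear in the first momentum increment. -/
theorem osc_eq_of_linear_phase {μ α β : ℝ} {f : Big d → ℂ} (hf : Amp₁ μ α β f) (p : Phase d)
    (y₀ : Cfg d) {h : Phase d → ℂ} (hc : Continuous h) {C : ℝ} (hC : ∀ Y, ‖h Y‖ ≤ C)
    (hfh : ∀ Q : Phase d × Phase d, f (p, Q) =
      Complex.exp (Complex.I * ((inner ℝ y₀ Q.2.1 : ℝ) : ℂ)) * h Q.1) :
    osc f p = ((((2 * Real.pi) ^ d : ℝ) : ℂ) * (((2 * Real.pi) ^ d : ℝ) : ℂ)) * h (y₀, 0) := by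
  obtain ⟨K, hK0, hK⟩ := (cut_isCutoff (d := d)).exists_norm_le
  have hcut : Continuous (cut (d := d)) := cut_isCutoff.continuous
  -- The substitution `Y ↦ (y₀, 0) + εY`, `H ↦ (-ξ, -ξ) + ε⁻¹H` turns the momentum cut-offs `cut
  -- (ε(ξ + η))`, `cut (ε(ξ + ζ))` into fixed functions of `H` and keeps the oscillating factor. The
  -- `H`-integral is then the Fourier transform of `cut`, and `g` collects what remains; it tends to
  -- `h (y₀, 0)` as `ε → 0`.
  let g : ℝ → Phase d → ℂ := fun ε Y =>
    Complex.exp (Complex.I * ((ε * (inner ℝ (Y.1 + Y.2) p.2) : ℝ) : ℂ)) *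
      cut (ε • (y₀ + ε • Y.1)) * cut (ε • ε • Y.2) * h (y₀ + ε • Y.1, ε • Y.2)
  have hg : ∀ n, bigInt (fun q => kap (diagEps n) q * f q) p =
      ∫ Y : Phase d, g (eps n) Y * (cutHat Y.1 * cutHat Y.2) := by
    intro n
    have hε : (0 : ℝ) < eps n := by
      have : (0 : ℝ) < 1 / (n + 1) := by positivity
      exact this
    have hint : Integrable (fun Q : Phase d × Phase d =>
        oscKer Q * (kap (diagEps n) (p, Q) * f (p, Q))) :=
      integrable_of_bddSupp (f := fun q => kap (diagEps n) q * f q)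
        (((amp_kap.reindex diagEps).smooth n).mul (hf.smooth ())).continuous
        ((bddSupp_kap (fun _ => eps_ne_zero n) p).mul_right f) contDiff_oscKer.continuous
    rw [bigInt, integral_rescale hint (y₀, 0) (-p.2, -p.2) hε]
    refine integral_congr_ae (Eventually.of_forall fun Y => ?_)
    dsimp only
    rw [← integral_oscKer_mul_cut, ← integral_const_mul]
    refine integral_congr_ae (Eventually.of_forall fun H => ?_)
    have e1 : ∀ v : Cfg d, (eps n : ℝ) • (p.2 + (-p.2 + (eps n : ℝ)⁻¹ • v)) = v := fun v => by
      rw [add_neg_cancel_left, smul_inv_smul₀ hε.ne']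
    have e2 : oscKer ((y₀, 0) + (eps n : ℝ) • Y, (-p.2, -p.2) + (eps n : ℝ)⁻¹ • H) *
        Complex.exp (Complex.I * ((inner ℝ y₀ (-p.2 + (eps n : ℝ)⁻¹ • H.1) : ℝ) : ℂ)) =
        Complex.exp (Complex.I * (((eps n : ℝ) * (inner ℝ (Y.1 + Y.2) p.2) : ℝ) : ℂ)) *
          oscKer (Y, H) := by
      simp only [oscKer, ← Complex.exp_add, pair_eq_inner]
      congr 1
      rw [← mul_neg, ← mul_neg, ← mul_add, ← mul_add]
      congr 1
      norm_cast
      simp only [Prod.fst_add, Prod.snd_add, Prod.smul_fst, Prod.smul_snd, inner_add_left,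
        inner_add_right, inner_smul_left, inner_smul_right, inner_neg_right, zero_add,
        RCLike.conj_to_real]
      field_simp
      ring
    have e3 : (y₀ + (eps n : ℝ) • Y.1, (eps n : ℝ) • Y.2) = (y₀, 0) + (eps n : ℝ) • Y := by
      ext1 <;> simp
    simp only [e3, hfh, kap, diagEps, Fin.prod_univ_four, cutVar_zero, cutVar_one, cutVar_two,
      cutVar_three, Prod.fst_add, Prod.snd_add, Prod.smul_fst, Prod.smul_snd, e1, zero_add, g]
    linear_combination (cut H.1 * cut ((eps n : ℝ) • (y₀ + (eps n : ℝ) • Y.1)) * cut H.2 *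
      cut ((eps n : ℝ) • (eps n : ℝ) • Y.2) * h ((y₀, 0) + (eps n : ℝ) • Y)) * e2
  have hprod : Integrable (fun Y : Phase d => cutHat Y.1 * cutHat Y.2) :=
    integrable_cutHat.mul_prod integrable_cutHat
  have hgc : ∀ Y, Continuous fun ε => g ε Y := fun Y => by
    have h1 : Continuous fun ε : ℝ => h (y₀ + ε • Y.1, ε • Y.2) := hc.comp (by fun_prop)
    dsimp only [g]
    fun_prop
  have hgc2 : ∀ ε, Continuous (g ε) := fun ε => by
    have h1 : Continuous fun Y : Phase d => h (y₀ + ε • Y.1, ε • Y.2) := hc.comp (by fun_prop)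
    have h2 : Continuous fun Y : Phase d => inner ℝ (Y.1 + Y.2) p.2 :=
      (continuous_fst.add continuous_snd).inner continuous_const
    have h3 : Continuous fun Y : Phase d =>
        Complex.exp (Complex.I * ((ε * (inner ℝ (Y.1 + Y.2) p.2) : ℝ) : ℂ)) :=
      Complex.continuous_exp.comp (continuous_const.mul
        (Complex.continuous_ofReal.comp (continuous_const.mul h2)))
    exact ((h3.mul (hcut.comp (by fun_prop))).mul (hcut.comp (by fun_prop))).mul h1
  have hgb : ∀ ε Y, ‖g ε Y‖ ≤ K * K * C := fun ε Y => by
    simp only [g, norm_mul, mul_comm Complex.I, Complex.norm_exp_ofReal_mul_I, one_mul]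
    have := hK (ε • (y₀ + ε • Y.1))
    have := hK (ε • ε • Y.2)
    have := hC (y₀ + ε • Y.1, ε • Y.2)
    gcongr
  refine tendsto_nhds_unique (tendsto_osc hf p) ?_
  simp only [hg]
  -- Each of the two integrals of `cutHat` is `(2π)^d · cut 0 = (2π)^d`.
  have hlim : (((2 * Real.pi) ^ d : ℝ) : ℂ) * (((2 * Real.pi) ^ d : ℝ) : ℂ) * h (y₀, 0) =
      ∫ Y : Phase d, h (y₀, 0) * (cutHat Y.1 * cutHat Y.2) := by
    rw [integral_const_mul, Measure.volume_eq_prod, integral_prod_mul, integral_cutHat]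
    ring
  rw [hlim]
  refine tendsto_integral_of_dominated_convergence
    (fun Y => K * K * C * ‖cutHat Y.1 * cutHat Y.2‖)
    (fun n => (hgc2 _).aestronglyMeasurable.mul hprod.aestronglyMeasurable)
    (hprod.norm.const_mul _) (fun n => Eventually.of_forall fun Y => ?_)
    (Eventually.of_forall fun Y => ?_)
  · rw [norm_mul]
    exact mul_le_mul_of_nonneg_right (hgb _ _) (norm_nonneg _)
  · have h1 := (((hgc Y).tendsto 0).comp tendsto_eps).mul_const (cutHat Y.1 * cutHat Y.2)
    simpa [g, cut_zero] using h1

end LinearPhase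

/-! ### The leading term. -/

section ModelAmplitude

variable {U : Phase d → ℝ} {a b : Phase d → ℂ} {m' m'' : ℝ} {A : Cfg d → Cfg d}
  {B : Fin d → Fin d → Cfg d → ℝ}

theorem gradXi_apply (hU : ContDiff ℝ ∞ U) (p : Phase d) (k : Fin d) :
    gradXi U p k = pderiv (Sum.inr k) U p := by
  have h1 : HasFDerivAt (fun η => U (p.1, η))
      ((fderiv ℝ U p).comp (ContinuousLinearMap.inr ℝ (Cfg d) (Cfg d))) p.2 :=
    (hU.diff_at p).hasFDerivAt.comp p.2 (hasFDerivAt_prodMk_right p.1 p.2)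
  have h2 : gradXi U p k = inner ℝ (gradXi U p) (EuclideanSpace.single k (1 : ℝ)) := by
    simp [EuclideanSpace.inner_single_right]
  rw [h2, gradXi, gradient, InnerProductSpace.toDual_symm_apply, h1.fderiv]
  rfl

theorem contDiff_nonlinearPart (hU : ContDiff ℝ ∞ U) : ContDiff ℝ ∞ (nonlinearPart U) :=
  hU.sub contDiff_inner_phase

theorem gradXi_eq (hU : ContDiff ℝ ∞ U) (p : Phase d) :
    gradXi U p = p.1 + gradXi (nonlinearPart U) p := by
  ext k
  rw [PiLp.add_apply, gradXi_apply hU, gradXi_apply (contDiff_nonlinearPart hU),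
    pderiv_eq_add hU]
  rfl

/-- The phase is linear in `η` with frequency `∇_ξ 𝖽(x,ξ)`, so the integral localizes at `y = ∇_ξ
𝖽(x,ξ)`, `z = 0`. There `x + y = ∇_ξ U(x,ξ)` and the triangle factor is `1`. -/
theorem osc_modelAmp (hB : IsMagneticField B) (hA : IsVectorPotential A B) (hU : ContDiff ℝ ∞ U)
    (hP : IsSPlus (nonlinearPart U)) (ha : IsSymbol m'' a) (hb : IsSymbol m' b) (p : Phase d) :
    osc (modelAmp (nonlinearPart U) a b (triangle A)) p =
      ((((2 * Real.pi) ^ d : ℝ) : ℂ) * (((2 * Real.pi) ^ d : ℝ) : ℂ)) *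
        (a p * b (gradXi U p, p.2)) := by
  have hT := amp_triangle hB hA
  obtain ⟨Cb, hCb, hb'⟩ := hb.norm_le
  obtain ⟨Ct, hCt, ht⟩ := hT.bound
  have h := osc_eq_of_linear_phase (amp_modelAmp hP ha hb hT) p (gradXi (nonlinearPart U) p)
    (h := fun Y => a p * (b (p.1 + Y.1, p.2) * triangle A (p, (Y, 0))))
    (C := ‖a p‖ * (Cb * bracket p.2 ^ m' * Ct)) ?_ ?_ ?_
  · rw [h, triangle_eq_one _ rfl, mul_one, ← gradXi_eq hU]
  · have h1 : Continuous fun Y : Phase d => b (p.1 + Y.1, p.2) :=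
      hb.smooth.continuous.comp (by fun_prop)
    have h2 : Continuous fun Y : Phase d => triangle A (p, (Y, 0)) :=
      (hT.smooth ()).continuous.comp (by fun_prop)
    exact continuous_const.mul (h1.mul h2)
  · intro Y
    rw [norm_mul, norm_mul]
    have h1 := hb' (p.1 + Y.1, p.2)
    have h2 := ht () (p, (Y, 0))
    rw [wt_zero, mul_one] at h2
    have := bracket_pos p.2
    gcongr
  · intro Q
    have h1 : phaseLin (nonlinearPart U) (p, Q) = inner ℝ (gradXi (nonlinearPart U) p) Q.2.1 := by
      simp [phaseLin, PiLp.inner_apply, gradXi_apply (contDiff_nonlinearPart hU)]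
    rw [modelAmp, h1]
    rfl

end ModelAmplitude

end

section

variable {d : ℕ}

/-! ### Regularized symbols and removal of their cut-offs. -/

section RegularizedComposition

variable {U : Phase d → ℝ} {q : Phase d → ℂ} {G : Big d → ℂ} {μ α β : ℝ}

theorem integrable_bracket_mul_qHat (hq : Function.HasTemperateGrowth q) (u : 𝓢(Cfg d, ℂ)) (x : Cfg d)
    (μ : ℝ) : Integrable (fun ξ => ‖qHat q u (x, ξ)‖ * bracket ξ ^ μ) := by
  obtain ⟨k, s, -, h⟩ := exists_sBound_qHat (⌈|μ|⌉₊ + (d + 1)) hq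
  have hb : Continuous fun ξ : Cfg d => bracket ξ ^ μ :=
    Continuous.rpow_const (Real.continuous_sqrt.comp (by fun_prop)) fun ξ => Or.inl (bracket_pos ξ).ne'
  refine (integrable_decay.const_mul (s u * (1 + ‖x‖) ^ k)).mono'
    ((integrable_qHat hq u x).aestronglyMeasurable.norm.mul hb.aestronglyMeasurable)
    (Eventually.of_forall fun ξ => ?_)
  have h1 : (1 + ‖ξ‖) ^ (⌈|μ|⌉₊ + (d + 1)) * ‖qHat q u (x, ξ)‖ * ((1 + ‖x‖) ^ k)⁻¹ ≤ s u := h (x, ξ) u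
  have h0 : (0 : ℝ) < 1 + ‖ξ‖ := by positivity
  rw [mul_inv_le_iff₀ (by positivity), pow_add] at h1
  have h2 := Real.rpow_nonneg (bracket_pos ξ).le μ
  rw [Real.norm_of_nonneg (by positivity), Real.rpow_neg h0.le, Real.rpow_natCast, ← div_eq_mul_inv,
    le_div_iff₀ (pow_pos h0 _)]
  refine le_trans ?_ h1
  calc _ ≤ ‖qHat q u (x, ξ)‖ * (1 + ‖ξ‖) ^ ⌈|μ|⌉₊ * (1 + ‖ξ‖) ^ (d + 1) := by
        gcongr
        exact bracket_rpow_le μ ξ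
    _ = _ := by ring

/-- The Fourier integral with the regularized oscillatory integral of `G` as symbol. -/
def compRight (U : Phase d → ℝ) (q : Phase d → ℂ) (G : Big d → ℂ) (u : 𝓢(Cfg d, ℂ)) (x : Cfg d)
    (τ : Fin 4 → unitInterval) : ℂ :=
  ∫ ξ, qHat q u (x, ξ) *
    (Complex.exp (Complex.I * (U (x, ξ) : ℂ)) * osc (fun r => kap τ r * G r) (x, ξ))

/-- The regularized symbols are bounded by `⟨ξ⟩^μ` uniformly in the cut-off parameters, and the
rapid decay of `qHat` dominates this. -/
theorem tendsto_compRight (hU : Continuous U) (hq : Function.HasTemperateGrowth q)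
    (hG : Amp₁ μ α β G) (u : 𝓢(Cfg d, ℂ)) (x : Cfg d) {σ : ℕ → Fin 4 → unitInterval}
    {τ : Fin 4 → unitInterval} (hσ : ∀ r : Big d, ∀ᶠ n in atTop, kap (σ n) =ᶠ[𝓝 r] kap τ) :
    Tendsto (fun n => compRight U q G u x (σ n)) atTop (𝓝 (compRight U q G u x τ)) := by
  have hK : Amp μ α β (fun (τ : Fin 4 → unitInterval) r => kap τ r * G r) :=
    hG.kap_mul (fun τ => τ) fun _ => ()
  obtain ⟨C, hC, hb⟩ := exists_norm_osc_le hK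
  have hUx : Continuous fun ξ => U (x, ξ) := hU.comp (by fun_prop)
  have hexp : Continuous fun ξ => Complex.exp (Complex.I * (U (x, ξ) : ℂ)) := by fun_prop
  have hosc : ∀ τ, Continuous fun ξ => osc (fun r => kap τ r * G r) (x, ξ) := fun τ =>
    (isSymbol_osc (hK.reindex fun _ : Unit => τ)).smooth.continuous.comp (by fun_prop)
  refine tendsto_integral_of_dominated_convergence
    (fun ξ => C * (‖qHat q u (x, ξ)‖ * bracket ξ ^ μ))
    (fun n => (integrable_qHat hq u x).aestronglyMeasurable.mul
      (hexp.mul (hosc _)).aestronglyMeasurable)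
    ((integrable_bracket_mul_qHat hq u x μ).const_mul C)
    (fun n => Eventually.of_forall fun ξ => ?_) (Eventually.of_forall fun ξ => ?_)
  · rw [norm_mul, norm_mul, mul_comm Complex.I, Complex.norm_exp_ofReal_mul_I, one_mul]
    calc _ ≤ ‖qHat q u (x, ξ)‖ * (C * bracket ξ ^ μ) := by
          gcongr
          exact hb _ (x, ξ)
      _ = _ := by ring
  · refine (Tendsto.const_mul _ ?_).const_mul _
    refine osc_tendsto (hK.reindex σ) (hK.reindex fun _ : Unit => τ) (x, ξ) fun r => ?_
    filter_upwards [hσ r] with n hn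
    filter_upwards [hn] with r' hr'
    rw [hr']

theorem eventually_kap_eq (τ : Fin 4 → unitInterval) (i : Fin 4) (hi : τ i = 0) (r : Big d) :
    ∀ᶠ n in atTop, kap (Function.update τ i (eps n)) =ᶠ[𝓝 r] kap τ := by
  filter_upwards [eventually_cut_eq i r] with n hn
  filter_upwards [hn] with r' hr'
  refine Finset.prod_congr rfl fun j _ => ?_
  rcases eq_or_ne j i with rfl | hj
  · rw [Function.update_self, hr', hi]
    simp [cut_zero]
  · rw [Function.update_of_ne hj]

theorem tendsto_compRight_update (hU : Continuous U) (hq : Function.HasTemperateGrowth q)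
    (hG : Amp₁ μ α β G) (u : 𝓢(Cfg d, ℂ)) (x : Cfg d) {τ : Fin 4 → unitInterval} {i : Fin 4}
    (hi : τ i = 0) : Tendsto (fun n => compRight U q G u x (Function.update τ i (eps n))) atTop
      (𝓝 (compRight U q G u x τ)) :=
  tendsto_compRight (σ := fun n => Function.update τ i (eps n)) hU hq hG u x (eventually_kap_eq τ i hi)

end RegularizedComposition

end

section

variable {d : ℕ}

/-! ### Regrouping the integration variables. -/

section Rearrangement

/-- Passes between the grouping `((y, z), (η, ζ))` natural for amplitudes and the grouping `((y, η),
(z, ζ))` natural for the two operators. -/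
theorem measurePreserving_prodProdComm {V : Type*} [MeasurableSpace V] (μ : Measure V) [SFinite μ] :
    MeasurePreserving (fun Q : (V × V) × (V × V) => ((Q.1.1, Q.2.1), (Q.1.2, Q.2.2)))
      ((μ.prod μ).prod (μ.prod μ)) ((μ.prod μ).prod (μ.prod μ)) := by
  have hs : MeasurePreserving (Prod.swap : V × V → V × V) (μ.prod μ) (μ.prod μ) :=
    Measure.measurePreserving_swap
  have h1 := measurePreserving_prodAssoc μ μ (μ.prod μ)
  have h2 := measurePreserving_prodAssoc μ μ μ
  have h3 := (h2.comp (hs.prod (MeasurePreserving.id μ))).comp (h2.symm _)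
  exact ((h1.symm _).comp ((MeasurePreserving.id μ).prod h3)).comp h1

theorem integral_prodProdComm {V : Type*} [MeasurableSpace V] {μ : Measure V} [SFinite μ]
    {F : (V × V) × (V × V) → ℂ} (hF : Integrable F ((μ.prod μ).prod (μ.prod μ))) :
    ∫ Q, F Q ∂((μ.prod μ).prod (μ.prod μ)) =
      ∫ r, ∫ s, F ((r.1, s.1), (r.2, s.2)) ∂(μ.prod μ) ∂(μ.prod μ) := by
  have h := measurePreserving_prodProdComm μ
  have h1 : Integrable (fun Q : (V × V) × (V × V) => F ((Q.1.1, Q.2.1), (Q.1.2, Q.2.2)))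
      ((μ.prod μ).prod (μ.prod μ)) := h.integrable_comp_of_integrable hF
  rw [← integral_prod _ h1]
  have h2 := integral_map (μ := (μ.prod μ).prod (μ.prod μ)) h.measurable.aemeasurable
    (f := F) (by rw [h.map_eq]; exact hF.aestronglyMeasurable)
  rwa [h.map_eq] at h2

end Rearrangement

/-! ### The composition identity with all cut-offs active. -/

section CompositionIdentity

variable {U : Phase d → ℝ} {a b : Phase d → ℂ} {A : Cfg d → Cfg d} {μ α β : ℝ}

/-- The kernel of the outer operator, centred at `x`, with cut-offs. -/
def leftKer (U : Phase d → ℝ) (a k : Phase d → ℂ) (x : Cfg d) (s t : ℝ) (r : Cfg d × Cfg d) : ℂ :=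
  cut (s • r.2) * cut (t • r.1) *
    (Complex.exp (Complex.I * ((U (x, r.2) - inner ℝ (x + r.1) r.2 : ℝ) : ℂ)) *
      k (x, x + r.1) * a (x, r.2))

/-- The integrand of the inner operator, centred at `y`, with cut-offs. -/
def innerKer (b k : Phase d → ℂ) (u : 𝓢(Cfg d, ℂ)) (s t : ℝ) (y : Cfg d) (r : Cfg d × Cfg d) : ℂ :=
  cut (s • r.2) * cut (t • r.1) *
    (Complex.exp (Complex.I * ((inner ℝ y r.2 - inner ℝ (y + r.1) r.2 : ℝ) : ℂ)) *
      k (y, y + r.1) * b (y, r.2) * u (y + r.1))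

/-- The phase factor and the amplitude of the composition, with cut-offs. -/
def midKer (f : Phase d → ℝ) (a b : Phase d → ℂ) (Ω : Big d → ℂ) (τ : Fin 4 → unitInterval)
    (p : Phase d) (Q : Phase d × Phase d) : ℂ :=
  oscKer Q * (kap τ (p, Q) * fullAmp f a b Ω (p, Q))

/-- The two magnetic factors combine to the one for the pair `x`, `x + y + z` and the factor of the
triangle; the phases are compared at `ξ = 0`, before any momentum translation. -/
theorem leftKer_mul_innerKer (u : 𝓢(Cfg d, ℂ)) (x : Cfg d) (τ : Fin 4 → unitInterval)
    (Q : Phase d × Phase d) :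
    leftKer U a (fun p => omegaA A p.1 p.2) x (τ 0) (τ 1) (Q.1.1, Q.2.1) *
      innerKer b (fun p => omegaA A p.1 p.2) u (τ 2) (τ 3) (x + Q.1.1) (Q.1.2, Q.2.2) =
    Complex.exp (Complex.I * (U (x, 0) : ℂ)) *
      midKer (nonlinearPart U) a b (triangle A) τ (x, 0) Q *
      (omegaA A x (x + Q.1.1 + Q.1.2) * u (x + Q.1.1 + Q.1.2)) := by
  have h1 : Complex.exp (Complex.I * ((U (x, Q.2.1) - inner ℝ (x + Q.1.1) Q.2.1 : ℝ) : ℂ)) *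
      Complex.exp (Complex.I *
        ((inner ℝ (x + Q.1.1) Q.2.2 - inner ℝ (x + Q.1.1 + Q.1.2) Q.2.2 : ℝ) : ℂ)) =
      Complex.exp (Complex.I * (U (x, 0) : ℂ)) * oscKer Q *
        Complex.exp (Complex.I * (phaseDiff (nonlinearPart U) ((x, 0), Q) : ℂ)) := by
    simp only [oscKer, ← Complex.exp_add, pair_eq_inner, phaseDiff, nonlinearPart]
    congr 1
    rw [← mul_neg, ← mul_add, ← mul_add, ← mul_add]
    congr 1
    norm_cast
    simp only [zero_add, inner_add_left, inner_zero_right]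
    ring
  have h2 := omegaA_mul_omegaA (A := A) ((x, 0), Q)
  dsimp only at h2
  simp only [leftKer, innerKer, midKer, kap, Fin.prod_univ_four, cutVar_zero, cutVar_one, cutVar_two,
    cutVar_three, fullAmp, zero_add]
  linear_combination (cut ((τ 0 : ℝ) • Q.2.1) * cut ((τ 1 : ℝ) • Q.1.1) * cut ((τ 2 : ℝ) • Q.2.2) *
    cut ((τ 3 : ℝ) • Q.1.2) * a (x, Q.2.1) * b (x + Q.1.1, Q.2.2) * u (x + Q.1.1 + Q.1.2)) *
    (omegaA A x (x + Q.1.1) * omegaA A (x + Q.1.1) (x + Q.1.1 + Q.1.2) * h1 +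
      Complex.exp (Complex.I * (U (x, 0) : ℂ)) * oscKer Q *
        Complex.exp (Complex.I * (phaseDiff (nonlinearPart U) ((x, 0), Q) : ℂ)) * h2)

/-- Translating `η` and `ζ` by `ξ` changes the phase by exactly `⟨x + y + z, ξ⟩`, up to replacing
the base point `(x, 0)` by `(x, ξ)`. The cut-offs depend on `ξ + η` and `ξ + ζ` so that they follow
this translation. -/
theorem midKer_translate (x ξ : Cfg d) (τ : Fin 4 → unitInterval) (Q : Phase d × Phase d) :
    Complex.exp (Complex.I * (U (x, 0) : ℂ)) *
      midKer (nonlinearPart U) a b (triangle A) τ (x, 0) (Q + (0, (ξ, ξ))) *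
      Complex.exp (Complex.I * ((inner ℝ (x + Q.1.1 + Q.1.2) ξ : ℝ) : ℂ)) =
    Complex.exp (Complex.I * (U (x, ξ) : ℂ)) *
      midKer (nonlinearPart U) a b (triangle A) τ (x, ξ) Q := by
  have h1 : Complex.exp (Complex.I * (U (x, 0) : ℂ)) * oscKer (Q + (0, (ξ, ξ))) *
      Complex.exp (Complex.I * (phaseDiff (nonlinearPart U) ((x, 0), Q + (0, (ξ, ξ))) : ℂ)) *
      Complex.exp (Complex.I * ((inner ℝ (x + Q.1.1 + Q.1.2) ξ : ℝ) : ℂ)) =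
      Complex.exp (Complex.I * (U (x, ξ) : ℂ)) * oscKer Q *
      Complex.exp (Complex.I * (phaseDiff (nonlinearPart U) ((x, ξ), Q) : ℂ)) := by
    simp only [oscKer, ← Complex.exp_add, pair_eq_inner, phaseDiff, nonlinearPart]
    congr 1
    rw [← mul_neg, ← mul_neg, ← mul_add, ← mul_add, ← mul_add, ← mul_add, ← mul_add]
    congr 1
    norm_cast
    simp only [Prod.fst_add, Prod.snd_add, zero_add, add_zero, inner_add_left, inner_add_right,
      inner_zero_right, add_comm Q.2.1 ξ]
    ring
  have h2 : triangle A ((x, (0 : Cfg d)), Q + (0, (ξ, ξ))) = triangle A ((x, ξ), Q) := by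
    simp [triangle, flux]
  simp only [midKer, kap, Fin.prod_univ_four, cutVar_zero, cutVar_one, cutVar_two, cutVar_three,
    fullAmp, h2, Prod.fst_add, Prod.snd_add, zero_add, add_zero, add_comm Q.2.1 ξ, add_comm Q.2.2 ξ]
  linear_combination (cut ((τ 0 : ℝ) • (ξ + Q.2.1)) * cut ((τ 1 : ℝ) • Q.1.1) *
    cut ((τ 2 : ℝ) • (ξ + Q.2.2)) * cut ((τ 3 : ℝ) • Q.1.2) * a (x, ξ + Q.2.1) *
    b (x + Q.1.1, ξ + Q.2.2) * triangle A ((x, ξ), Q)) * h1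

/-- For positive cut-off parameters the composition is a Fourier integral. -/
theorem integral_leftKer_mul_innerKer (hA : Function.HasTemperateGrowth A)
    (hG : Amp₁ μ α β (fullAmp (nonlinearPart U) a b (triangle A))) (u : 𝓢(Cfg d, ℂ)) (x : Cfg d)
    {τ : Fin 4 → unitInterval} (hτ : ∀ i, τ i ≠ 0) :
    (((2 * Real.pi) ^ d : ℝ) : ℂ) *
      ∫ r, leftKer U a (fun p => omegaA A p.1 p.2) x (τ 0) (τ 1) r *
        ∫ s, innerKer b (fun p => omegaA A p.1 p.2) u (τ 2) (τ 3) (x + r.1) s =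
    compRight U (fun p => omegaA A p.1 p.2) (fullAmp (nonlinearPart U) a b (triangle A)) u x τ := by
  set k : Phase d → ℂ := fun p => omegaA A p.1 p.2 with hk
  have hkt : Function.HasTemperateGrowth k := hasTemperateGrowth_omegaA hA
  set G := fullAmp (nonlinearPart U) a b (triangle A) with hGd
  set M : Phase d × Phase d → ℂ := fun Q => Complex.exp (Complex.I * (U (x, 0) : ℂ)) *
      midKer (nonlinearPart U) a b (triangle A) τ (x, 0) Q with hM
  have hK : Continuous fun r => kap τ r * G r :=
    ((amp_kap.reindex fun _ : Unit => τ).smooth ()).continuous.mul (hG.smooth ()).continuous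
  have hs : BddSupp (x, 0) fun r => kap τ r * G r := (bddSupp_kap hτ (x, 0)).mul_right G
  have hMi : Integrable M := (integrable_of_bddSupp hK hs contDiff_oscKer.continuous).const_mul _
  have hz : Continuous fun Q : Phase d × Phase d => x + Q.1.1 + Q.1.2 := by fun_prop
  have hF : Integrable (fun Q : Phase d × Phase d =>
      M Q * (k (x, x + Q.1.1 + Q.1.2) * u (x + Q.1.1 + Q.1.2))) := by
    have hc : Continuous fun Q : Phase d × Phase d =>
        k (x, x + Q.1.1 + Q.1.2) * u (x + Q.1.1 + Q.1.2) :=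
      (hkt.1.continuous.comp (continuous_const.prodMk hz)).mul (u.continuous.comp hz)
    have := integrable_of_bddSupp hK hs ((contDiff_oscKer.continuous.mul hc).const_mul
      (Complex.exp (Complex.I * (U (x, 0) : ℂ))))
    refine this.congr (Eventually.of_forall fun Q => ?_)
    simp only [hM, midKer, hGd, Pi.mul_apply]
    ring
  have e1 : ∫ Q : Phase d × Phase d, M Q * (k (x, x + Q.1.1 + Q.1.2) * u (x + Q.1.1 + Q.1.2)) =
      ∫ r, leftKer U a k x (τ 0) (τ 1) r * ∫ s, innerKer b k u (τ 2) (τ 3) (x + r.1) s := by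
    refine (integral_prodProdComm hF).trans ?_
    refine integral_congr_ae (Eventually.of_forall fun r => ?_)
    dsimp only
    rw [← integral_const_mul]
    refine integral_congr_ae (Eventually.of_forall fun s => ?_)
    exact (leftKer_mul_innerKer u x τ ((r.1, s.1), (r.2, s.2))).symm
  -- Justifies the exchange of integrals: `M` has compact support in `Q`, `qHat` is integrable in
  -- `ξ`, and the exponential has modulus one.
  have hi : Integrable (fun W : (Phase d × Phase d) × Cfg d => M W.1 *
      (Complex.exp (Complex.I * ((inner ℝ (x + W.1.1.1 + W.1.1.2) W.2 : ℝ) : ℂ)) *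
        qHat k u (x, W.2))) (volume.prod volume) := by
    have h1 := hMi.mul_prod (integrable_qHat hkt u x)
    have hc : Continuous fun W : (Phase d × Phase d) × Cfg d =>
        Complex.exp (Complex.I * ((inner ℝ (x + W.1.1.1 + W.1.1.2) W.2 : ℝ) : ℂ)) :=
      Complex.continuous_exp.comp (continuous_const.mul (Complex.continuous_ofReal.comp
        ((hz.comp continuous_fst).inner continuous_snd)))
    refine (h1.mono (hc.aestronglyMeasurable.mul h1.aestronglyMeasurable)
      (Eventually.of_forall fun W => ?_)).congr (Eventually.of_forall fun W => ?_)
    · rw [Pi.mul_apply, norm_mul, mul_comm Complex.I, Complex.norm_exp_ofReal_mul_I, one_mul]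
    · simp only [Pi.mul_apply]
      ring
  rw [← e1, ← integral_const_mul]
  calc ∫ Q : Phase d × Phase d, (((2 * Real.pi) ^ d : ℝ) : ℂ) *
        (M Q * (k (x, x + Q.1.1 + Q.1.2) * u (x + Q.1.1 + Q.1.2)))
      = ∫ Q : Phase d × Phase d, ∫ ξ, M Q *
        (Complex.exp (Complex.I * ((inner ℝ (x + Q.1.1 + Q.1.2) ξ : ℝ) : ℂ)) * qHat k u (x, ξ)) := by
        refine integral_congr_ae (Eventually.of_forall fun Q => ?_)
        dsimp only
        -- Fourier inversion at the point `x + y + z`; this is the source of the factor `(2π)^d` on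
        -- the left.
        rw [integral_const_mul, integral_cexp_mul_qHat hkt]
        ring
    _ = ∫ ξ, ∫ Q : Phase d × Phase d, M Q *
        (Complex.exp (Complex.I * ((inner ℝ (x + Q.1.1 + Q.1.2) ξ : ℝ) : ℂ)) * qHat k u (x, ξ)) :=
        integral_integral_swap hi
    _ = _ := by
        refine integral_congr_ae (Eventually.of_forall fun ξ => ?_)
        dsimp only
        rw [osc_of_bddSupp (hG.kap_mul (fun _ => τ) fun _ => ()) ((bddSupp_kap hτ _).mul_right G),
          bigInt, ← integral_const_mul, ← integral_const_mul,
          ← integral_add_right_eq_self _ ((0, (ξ, ξ)) : Phase d × Phase d)]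
        refine integral_congr_ae (Eventually.of_forall fun Q => ?_)
        have h := midKer_translate (U := U) (a := a) (b := b) (A := A) x ξ τ Q
        simp only [hM, midKer, hGd, Prod.fst_add, add_zero] at h ⊢
        linear_combination qHat k u (x, ξ) * h

end CompositionIdentity

end

section

variable {d : ℕ}

/-! ### Removal of the cut-offs. -/

section CompositionLimit

variable {U : Phase d → ℝ} {a b k : Phase d → ℂ} {A : Cfg d → Cfg d} {m μ α β : ℝ}

theorem continuous_leftKer (hU : Continuous U) (ha : Continuous a) (hk : Continuous k) (x : Cfg d)
    (s : ℝ) : Continuous (Function.uncurry (leftKer U a k x s)) := by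
  have hc : Continuous (cut (d := d)) := cut_isCutoff.continuous
  have h1 : Continuous fun w : ℝ × (Cfg d × Cfg d) => U (x, w.2.2) - inner ℝ (x + w.2.1) w.2.2 :=
    (hU.comp (by fun_prop)).sub (Continuous.inner (by fun_prop) (by fun_prop))
  exact ((hc.comp (by fun_prop)).mul (hc.comp (by fun_prop))).mul
    (((Complex.continuous_exp.comp (continuous_const.mul (Complex.continuous_ofReal.comp h1))).mul
      (hk.comp (by fun_prop))).mul (ha.comp (by fun_prop)))

theorem continuous_innerKer (hb : Continuous b) (hk : Continuous k) (u : 𝓢(Cfg d, ℂ)) (s : ℝ) :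
    Continuous fun w : ℝ × (Cfg d × (Cfg d × Cfg d)) => innerKer b k u s w.1 w.2.1 w.2.2 := by
  have hc : Continuous (cut (d := d)) := cut_isCutoff.continuous
  have h1 : Continuous fun w : ℝ × (Cfg d × (Cfg d × Cfg d)) =>
      (inner ℝ w.2.1 w.2.2.2 : ℝ) - inner ℝ (w.2.1 + w.2.2.1) w.2.2.2 :=
    (Continuous.inner (by fun_prop) (by fun_prop)).sub (Continuous.inner (by fun_prop) (by fun_prop))
  exact ((hc.comp (by fun_prop)).mul (hc.comp (by fun_prop))).mul
    ((((Complex.continuous_exp.comp (continuous_const.mul (Complex.continuous_ofReal.comp h1))).mul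
      (hk.comp (by fun_prop))).mul (hb.comp (by fun_prop))).mul (u.continuous.comp (by fun_prop)))

theorem continuous_innerKer_prod (hb : Continuous b) (hk : Continuous k) (u : 𝓢(Cfg d, ℂ)) (s t : ℝ) :
    Continuous (Function.uncurry (innerKer b k u s t)) :=
  Continuous.comp (g := fun w : ℝ × (Cfg d × (Cfg d × Cfg d)) => innerKer b k u s w.1 w.2.1 w.2.2)
    (f := fun w => (t, w)) (continuous_innerKer hb hk u s) (continuous_const.prodMk continuous_id)

theorem continuous_innerKer_cutoff (hb : Continuous b) (hk : Continuous k) (u : 𝓢(Cfg d, ℂ)) (s : ℝ)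
    (y : Cfg d) (r : Cfg d × Cfg d) : Continuous fun t => innerKer b k u s t y r :=
  Continuous.comp (g := fun w : ℝ × (Cfg d × (Cfg d × Cfg d)) => innerKer b k u s w.1 w.2.1 w.2.2)
    (f := fun t : ℝ => (t, (y, r))) (continuous_innerKer hb hk u s)
    (continuous_id.prodMk continuous_const)

theorem norm_leftKer_le (hk1 : ∀ p, ‖k p‖ ≤ 1) (x : Cfg d) (s t : ℝ) (r : Cfg d × Cfg d) :
    ‖leftKer U a k x s t r‖ ≤ ‖cut (t • r.1)‖ * ‖cut (s • r.2) * a (x, r.2)‖ := by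
  simp only [leftKer, norm_mul, mul_comm Complex.I, Complex.norm_exp_ofReal_mul_I, one_mul]
  calc _ ≤ ‖cut (s • r.2)‖ * ‖cut (t • r.1)‖ * (1 * ‖a (x, r.2)‖) := by
        gcongr
        exact hk1 _
    _ = _ := by ring

theorem norm_innerKer_le (hk1 : ∀ p, ‖k p‖ ≤ 1) (u : 𝓢(Cfg d, ℂ)) (s t : ℝ) (y : Cfg d)
    (r : Cfg d × Cfg d) : ‖innerKer b k u s t y r‖ ≤
      ‖cut (t • r.1)‖ * ‖u (y + r.1)‖ * (‖cut (s • r.2)‖ * ‖b (y, r.2)‖) := by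
  simp only [innerKer, norm_mul, mul_comm Complex.I, Complex.norm_exp_ofReal_mul_I, one_mul]
  calc _ ≤ ‖cut (s • r.2)‖ * ‖cut (t • r.1)‖ * (1 * ‖b (y, r.2)‖ * ‖u (y + r.1)‖) := by
        gcongr
        exact hk1 _
    _ = _ := by ring

/-- One dominated convergence statement for all steps with the outer momentum still cut off: either
the inner function `V n` or the position cut-off varies, and `D` has to bound only their product. -/
theorem tendsto_integral_leftKer (hU : Continuous U) (ha : Continuous a) (hk : Continuous k)
    (hk1 : ∀ p, ‖k p‖ ≤ 1) (x : Cfg d) {s : ℝ} (hs : s ≠ 0) {t : ℕ → ℝ} {t₀ : ℝ}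
    (ht : Tendsto t atTop (𝓝 t₀)) {V : ℕ → Cfg d → ℂ} {v : Cfg d → ℂ}
    (hVm : ∀ n, StronglyMeasurable (V n)) (hV : ∀ y, Tendsto (fun n => V n y) atTop (𝓝 (v y)))
    {D : Cfg d → ℝ} (hD : Integrable D) (hDb : ∀ n y, ‖cut (t n • y)‖ * ‖V n (x + y)‖ ≤ D y) :
    Tendsto (fun n => ∫ r, leftKer U a k x s (t n) r * V n (x + r.1)) atTop
      (𝓝 (∫ r, leftKer U a k x s t₀ r * v (x + r.1))) := by
  have hL := continuous_leftKer hU ha hk x s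
  have hac : Continuous fun η => a (x, η) := ha.comp (by fun_prop)
  have hi := (cut_isCutoff (d := d)).integrable_mul hs hac
  refine tendsto_integral_of_dominated_convergence
    (fun r : Cfg d × Cfg d => D r.1 * ‖cut (s • r.2) * a (x, r.2)‖)
    (fun n => ((hL.uncurry_left (t n)).aestronglyMeasurable.mul
      ((hVm n).comp_measurable (by fun_prop)).aestronglyMeasurable))
    (hD.mul_prod hi.norm) (fun n => Eventually.of_forall fun r => ?_)
    (Eventually.of_forall fun r => ?_)
  · rw [norm_mul]
    calc _ ≤ ‖cut (t n • r.1)‖ * ‖cut (s • r.2) * a (x, r.2)‖ * ‖V n (x + r.1)‖ := by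
          gcongr
          exact norm_leftKer_le hk1 x s (t n) r
      _ = ‖cut (t n • r.1)‖ * ‖V n (x + r.1)‖ * ‖cut (s • r.2) * a (x, r.2)‖ := by ring
      _ ≤ _ := by
          gcongr
          exact hDb n r.1
  · have h1 : Continuous fun t => leftKer U a k x s t r := hL.uncurry_right r
    exact ((h1.tendsto t₀).comp ht).mul (hV (x + r.1))

theorem stronglyMeasurable_integral_innerKer (hb : Continuous b) (hk : Continuous k)
    (u : 𝓢(Cfg d, ℂ)) (s t : ℝ) : StronglyMeasurable fun y => ∫ r, innerKer b k u s t y r :=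
  (continuous_innerKer_prod hb hk u s t).stronglyMeasurable.integral_prod_right

theorem integrable_cut_mul_bracket (m : ℝ) {s : ℝ} (hs : s ≠ 0) :
    Integrable (fun ζ : Cfg d => ‖cut (s • ζ)‖ * bracket ζ ^ m) := by
  have hb : Continuous fun ξ : Cfg d => bracket ξ ^ m :=
    Continuous.rpow_const (Real.continuous_sqrt.comp (by fun_prop)) fun ξ => Or.inl (bracket_pos ξ).ne'
  exact cut_isCutoff.integrable_norm_mul hs hb

/-- Removal of the cut-off in the position variable of the inner operator. -/
theorem tendsto_integral_innerKer (hb : IsSymbol m b) (hk : Continuous k) (hk1 : ∀ p, ‖k p‖ ≤ 1)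
    (u : 𝓢(Cfg d, ℂ)) {s : ℝ} (hs : s ≠ 0) :
    (∀ y, Tendsto (fun n => ∫ r, innerKer b k u s (eps n) y r) atTop
      (𝓝 (∫ r, innerKer b k u s 0 y r))) ∧ ∃ C, ∀ t y, ‖∫ r, innerKer b k u s t y r‖ ≤ C := by
  obtain ⟨K, hK0, hK⟩ := (cut_isCutoff (d := d)).exists_norm_le
  obtain ⟨Cb, hCb, hbb⟩ := hb.norm_le
  have hD : ∀ y, Integrable (fun r : Cfg d × Cfg d =>
      K * ‖u (y + r.1)‖ * (Cb * (‖cut (s • r.2)‖ * bracket r.2 ^ m))) := fun y =>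
    (((u.integrable (μ := volume)).comp_add_left y).norm.const_mul K).mul_prod
      ((integrable_cut_mul_bracket m hs).const_mul Cb)
  have hDb : ∀ t y r, ‖innerKer b k u s t y r‖ ≤
      K * ‖u (y + r.1)‖ * (Cb * (‖cut (s • r.2)‖ * bracket r.2 ^ m)) := fun t y r => by
    refine (norm_innerKer_le hk1 u s t y r).trans ?_
    have h1 := hbb (y, r.2)
    have h2 := hK (t • r.1)
    calc _ ≤ K * ‖u (y + r.1)‖ * (‖cut (s • r.2)‖ * (Cb * bracket r.2 ^ m)) := by gcongr
      _ = _ := by ring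
  have hbc := hb.smooth.continuous
  refine ⟨fun y => ?_, K * (∫ y, ‖u y‖) * (Cb * ∫ ζ : Cfg d, ‖cut (s • ζ)‖ * bracket ζ ^ m),
    fun t y => ?_⟩
  · refine tendsto_integral_of_dominated_convergence _ (fun n => ?_) (hD y)
      (fun n => Eventually.of_forall fun r => hDb _ y r) (Eventually.of_forall fun r => ?_)
    · exact ((continuous_innerKer_prod hbc hk u s (eps n)).uncurry_left y).aestronglyMeasurable
    · exact ((continuous_innerKer_cutoff hbc hk u s y r).tendsto 0).comp tendsto_eps
  · refine (norm_integral_le_of_norm_le (hD y) (Eventually.of_forall fun r => hDb t y r)).trans_eq ?_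
    rw [Measure.volume_eq_prod, integral_prod_mul (μ := volume) (ν := volume)
      (fun z => K * ‖u (y + z)‖) fun ζ => Cb * (‖cut (s • ζ)‖ * bracket ζ ^ m),
      integral_const_mul, integral_const_mul, integral_add_left_eq_self (fun z => ‖u z‖) y]

/-- At dilation parameter `0` the position cut-off is the constant `cut 0 = 1`; a translation then
restores the uncentred kernel. -/
theorem integral_innerKer_zero (hb : Continuous b) (hk : Function.HasTemperateGrowth k)
    (u : 𝓢(Cfg d, ℂ)) {s : ℝ} (hs : s ≠ 0) (y : Cfg d) : ∫ r, innerKer b k u s 0 y r =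
      ∫ ζ, cut (s • ζ) * fioIntegrand (fun p : Phase d => (inner ℝ p.1 p.2 : ℝ)) k b u (y, ζ) := by
  rw [← integral_cutoff_mul_kernel contDiff_inner_phase.continuous hk hb u y cut_isCutoff hs]
  refine Eq.trans ?_ (integral_add_left_eq_self _ ((y, 0) : Cfg d × Cfg d))
  refine integral_congr_ae (Eventually.of_forall fun r => ?_)
  simp [innerKer, cut_zero]

theorem integral_leftKer_zero (hU : Continuous U) (ha : Continuous a)
    (hk : Function.HasTemperateGrowth k) (v : 𝓢(Cfg d, ℂ)) {s : ℝ} (hs : s ≠ 0) (x : Cfg d) :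
    ∫ r, leftKer U a k x s 0 r * v (x + r.1) = ∫ η, cut (s • η) * fioIntegrand U k a v (x, η) := by
  rw [← integral_cutoff_mul_kernel hU hk ha v x cut_isCutoff hs]
  refine Eq.trans ?_ (integral_add_left_eq_self _ ((x, 0) : Cfg d × Cfg d))
  refine integral_congr_ae (Eventually.of_forall fun r => ?_)
  simp [leftKer, cut_zero]
  ring

theorem tendsto_integral_cut_mul {f : Cfg d → ℂ} (hf : Integrable f) :
    Tendsto (fun n => ∫ η, cut ((eps n : ℝ) • η) * f η) atTop (𝓝 (∫ η, f η)) :=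
  (cut_isCutoff.tendsto_integral hf).comp tendsto_eps_gt

/-- Removal of the cut-off in the momentum variable of the inner operator. -/
theorem tendsto_integral_innerKer_zero (hb : IsSymbol m b) (hk : Function.HasTemperateGrowth k)
    (u : 𝓢(Cfg d, ℂ)) :
    (∀ y, Tendsto (fun n => ∫ r, innerKer b k u (eps n) 0 y r) atTop
      (𝓝 (fioInt (fun p : Phase d => (inner ℝ p.1 p.2 : ℝ)) k b u y))) ∧
    ∃ (C : ℝ) (N : ℕ), ∀ n y, ‖∫ r, innerKer b k u (eps n) 0 y r‖ ≤ C * (1 + ‖y‖) ^ N := by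
  obtain ⟨K, hK0, hK⟩ := (cut_isCutoff (d := d)).exists_norm_le
  obtain ⟨N, hN⟩ := exists_bound_fioIntegrand hk m
  obtain ⟨p, -, hp⟩ := hN b hb
  have h0 : ∀ n, (eps n : ℝ) ≠ 0 := fun n h => eps_ne_zero n (Subtype.ext h)
  simp only [fun n => integral_innerKer_zero hb.smooth.continuous hk u (h0 n)]
  refine ⟨fun y => tendsto_integral_cut_mul (integrable_fioIntegrand contDiff_inner_phase hk hb u y),
    K * (p u * ∫ ζ : Cfg d, (1 + ‖ζ‖) ^ (-((d + 1 : ℕ) : ℝ))), N, fun n y => ?_⟩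
  refine (norm_integral_le_of_norm_le (integrable_decay.const_mul (K * (p u * (1 + ‖y‖) ^ N)))
    (Eventually.of_forall fun ζ => ?_)).trans_eq ?_
  · rw [norm_mul, mul_assoc]
    have h1 := hK ((eps n : ℝ) • ζ)
    have h2 := hp (fun p : Phase d => (inner ℝ p.1 p.2 : ℝ)) u (y, ζ)
    gcongr
  · rw [integral_const_mul]
    ring

/-- The composition of a Fourier integral operator with a pseudodifferential operator. -/
theorem fioInt_fioInt (hU : ContDiff ℝ ∞ U) (hA : Function.HasTemperateGrowth A)
    (ha : IsSymbol μ a) (hb : IsSymbol m b) {μ' α β : ℝ}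
    (hG : Amp₁ μ' α β (fullAmp (nonlinearPart U) a b (triangle A))) (u v : 𝓢(Cfg d, ℂ))
    (hv : ∀ y, v y = fioInt (fun p : Phase d => (inner ℝ p.1 p.2 : ℝ))
      (fun p => omegaA A p.1 p.2) b u y) (x : Cfg d) :
    (((2 * Real.pi) ^ d : ℝ) : ℂ) * fioInt U (fun p => omegaA A p.1 p.2) a v x =
      fioInt U (fun p => omegaA A p.1 p.2)
        (osc (fullAmp (nonlinearPart U) a b (triangle A))) u x := by
  set C : ℂ := (((2 * Real.pi) ^ d : ℝ) : ℂ)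
  set k : Phase d → ℂ := fun p => omegaA A p.1 p.2
  have hk : Function.HasTemperateGrowth k := hasTemperateGrowth_omegaA hA
  have hk1 : ∀ p, ‖k p‖ ≤ 1 := fun p => (norm_omegaA p.1 p.2).le
  have hkc := hk.1.continuous
  have hac := ha.smooth.continuous
  have hbc := hb.smooth.continuous
  set G := fullAmp (nonlinearPart U) a b (triangle A) with hGd
  obtain ⟨K, hK0, hK⟩ := (cut_isCutoff (d := d)).exists_norm_le
  have hne : ∀ {τ : unitInterval}, τ ≠ 0 → (τ : ℝ) ≠ 0 := fun h h' => h (Subtype.ext h')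
  have hR := fun (τ : Fin 4 → unitInterval) (i : Fin 4) (hi : τ i = 0) =>
    tendsto_compRight_update hU.continuous hk hG u x hi
  have hS : ∀ τ : Fin 4 → unitInterval, (∀ i, τ i ≠ 0) →
      C * ∫ r, leftKer U a k x (τ 0) (τ 1) r * ∫ s, innerKer b k u (τ 2) (τ 3) (x + r.1) s =
        compRight U k G u x τ := fun τ hτ => integral_leftKer_mul_innerKer hA hG u x hτ
  -- The cut-offs are removed from the inside out: in `z`, then `ζ`, `y`, `η`. Each time both sides
  -- of the identity already known along `eps n` converge, and uniqueness of limits gives the next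
  -- identity.
  have s2 : ∀ τ : Fin 4 → unitInterval, τ 0 ≠ 0 → τ 1 ≠ 0 → τ 2 ≠ 0 → τ 3 = 0 →
      C * ∫ r, leftKer U a k x (τ 0) (τ 1) r * ∫ s, innerKer b k u (τ 2) 0 (x + r.1) s =
        compRight U k G u x τ := by
    intro τ h0 h1 h2 h3
    obtain ⟨hl, D, hD⟩ := tendsto_integral_innerKer hb hkc hk1 u (hne h2)
    refine tendsto_nhds_unique (Tendsto.const_mul C (tendsto_integral_leftKer hU.continuous hac hkc
      hk1 x (hne h0) tendsto_const_nhds (fun n => stronglyMeasurable_integral_innerKer hbc hkc u _ _)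
      hl (cut_isCutoff.integrable_norm_mul (hne h1) (f := fun _ => D) continuous_const) fun n y => ?_)) ((hR τ 3 h3).congr fun n => ?_)
    · exact mul_le_mul_of_nonneg_left (hD _ _) (norm_nonneg _)
    · have hσ : ∀ i, Function.update τ 3 (eps n) i ≠ 0 := by
        intro i
        fin_cases i <;> simp [Function.update, h0, h1, h2, eps_ne_zero]
      rw [← hS _ hσ]
      simp [Function.update]
  have s1 : ∀ τ : Fin 4 → unitInterval, τ 0 ≠ 0 → τ 1 ≠ 0 → τ 2 = 0 → τ 3 = 0 →
      C * ∫ r, leftKer U a k x (τ 0) (τ 1) r * v (x + r.1) = compRight U k G u x τ := by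
    intro τ h0 h1 h2 h3
    obtain ⟨hl, D, N, hD⟩ := tendsto_integral_innerKer_zero hb hk u
    simp only [← hv] at hl
    refine tendsto_nhds_unique (Tendsto.const_mul C (tendsto_integral_leftKer hU.continuous hac hkc
      hk1 x (hne h0) tendsto_const_nhds (fun n => stronglyMeasurable_integral_innerKer hbc hkc u _ _)
      -- The inner integrals are bounded only polynomially in `y`, uniformly in `n`, which suffices
      -- because `y` is still cut off.
      hl (cut_isCutoff.integrable_norm_mul (hne h1) (f := fun y => D * (1 + ‖x + y‖) ^ N) (by fun_prop)) fun n y => ?_))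
      ((hR τ 2 h2).congr fun n => ?_)
    · exact mul_le_mul_of_nonneg_left (hD _ _) (norm_nonneg _)
    · rw [← s2 _ (by simpa [Function.update] using h0) (by simpa [Function.update] using h1)
        (by simp [eps_ne_zero]) (by simpa [Function.update] using h3)]
      simp [Function.update]
  have s0 : ∀ τ : Fin 4 → unitInterval, τ 0 ≠ 0 → τ 1 = 0 → τ 2 = 0 → τ 3 = 0 →
      C * ∫ r, leftKer U a k x (τ 0) 0 r * v (x + r.1) = compRight U k G u x τ := by
    intro τ h0 h1 h2 h3
    refine tendsto_nhds_unique (Tendsto.const_mul C (tendsto_integral_leftKer hU.continuous hac hkc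
      hk1 x (hne h0) tendsto_eps (fun n => v.continuous.stronglyMeasurable)
      (fun y => tendsto_const_nhds)
      -- The inner function is by now the Schwartz function `v`, whose integrability replaces the
      -- cut-off in `y`.
      ((((v.integrable (μ := volume)).comp_add_left x).norm).const_mul K) fun n y => ?_))
      ((hR τ 1 h1).congr fun n => ?_)
    · exact mul_le_mul_of_nonneg_right (hK _) (norm_nonneg _)
    · rw [← s1 _ (by simpa [Function.update] using h0) (by simp [eps_ne_zero])
        (by simpa [Function.update] using h2) (by simpa [Function.update] using h3)]
      simp [Function.update]
  have key : C * fioInt U k a v x = compRight U k G u x 0 := by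
    refine tendsto_nhds_unique (Tendsto.const_mul C
      (tendsto_integral_cut_mul (integrable_fioIntegrand hU hk ha v x))) ((hR 0 0 rfl).congr fun n => ?_)
    rw [← s0 _ (by simp [eps_ne_zero]) (by simp [Function.update]) (by simp [Function.update])
      (by simp [Function.update]), integral_leftKer_zero hU.continuous hac hk v (hne (by simp [eps_ne_zero]))]
    simp
  have hone : (fun r => kap (d := d) 0 r * G r) = G := by
    funext r
    simp [kap, cut_zero]
  rw [key, compRight, fioInt, hone]
  refine integral_congr_ae (Eventually.of_forall fun ξ => ?_)
  simp only [fioIntegrand]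
  ring

end CompositionLimit

end

end MagneticFIO

end

/-! ### Assembly of the theorem. -/

theorem theorem4p6 (d : ℕ)
    (B : Fin d → Fin d → MagneticFIO.Cfg d → ℝ) (hB : MagneticFIO.IsMagneticField B)
    (A : MagneticFIO.Cfg d → MagneticFIO.Cfg d) (hA : MagneticFIO.IsVectorPotential A B)
    (U : MagneticFIO.Phase d → ℝ) (hU : MagneticFIO.IsGenerating U)
    (m' m'' : ℝ) (a b : MagneticFIO.Phase d → ℂ)
    (ha : MagneticFIO.IsSymbol m'' a) (hb : MagneticFIO.IsSymbol m' b) :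
    ∃ E F : 𝓢(MagneticFIO.Cfg d, ℂ) →L[ℂ] 𝓢(MagneticFIO.Cfg d, ℂ),
      MagneticFIO.IsMagneticFIO A U a E ∧ MagneticFIO.IsMagneticPsiDO A b F ∧
      ∃ c : MagneticFIO.Phase d → ℂ,
        MagneticFIO.IsSymbol (m' + m'') c ∧
        MagneticFIO.IsMagneticFIO A U c (E ∘L F) ∧
        MagneticFIO.IsSymbol (m' + m'' - 1)
          (fun p => c p - a p * b (MagneticFIO.gradXi U p, p.2)) := by
  open MagneticFIO in
  have hω := hasTemperateGrowth_omegaA hA.temperate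
  have hT := amp_triangle hB hA
  have hG := amp_fullAmp hU.sPlus ha hb hT
  have hM := amp_modelAmp hU.sPlus ha hb hT
  obtain ⟨E, hE⟩ := exists_clm_fioInt hU.smooth hU.sPlus hω ha
  obtain ⟨F, hF⟩ := exists_clm_fioInt contDiff_inner_phase isSPlus_nonlinearPart_inner hω hb
  have hc := isSymbol_osc hG
  set C : ℂ := (((2 * Real.pi) ^ d : ℝ) : ℂ) with hC
  have hC0 : C ≠ 0 := by
    rw [hC, Complex.ofReal_ne_zero]
    positivity
  -- The symbol is `(2π)^{-2d}` times the oscillatory integral: of the normalizing factors of the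
  -- two operators and of Fourier inversion, one remains as the prefactor of the resulting operator.
  have hc' := hc.const_mul (C * C)⁻¹
  refine ⟨E, F, isMagneticFIO_of_forall_eq hU.smooth hA.temperate ha hE,
    isMagneticPsiDO_of_isMagneticFIO (isMagneticFIO_of_forall_eq contDiff_inner_phase hA.temperate hb hF),
    _, hc', isMagneticFIO_of_forall_eq hU.smooth hA.temperate hc' fun u x => ?_, ?_⟩
  -- The factor `C` undoes the normalization of `F`, since the composition formula is stated for
  -- unnormalized Fourier integrals.
  · have h := fioInt_fioInt hU.smooth hA.temperate ha hb hG u (C • F u) (fun y => by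
      rw [smul_apply, hF, smul_eq_mul, mul_inv_cancel_left₀ hC0]) x
    have h2 := hE (C • F u) x
    rw [map_smul, smul_apply, smul_eq_mul, eq_inv_mul_iff_mul_eq₀ hC0] at h2
    rw [← h2] at h
    have h3 : fioInt U (fun p => omegaA A p.1 p.2) (fun p => (C * C)⁻¹ *
        osc (fullAmp (nonlinearPart U) a b (triangle A)) p) u x =
        (C * C)⁻¹ * fioInt U (fun p => omegaA A p.1 p.2)
          (osc (fullAmp (nonlinearPart U) a b (triangle A))) u x := by
      rw [fioInt, fioInt, ← MeasureTheory.integral_const_mul]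
      refine MeasureTheory.integral_congr_ae (Filter.Eventually.of_forall fun η => ?_)
      simp only [fioIntegrand]
      ring
    rw [h3, ← h, ContinuousLinearMap.comp_apply]
    field_simp
  · obtain ⟨r, hr⟩ := exists_amp_sub hU.sPlus ha hb hT
    have h := (isSymbol_osc hr).const_mul (C * C)⁻¹
    have h4 : (fun p => (C * C)⁻¹ * osc (fullAmp (nonlinearPart U) a b (triangle A)) p -
        a p * b (gradXi U p, p.2)) = fun p => (C * C)⁻¹ * osc (fun q =>
          fullAmp (nonlinearPart U) a b (triangle A) q -
          modelAmp (nonlinearPart U) a b (triangle A) q) p := by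
      funext p
      -- Both amplitudes have the same exponents, as additivity of `osc` requires.
      have h5 : ∃ β, Amp₁ (m' + m'') 0 β (fullAmp (nonlinearPart U) a b (triangle A)) ∧
        Amp₁ (m' + m'') 0 β (modelAmp (nonlinearPart U) a b (triangle A)) := ⟨_, hG, hM⟩
      obtain ⟨β, h6, h7⟩ := h5
      rw [osc_sub h6 h7, osc_modelAmp hB hA hU.smooth hU.sPlus ha hb, ← hC]
      field_simp
    rw [h4]
    exact h
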